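/- **Theorem 1 (The Fundamental Theorem).** Let $n>1$ and let $M$ be a smooth immersed hypersurface of $\mathbb R^{n+1}$, given by a smooth immersion $F:U\to\mathbb R^{n+1}$ of an open set $U\subseteq\mathbb R^n$ with a smooth unit normal field. Assume that $M$ is non-minimal, i.e. its mean curvature vanishes nowhere, and that $M$ has no umbilical points in the following sense: at no point are the principal curvatures, counted with multiplicity, of the form $k,k,0,\dots,0$ (for $n=2$ these are the usual umbilical points). *Definitions.* A *Bonnet associate* of $M$ over a connected open set $V\subseteq U$ is a smooth immersed hypersurface $M'$, given by $F':V\to\mathbb R^{n+1}$ with a smooth unit normal field, such that $F(x)\mapsto F'(x)$ is an isometry that preserves the mean curvature and is nontrivial, i.e. $F'$ is not $\Phi\circ F|_V$ for any (proper or improper) rigid motion $\Phi$ of $\mathbb R^{n+1}$. $M$ is a *Bonnet hypersurface* around $x_0\in U$ if it has a Bonnet associate over some connected open neighbourhood of $x_0$ in $U$. An *A-net* around $x_0$ is a smooth orthogonal local coordinate system $(x^1,\dots,x^n)$ around $x_0$ in which the first and second fundamental tensors satisfy $$g_{11}=g_{22},\quad g_{pp}=1,\quad b_{iq}=b_{pq}=0,\quad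 b_{12}=\varepsilon\rho\qquad(i\le 2;\ p,q\ge 3),$$ where $\varepsilon=\pm1$ is a constant and $\rho$ is either $\sum_{p=3}^n C^px^p$ with real constants $C^p$ that are not all zero, or $\rho=1$. *Claim.* For every $x_0\in U$, $M$ is a Bonnet hypersurface around $x_0$ if and only if $M$ has an A-net around $x_0$. Moreover, if $M'$ is any Bonnet associate of $M$ over a connected open set $V\subseteq U$, then around every point of $V$ there is a smooth orthogonal coordinate system $(x^1,\dots,x^n)$ in which the fundamental tensors $g,b$ of $M$ and $g',b'$ of $M'$ are $$g_{11}=g_{22}=g'_{11}=g'_{22}=\frac{\rho^2}{|\mathfrak J|\sin\theta},\qquad g_{pp}=g'_{pp}=1,$$ $$b_{11}=b'_{11}=\rho\,\frac{\mathfrak H+\mathfrak J\cos\theta}{|\mathfrak J|\sin\theta},\qquad b_{22}=b'_{22}=\rho\,\frac{\mathfrak H-\mathfrak J\cos\theta}{|\mathfrak J|\sin\theta},$$ $$b_{12}=\varepsilon\rho,\qquad b'_{12}=-\varepsilon\rho,\qquad b_{iq}=b_{pq}=b'_{iq}=b'_{pq}=0,$$ where $\rho$ is as in the definition of an A-net (either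 $\sum_{p\ge3}C^px^p$ with constants not all zero, or $1$), $\mathfrak H,\mathfrak J,\theta$ are smooth functions of $(x^1,x^2)$ alone with $\mathfrak J\ne0$ and $0<\theta<\pi$, and $\varepsilon=\operatorname{sgn}\mathfrak J=\pm1$ is constant. -/

import Mathlib

open scoped ContDiff

noncomputable section

namespace Bonnet

/-- Euclidean space `ℝⁿ`. -/
abbrev Euc (n : ℕ) : Type := EuclideanSpace ℝ (Fin n)

/-- The `A`-th coordinate vector of `ℝⁿ`. -/
def coordVec {n : ℕ} (A : Fin n) : Euc n := EuclideanSpace.single A 1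

/-- Components `g_AB = ⟨∂_A F, ∂_B F⟩` of the first fundamental form of a parametrized
hypersurface. -/
def firstForm {n : ℕ} (F : Euc n → Euc (n + 1)) (x : Euc n) : Matrix (Fin n) (Fin n) ℝ :=
  Matrix.of fun A B => inner ℝ (fderiv ℝ F x (coordVec A)) (fderiv ℝ F x (coordVec B))

/-- Components `b_AB = ⟨∂_A ∂_B F, N⟩ = ⟨L ∂_A, ∂_B⟩` of the second fundamental form with respect
to the unit normal field `N`. -/
def secondForm {n : ℕ} (F N : Euc n → Euc (n + 1)) (x : Euc n) : Matrix (Fin n) (Fin n) ℝ :=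
  Matrix.of fun A B =>
    inner ℝ (fderiv ℝ (fderiv ℝ F) x (coordVec A) (coordVec B)) (N x)

/-- The matrix `g⁻¹ b` of the shape operator in the coordinate basis. -/
def shapeMatrix {n : ℕ} (F N : Euc n → Euc (n + 1)) (x : Euc n) : Matrix (Fin n) (Fin n) ℝ :=
  (firstForm F x)⁻¹ * secondForm F N x

/-- The mean curvature. -/
def meanCurvature {n : ℕ} (F N : Euc n → Euc (n + 1)) (x : Euc n) : ℝ :=
  (shapeMatrix F N x).trace / n

/-- The principal curvatures, with multiplicities. -/
def principalCurvatures {n : ℕ} (F N : Euc n → Euc (n + 1)) (x : Euc n) : Multiset ℝ :=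
  (shapeMatrix F N x).charpoly.roots

/-- `F` is a smooth immersion of the open set `U ⊆ ℝⁿ` into `ℝⁿ⁺¹`, with smooth unit normal
field `N`. -/
structure IsHypersurface {n : ℕ} (F N : Euc n → Euc (n + 1)) (U : Set (Euc n)) : Prop where
  isOpen : IsOpen U
  smooth : ContDiffOn ℝ ∞ F U
  immersion : ∀ x ∈ U, Function.Injective (fderiv ℝ F x)
  smooth_normal : ContDiffOn ℝ ∞ N U
  norm_normal : ∀ x ∈ U, ‖N x‖ = 1
  normal_orthogonal : ∀ x ∈ U, ∀ v, inner ℝ (fderiv ℝ F x v) (N x) = 0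

/-- The principal curvatures are `k₁, k₂, 0, …, 0` with `k₁ = k₂`. For surfaces (`m = 0`) this is
an umbilical point in the usual sense. -/
def IsUmbilical {m : ℕ} (F N : Euc (m + 2) → Euc (m + 2 + 1)) (x : Euc (m + 2)) : Prop :=
  ∃ k : ℝ, principalCurvatures F N x = k ::ₘ k ::ₘ Multiset.replicate m 0

/-- `F'`, with unit normal `N'`, is a Bonnet associate of `F` over `V`: the correspondence
`F x ↦ F' x` is an isometry that preserves the mean curvature and is nontrivial, that is, it is not
induced by a (proper or improper) rigid motion of the ambient space. -/
structure IsBonnetAssociate {n : ℕ} (F N F' N' : Euc n → Euc (n + 1)) (V : Set (Euc n)) :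
    Prop where
  hypersurface : IsHypersurface F' N' V
  isometric : ∀ x ∈ V, firstForm F' x = firstForm F x
  same_mean : ∀ x ∈ V, meanCurvature F' N' x = meanCurvature F N x
  nontrivial : ¬ ∃ Φ : Euc (n + 1) ≃ᵃⁱ[ℝ] Euc (n + 1), ∀ x ∈ V, F' x = Φ (F x)

/-- `F : U → ℝⁿ⁺¹` is a Bonnet hypersurface around `x₀`: some connected open neighbourhood of `x₀`
in `U` carries a Bonnet associate. -/
def IsBonnetAt {n : ℕ} (F N : Euc n → Euc (n + 1)) (U : Set (Euc n)) (x₀ : Euc n) : Prop :=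
  ∃ V : Set (Euc n), IsOpen V ∧ IsConnected V ∧ x₀ ∈ V ∧ V ⊆ U ∧
    ∃ F' N' : Euc n → Euc (n + 1), IsBonnetAssociate F N F' N' V

/-- `c` is a smooth local coordinate system `x ↦ (x¹, …, xⁿ)` around `x₀`, defined inside `V`. -/
structure IsCoordAt {n : ℕ} (c : OpenPartialHomeomorph (Euc n) (Euc n)) (V : Set (Euc n))
    (x₀ : Euc n) : Prop where
  mem : x₀ ∈ c.source
  subset : c.source ⊆ V
  smooth : ContDiffOn ℝ ∞ c c.source
  smooth_symm : ContDiffOn ℝ ∞ c.symm c.target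

/-- First fundamental form in the coordinates `c`, at the point with coordinates `y`. -/
def gIn {n : ℕ} (F : Euc n → Euc (n + 1)) (c : OpenPartialHomeomorph (Euc n) (Euc n))
    (y : Euc n) : Matrix (Fin n) (Fin n) ℝ :=
  firstForm (F ∘ c.symm) y

/-- Second fundamental form in the coordinates `c`, at the point with coordinates `y`. -/
def bIn {n : ℕ} (F N : Euc n → Euc (n + 1)) (c : OpenPartialHomeomorph (Euc n) (Euc n))
    (y : Euc n) : Matrix (Fin n) (Fin n) ℝ :=
  secondForm (F ∘ c.symm) (N ∘ c.symm) y

/-- `ρ = ∑_{p ≥ 3} C^p x^p` with constants `C^p` that are not all zero, or `ρ = 1`.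
The coordinates `x¹, x², x³, …` are numbered `0, 1, 2, …` here. -/
def IsWeight {m : ℕ} (ρ : Euc (m + 2) → ℝ) : Prop :=
  (∃ C : Fin m → ℝ, C ≠ 0 ∧ ∀ y, ρ y = ∑ j : Fin m, C j * y j.succ.succ) ∨ ∀ y, ρ y = 1

/-- The coordinates `c` are orthogonal, with `g₁₁ = g₂₂`, `g_pp = 1`, `b_iq = b_pq = 0` and
`b₁₂ = s ρ`, where `i ≤ 2` and `p, q ≥ 3`. -/
structure IsNetWith {m : ℕ} (F N : Euc (m + 2) → Euc (m + 2 + 1))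
    (c : OpenPartialHomeomorph (Euc (m + 2)) (Euc (m + 2)))
    (ρ : Euc (m + 2) → ℝ) (s : ℝ) : Prop where
  orthogonal : ∀ y ∈ c.target, ∀ A B, A ≠ B → gIn F c y A B = 0
  g_isothermal : ∀ y ∈ c.target, gIn F c y 0 0 = gIn F c y 1 1
  g_unit : ∀ y ∈ c.target, ∀ p : Fin m, gIn F c y p.succ.succ p.succ.succ = 1
  b_null : ∀ y ∈ c.target, ∀ A, ∀ q : Fin m, bIn F N c y A q.succ.succ = 0
  b_mixed : ∀ y ∈ c.target, bIn F N c y 0 1 = s * ρ y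

/-- `F : U → ℝⁿ⁺¹` has an A-net around `x₀`. -/
def HasANetAt {m : ℕ} (F N : Euc (m + 2) → Euc (m + 2 + 1)) (U : Set (Euc (m + 2)))
    (x₀ : Euc (m + 2)) : Prop :=
  ∃ c : OpenPartialHomeomorph (Euc (m + 2)) (Euc (m + 2)), IsCoordAt c U x₀ ∧
    ∃ (ρ : Euc (m + 2) → ℝ) (ε : ℝ), IsWeight ρ ∧ (ε = 1 ∨ ε = -1) ∧ IsNetWith F N c ρ ε

/-- In the coordinates `c` the fundamental forms of `F` are
`g₁₁ = g₂₂ = ρ² / (|J| sin θ)`, `g_pp = 1`, `b₁₁ = ρ (H + J cos θ) / (|J| sin θ)`,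
`b₂₂ = ρ (H - J cos θ) / (|J| sin θ)`, `b₁₂ = s ρ`, all other components being zero, where `H, J, θ`
are functions of `(x¹, x²)`. -/
structure HasBonnetForms {m : ℕ} (F N : Euc (m + 2) → Euc (m + 2 + 1))
    (c : OpenPartialHomeomorph (Euc (m + 2)) (Euc (m + 2)))
    (ρ : Euc (m + 2) → ℝ) (H J θ : ℝ × ℝ → ℝ) (s : ℝ) : Prop where
  net : IsNetWith F N c ρ s
  g_eq : ∀ y ∈ c.target,
    gIn F c y 0 0 = ρ y ^ 2 / (|J (y 0, y 1)| * Real.sin (θ (y 0, y 1)))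
  b_eq₁ : ∀ y ∈ c.target,
    bIn F N c y 0 0 =
      ρ y * (H (y 0, y 1) + J (y 0, y 1) * Real.cos (θ (y 0, y 1))) /
        (|J (y 0, y 1)| * Real.sin (θ (y 0, y 1)))
  b_eq₂ : ∀ y ∈ c.target,
    bIn F N c y 1 1 =
      ρ y * (H (y 0, y 1) - J (y 0, y 1) * Real.cos (θ (y 0, y 1))) /
        (|J (y 0, y 1)| * Real.sin (θ (y 0, y 1)))

/-- Admissible data for the forms above on the coordinate domain `W`: `ρ` is a weight, `ε = ±1` is
the sign of `J`, `0 < θ < π`, and `H, J, θ` are smooth. -/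
structure IsBonnetData {m : ℕ} (W : Set (Euc (m + 2))) (ρ : Euc (m + 2) → ℝ)
    (H J θ : ℝ × ℝ → ℝ) (ε : ℝ) : Prop where
  weight : IsWeight ρ
  sign : ε = 1 ∨ ε = -1
  sign_J : ∀ y ∈ W, 0 < ε * J (y 0, y 1)
  angle : ∀ y ∈ W, θ (y 0, y 1) ∈ Set.Ioo 0 Real.pi
  smooth_H : ∀ y ∈ W, ContDiffAt ℝ ∞ H (y 0, y 1)
  smooth_J : ∀ y ∈ W, ContDiffAt ℝ ∞ J (y 0, y 1)
  smooth_θ : ∀ y ∈ W, ContDiffAt ℝ ∞ θ (y 0, y 1)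

end Bonnet

end

/-! ### Calculus preliminaries and the moving frame of a hypersurface -/

open scoped ContDiff

noncomputable section

namespace Bonnet

section Calculus

variable {E G H : Type*} [NormedAddCommGroup E] [NormedSpace ℝ E]
  [NormedAddCommGroup G] [NormedSpace ℝ G] [NormedAddCommGroup H] [NormedSpace ℝ H]

/-! Let L and L' be the shape operators of M and of an isometric hypersurface M' with the same mean
curvature, both read on the tangent spaces of M, and put D = L - L', S = L + L'. Since the intrinsic
curvatures agree, the two Gauss equations say that the Kulkarni–Nomizu product of D and S vanishes;
moreover D is trace-free and S has nonzero trace. This algebra alone (`exists_adaptedFrame`) forces,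
wherever D ≠ 0, an orthonormal frame in which D = diag(l, -l, 0, …), while S has the block with rows
(t, r) and (r, t) on the first two vectors and is zero on the others.

Dichotomy. Both D and S satisfy the Codazzi equation. Comparing it with the derivative of the
algebraic relation bounds the differential of q = tr D² by a multiple of q, as long as r and t stay
away from zero. Here t = tr L, and r² = 2 tr L² - (tr L)² - q/2 makes sense also at zeros of D. At a
zero that is a limit of points with D ≠ 0, the operator L still satisfies the cubic equation of an
operator of rank two; if the limit of r² were zero, that equation would make the principal
curvatures k, k, 0, …, 0. Hence the zeros of D form an open set (`eventually_D_eq_zero`), and on a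
connected set D vanishes either everywhere, so that M' is congruent to M
(`exists_affineIsometryEquiv`), or nowhere.

Net. Where D has no zeros, let Q project onto the kernel of D in the tangent space. Codazzi
expresses dQ through a single vector field A in the range of Q (`nullityField`), and the symmetry of
the second derivative of Q closes the system with a structure equation for A (`fderiv_A`). It can be
integrated explicitly. Either A vanishes near the point, Q is constant and ρ = 1, or ρ = 1/|A|
works; in both cases the range of Q has an orthonormal frame of gradients of functions ξ_p, and in
the second case ρ is a linear combination of the ξ_p (`exists_parallelFrame`). Let h₁, h₂ be unit
eigenvector fields of D for l, -l and let κ²ρ = l. Codazzi for D makes the forms κ⟨h_i, dF⟩ closed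
(`exists_potential`). With potentials y₁, y₂ the coordinates (y₁ + y₂)/2, (y₁ - y₂)/2, ξ_p have
coordinate directions along h₁ + h₂, h₁ - h₂ and the frame of the kernel. The first two are
asymptotic for D and conjugate for S. So b and b' agree except for b₁₂ = ρ = -b'₁₂ (`exists_net`).
In the remaining directions the normal is constant and the first two coordinate vectors only change
length, so g₁₁/ρ² and b_ii/ρ (i ≤ 2) are functions of x¹, x² alone; renaming them gives the three
functions of the canonical form (`NetForm.exists_forms`).

Converse. Given a net, reversing the sign of b₁₂ preserves the trace of the shape operator and the
equations of Gauss and Codazzi. The hypersurface with the new second fundamental form is found by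
deformation: solve dR = R Ω for a flat skew-symmetric connection form Ω (`exists_fderiv_eq_mul`),
then integrate R dF (`exists_deformation`). It is not congruent to M: a rigid motion multiplies b by
a factor, which must be 1 because the mean curvatures agree and are not zero, whereas b₁₂ ≠ 0 has
changed sign. -/

theorem fderiv_clm_apply_apply {c : E → G →L[ℝ] H} {u : E → G} {x : E}
    (hc : DifferentiableAt ℝ c x) (hu : DifferentiableAt ℝ u x) (X : E) :
    fderiv ℝ (fun y => c y (u y)) x X = fderiv ℝ c x X (u x) + c x (fderiv ℝ u x X) := by
  rw [fderiv_clm_apply hc hu]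
  simp [add_comm]

theorem fderiv_clm_apply_const {c : E → G →L[ℝ] H} {x : E}
    (hc : DifferentiableAt ℝ c x) (v : G) (X : E) :
    fderiv ℝ (fun y => c y v) x X = fderiv ℝ c x X v := by
  rw [fderiv_clm_apply_apply hc (differentiableAt_const v)]
  simp

/-- Two functions that agree on an open set have the same derivative there. -/
theorem fderiv_eq_of_eqOn {f g : E → G} {V : Set E} (hV : IsOpen V)
    (h : ∀ y ∈ V, f y = g y) {x : E} (hx : x ∈ V) : fderiv ℝ f x = fderiv ℝ g x :=
  Filter.EventuallyEq.fderiv_eq (Filter.eventuallyEq_of_mem (hV.mem_nhds hx) h)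

theorem _root_.ContDiffOn.differentiableAt_of_isOpen {f : E → G} {V : Set E}
    (hf : ContDiffOn ℝ ∞ f V) (hV : IsOpen V) {x : E} (hx : x ∈ V) : DifferentiableAt ℝ f x :=
  (hf.contDiffAt (hV.mem_nhds hx)).differentiableAt (by simp)

theorem _root_.ContDiffOn.fderiv_infty {f : E → G} {V : Set E}
    (hf : ContDiffOn ℝ ∞ f V) (hV : IsOpen V) : ContDiffOn ℝ ∞ (fderiv ℝ f) V :=
  hf.fderiv_of_isOpen hV (by simp)

theorem _root_.ContDiffOn.fderiv_fderiv_comm {f : E → G} {V : Set E}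
    (hf : ContDiffOn ℝ ∞ f V) (hV : IsOpen V) {x : E} (hx : x ∈ V) (X Y : E) :
    fderiv ℝ (fderiv ℝ f) x X Y = fderiv ℝ (fderiv ℝ f) x Y X :=
  ((hf.contDiffAt (hV.mem_nhds hx)).isSymmSndFDerivAt
    (by rw [minSmoothness_of_isRCLikeNormedField]; exact ENat.LEInfty.out)).eq X Y

end Calculus

section Hypersurface

variable {n : ℕ} {F N : Euc n → Euc (n + 1)} {V : Set (Euc n)} {x : Euc n}

/-- The map `(X, t) ↦ dF(X) + t N`. -/
def frameMap (F N : Euc n → Euc (n + 1)) (x : Euc n) : Euc n × ℝ →L[ℝ] Euc (n + 1) :=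
  (fderiv ℝ F x).coprod (ContinuousLinearMap.toSpanSingleton ℝ (N x))

/-- The left inverse of `dF` that annihilates the normal. -/
def tangentCoord (F N : Euc n → Euc (n + 1)) (x : Euc n) : Euc (n + 1) →L[ℝ] Euc n :=
  (ContinuousLinearMap.fst ℝ (Euc n) ℝ) ∘L (frameMap F N x).inverse

namespace IsHypersurface

theorem differentiableAt (hF : IsHypersurface F N V) (hx : x ∈ V) : DifferentiableAt ℝ F x :=
  hF.smooth.differentiableAt_of_isOpen hF.isOpen hx

theorem differentiableAt_normal (hF : IsHypersurface F N V) (hx : x ∈ V) :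
    DifferentiableAt ℝ N x :=
  hF.smooth_normal.differentiableAt_of_isOpen hF.isOpen hx

theorem differentiableAt_fderiv (hF : IsHypersurface F N V) (hx : x ∈ V) :
    DifferentiableAt ℝ (fderiv ℝ F) x :=
  (hF.smooth.fderiv_infty hF.isOpen).differentiableAt_of_isOpen hF.isOpen hx

theorem differentiableAt_fderiv_normal (hF : IsHypersurface F N V) (hx : x ∈ V) :
    DifferentiableAt ℝ (fderiv ℝ N) x :=
  (hF.smooth_normal.fderiv_infty hF.isOpen).differentiableAt_of_isOpen hF.isOpen hx

theorem mono (hF : IsHypersurface F N V) {V' : Set (Euc n)} (hV : IsOpen V') (h : V' ⊆ V) :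
    IsHypersurface F N V' :=
  ⟨hV, hF.smooth.mono h, fun x hx => hF.immersion x (h hx), hF.smooth_normal.mono h,
    fun x hx => hF.norm_normal x (h hx), fun x hx => hF.normal_orthogonal x (h hx)⟩

theorem inner_normal_self (hF : IsHypersurface F N V) (hx : x ∈ V) :
    inner ℝ (N x) (N x) = 1 := by
  rw [real_inner_self_eq_norm_sq, hF.norm_normal x hx, one_pow]

theorem inner_fderiv_normal (hF : IsHypersurface F N V) (hx : x ∈ V) (X : Euc n) :
    inner ℝ (fderiv ℝ N x X) (N x) = 0 := by
  have h := congrArg (fun L => L X) (fderiv_eq_of_eqOn hF.isOpen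
    (fun y hy => hF.inner_normal_self hy) hx)
  simp only [fderiv_inner_apply ℝ (hF.differentiableAt_normal hx) (hF.differentiableAt_normal hx)]
    at h
  simp only [fderiv_fun_const, Pi.zero_apply, zero_apply] at h
  rw [real_inner_comm] at h
  linarith

/-- `⟨∂_X ∂_Y F, N⟩ = -⟨∂_Y F, ∂_X N⟩`. -/
theorem inner_fderiv_fderiv_normal (hF : IsHypersurface F N V) (hx : x ∈ V) (X Y : Euc n) :
    inner ℝ (fderiv ℝ (fderiv ℝ F) x X Y) (N x)
      = -inner ℝ (fderiv ℝ F x Y) (fderiv ℝ N x X) := by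
  have hd := hF.differentiableAt_fderiv hx
  have h := congrArg (fun L => L X) (fderiv_eq_of_eqOn hF.isOpen
    (fun y hy => hF.normal_orthogonal y hy Y) hx)
  simp only [fderiv_inner_apply ℝ (hd.clm_apply (differentiableAt_const Y))
    (hF.differentiableAt_normal hx), fderiv_clm_apply_const hd] at h
  simp only [fderiv_fun_const, Pi.zero_apply, zero_apply] at h
  linarith

theorem frameMap_injective (hF : IsHypersurface F N V) (hx : x ∈ V) :
    Function.Injective (frameMap F N x) := by
  rw [injective_iff_map_eq_zero]
  rintro ⟨X, t⟩ h
  simp only [frameMap, ContinuousLinearMap.coprod_apply,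
    ContinuousLinearMap.toSpanSingleton_apply] at h
  have ht : t = 0 := by
    have h' := congrArg (fun v => inner ℝ v (N x)) h
    simpa [inner_add_left, hF.normal_orthogonal x hx, real_inner_smul_left,
      hF.norm_normal x hx] using h'
  subst ht
  have : X = 0 := hF.immersion x hx (by simpa using h)
  simp [this]

theorem frameMap_isInvertible (hF : IsHypersurface F N V) (hx : x ∈ V) :
    (frameMap F N x).IsInvertible := by
  have hfin : Module.finrank ℝ (Euc n × ℝ) = Module.finrank ℝ (Euc (n + 1)) := by simp
  let e := (LinearEquiv.ofInjectiveOfFinrankEq (frameMap F N x : Euc n × ℝ →ₗ[ℝ] Euc (n + 1))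
    (hF.frameMap_injective hx) hfin).toContinuousLinearEquiv
  exact ⟨e, by ext v <;> rfl⟩

theorem exists_eq_add (hF : IsHypersurface F N V) (hx : x ∈ V) (v : Euc (n + 1)) :
    ∃ (X : Euc n) (t : ℝ), v = fderiv ℝ F x X + t • N x := by
  obtain ⟨e, he⟩ := hF.frameMap_isInvertible hx
  refine ⟨(e.symm v).1, (e.symm v).2, ?_⟩
  have : frameMap F N x (e.symm v) = v := by rw [← he]; simp
  conv_lhs => rw [← this]
  simp [frameMap]

theorem tangentCoord_add (hF : IsHypersurface F N V) (hx : x ∈ V) (X : Euc n) (t : ℝ) :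
    tangentCoord F N x (fderiv ℝ F x X + t • N x) = X := by
  have h : fderiv ℝ F x X + t • N x = frameMap F N x (X, t) := by simp [frameMap]
  rw [h, tangentCoord, ContinuousLinearMap.comp_apply,
    (hF.frameMap_isInvertible hx).inverse_apply_eq.2 rfl]
  rfl

theorem tangentCoord_fderiv (hF : IsHypersurface F N V) (hx : x ∈ V) (X : Euc n) :
    tangentCoord F N x (fderiv ℝ F x X) = X := by
  simpa using hF.tangentCoord_add hx X 0

theorem tangentCoord_normal (hF : IsHypersurface F N V) (hx : x ∈ V) :
    tangentCoord F N x (N x) = 0 := by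
  simpa using hF.tangentCoord_add hx 0 1

theorem fderiv_tangentCoord (hF : IsHypersurface F N V) (hx : x ∈ V) (v : Euc (n + 1)) :
    fderiv ℝ F x (tangentCoord F N x v) = v - inner ℝ (N x) v • N x := by
  obtain ⟨X, t, rfl⟩ := hF.exists_eq_add hx v
  rw [hF.tangentCoord_add hx, inner_add_right, real_inner_comm, hF.normal_orthogonal x hx,
    real_inner_smul_right, hF.inner_normal_self hx]
  simp

theorem fderiv_tangentCoord_of_inner_eq_zero (hF : IsHypersurface F N V) (hx : x ∈ V)
    {v : Euc (n + 1)} (hv : inner ℝ (N x) v = 0) :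
    fderiv ℝ F x (tangentCoord F N x v) = v := by
  rw [hF.fderiv_tangentCoord hx, hv, zero_smul, sub_zero]

/-- Inversion of operators is smooth at invertible ones, which is why the left inverse of dF is cut
out of the inverse of the full frame map. -/
theorem contDiffOn_tangentCoord (hF : IsHypersurface F N V) :
    ContDiffOn ℝ ∞ (tangentCoord F N) V := by
  have hM : ContDiffOn ℝ ∞ (frameMap F N) V := by
    have h1 := hF.smooth.fderiv_infty hF.isOpen
    have : frameMap F N = fun x => (fderiv ℝ F x) ∘L (ContinuousLinearMap.fst ℝ (Euc n) ℝ)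
        + (ContinuousLinearMap.snd ℝ (Euc n) ℝ).smulRight (N x) := by
      ext x v <;> simp [frameMap]
    rw [this]
    exact (h1.clm_comp contDiffOn_const).add (contDiffOn_const.smulRight hF.smooth_normal)
  intro x hx
  have h2 : ContDiffWithinAt ℝ ∞ (fun x => (frameMap F N x).inverse) V x :=
    ((hF.frameMap_isInvertible hx).contDiffAt_map_inverse).comp_contDiffWithinAt x (hM x hx)
  exact contDiffWithinAt_const.clm_comp h2

/-- A vector orthogonal to the hypersurface and to its normal vanishes. -/
theorem eq_of_inner_eq (hF : IsHypersurface F N V) (hx : x ∈ V) {v w : Euc (n + 1)}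
    (hT : ∀ X, inner ℝ v (fderiv ℝ F x X) = inner ℝ w (fderiv ℝ F x X))
    (hN : inner ℝ v (N x) = inner ℝ w (N x)) : v = w := by
  refine ext_inner_right ℝ fun u => ?_
  obtain ⟨X, t, rfl⟩ := hF.exists_eq_add hx u
  rw [inner_add_right, inner_add_right, hT, real_inner_smul_right, real_inner_smul_right, hN]

theorem clm_ext {G : Type*} [NormedAddCommGroup G] [NormedSpace ℝ G]
    (hF : IsHypersurface F N V) (hx : x ∈ V) {A B : Euc (n + 1) →L[ℝ] G}
    (hT : ∀ X, A (fderiv ℝ F x X) = B (fderiv ℝ F x X)) (hN : A (N x) = B (N x)) : A = B := by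
  ext u
  obtain ⟨X, t, rfl⟩ := hF.exists_eq_add hx u
  rw [map_add, map_add, map_smul, map_smul, hT, hN]

end IsHypersurface

end Hypersurface

end Bonnet

end


/-! ### Isometric pairs: equations of Gauss and Codazzi, and rigidity -/

open scoped ContDiff

noncomputable section

namespace Bonnet

variable {n : ℕ} {F N F' N' : Euc n → Euc (n + 1)} {V : Set (Euc n)} {x : Euc n}

theorem inner_fderiv_eq_of_firstForm_eq (h : firstForm F' x = firstForm F x) (X Y : Euc n) :
    inner ℝ (fderiv ℝ F' x X) (fderiv ℝ F' x Y) = inner ℝ (fderiv ℝ F x X) (fderiv ℝ F x Y) := by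
  let b := (EuclideanSpace.basisFun (Fin n) ℝ).toBasis
  have key : (innerₗ (Euc (n + 1))).compl₁₂ (fderiv ℝ F' x).toLinearMap (fderiv ℝ F' x).toLinearMap
      = (innerₗ (Euc (n + 1))).compl₁₂ (fderiv ℝ F x).toLinearMap (fderiv ℝ F x).toLinearMap := by
    refine LinearMap.ext_basis b b fun i j => ?_
    simpa [b, firstForm, coordVec] using congrFun (congrFun h i) j
  simpa using LinearMap.congr_fun₂ key X Y

/-- The linear map of the ambient space that takes `dF` to `dF'` and `N` to `N'`. -/
def transition (F N F' N' : Euc n → Euc (n + 1)) (x : Euc n) :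
    Euc (n + 1) →L[ℝ] Euc (n + 1) :=
  fderiv ℝ F' x ∘L tangentCoord F N x + (innerSL ℝ (N x)).smulRight (N' x)

/-- The shape operator of the hypersurface `F'`, transported to the tangent spaces of `F` and
extended by zero on the normal of `F`. -/
def relShape (F N F' N' : Euc n → Euc (n + 1)) (x : Euc n) : Euc (n + 1) →L[ℝ] Euc (n + 1) :=
  -(transition F' N' F N x ∘L fderiv ℝ N' x ∘L tangentCoord F N x)

/-- Two hypersurfaces, parametrized over the same set, with the same first fundamental form. -/
structure IsometricPair (F N F' N' : Euc n → Euc (n + 1)) (V : Set (Euc n)) : Prop where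
  left : IsHypersurface F N V
  right : IsHypersurface F' N' V
  inner_eq : ∀ x ∈ V, ∀ X Y, inner ℝ (fderiv ℝ F' x X) (fderiv ℝ F' x Y)
    = inner ℝ (fderiv ℝ F x X) (fderiv ℝ F x Y)

theorem IsHypersurface.isometricPair_self (hF : IsHypersurface F N V) :
    IsometricPair F N F N V := ⟨hF, hF, fun _ _ _ _ => rfl⟩

namespace IsometricPair

theorem symm (h : IsometricPair F N F' N' V) : IsometricPair F' N' F N V :=
  ⟨h.right, h.left, fun x hx X Y => (h.inner_eq x hx X Y).symm⟩

theorem transition_fderiv (h : IsometricPair F N F' N' V) (hx : x ∈ V) (X : Euc n) :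
    transition F N F' N' x (fderiv ℝ F x X) = fderiv ℝ F' x X := by
  have : inner ℝ (N x) (fderiv ℝ F x X) = 0 := by
    rw [real_inner_comm, h.left.normal_orthogonal x hx]
  simp [transition, h.left.tangentCoord_fderiv hx, this]

theorem transition_normal (h : IsometricPair F N F' N' V) (hx : x ∈ V) :
    transition F N F' N' x (N x) = N' x := by
  simp [transition, h.left.tangentCoord_normal hx, h.left.norm_normal x hx]

theorem contDiffOn_transition (h : IsometricPair F N F' N' V) :
    ContDiffOn ℝ ∞ (transition F N F' N') V := by
  refine ((h.right.smooth.fderiv_infty h.left.isOpen).clm_comp h.left.contDiffOn_tangentCoord).add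
    (ContDiffOn.smulRight ?_ h.right.smooth_normal)
  exact (innerSL ℝ).contDiff.comp_contDiffOn h.left.smooth_normal

theorem inner_transition (h : IsometricPair F N F' N' V) (hx : x ∈ V) (v w : Euc (n + 1)) :
    inner ℝ (transition F N F' N' x v) (transition F N F' N' x w) = inner ℝ v w := by
  obtain ⟨X, s, rfl⟩ := h.left.exists_eq_add hx v
  obtain ⟨Y, t, rfl⟩ := h.left.exists_eq_add hx w
  have e1 := h.left.normal_orthogonal x hx
  have e2 := h.right.normal_orthogonal x hx
  have e3 : ∀ X, inner ℝ (N x) (fderiv ℝ F x X) = 0 := fun X => by rw [real_inner_comm, e1]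
  have e4 : ∀ X, inner ℝ (N' x) (fderiv ℝ F' x X) = 0 := fun X => by rw [real_inner_comm, e2]
  simp only [map_add, map_smul, h.transition_fderiv hx, h.transition_normal hx, inner_add_left,
    inner_add_right, real_inner_smul_left, real_inner_smul_right, e1, e2, e3, e4,
    h.inner_eq x hx, h.left.inner_normal_self hx, h.right.inner_normal_self hx]

theorem transition_transition (h : IsometricPair F N F' N' V) (hx : x ∈ V) (v : Euc (n + 1)) :
    transition F' N' F N x (transition F N F' N' x v) = v := by
  obtain ⟨X, s, rfl⟩ := h.left.exists_eq_add hx v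
  simp only [map_add, map_smul, h.transition_fderiv hx, h.transition_normal hx,
    h.symm.transition_fderiv hx, h.symm.transition_normal hx]

/-- The transition is an isometry whose inverse is the transition back, so each is the adjoint of
the other. -/
theorem inner_transition_left (h : IsometricPair F N F' N' V) (hx : x ∈ V)
    (v w : Euc (n + 1)) :
    inner ℝ (transition F' N' F N x v) w = inner ℝ v (transition F N F' N' x w) := by
  rw [← h.inner_transition hx, h.symm.transition_transition hx]

/-- Isometric hypersurfaces have the same Christoffel symbols. -/
theorem inner_fderiv_fderiv_fderiv (h : IsometricPair F N F' N' V) (hx : x ∈ V)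
    (X Y Z : Euc n) :
    inner ℝ (fderiv ℝ (fderiv ℝ F') x X Y) (fderiv ℝ F' x Z)
      = inner ℝ (fderiv ℝ (fderiv ℝ F) x X Y) (fderiv ℝ F x Z) := by
  have hd := h.left.differentiableAt_fderiv hx
  have hd' := h.right.differentiableAt_fderiv hx
  have hg : ∀ X Y Z,
      inner ℝ (fderiv ℝ F' x Y) (fderiv ℝ (fderiv ℝ F') x X Z)
        + inner ℝ (fderiv ℝ (fderiv ℝ F') x X Y) (fderiv ℝ F' x Z)
      = inner ℝ (fderiv ℝ F x Y) (fderiv ℝ (fderiv ℝ F) x X Z)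
        + inner ℝ (fderiv ℝ (fderiv ℝ F) x X Y) (fderiv ℝ F x Z) := by
    intro X Y Z
    have e := congrArg (fun L => L X) (fderiv_eq_of_eqOn h.left.isOpen
      (fun y hy => h.inner_eq y hy Y Z) hx)
    simp only [fderiv_inner_apply ℝ (hd.clm_apply (differentiableAt_const Y))
      (hd.clm_apply (differentiableAt_const Z)),
      fderiv_inner_apply ℝ (hd'.clm_apply (differentiableAt_const Y))
      (hd'.clm_apply (differentiableAt_const Z)), fderiv_clm_apply_const hd,
      fderiv_clm_apply_const hd'] at e
    exact e
  -- Koszul's argument: three permutations of the derivative of the metric, combined with the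
  -- symmetry of second derivatives, isolate a single Christoffel symbol.
  have e1 := hg X Y Z
  have e2 := hg Y X Z
  have e3 := hg Z X Y
  have hs := h.left.smooth.fderiv_fderiv_comm h.left.isOpen hx
  have hs' := h.right.smooth.fderiv_fderiv_comm h.left.isOpen hx
  rw [real_inner_comm, real_inner_comm (fderiv ℝ (fderiv ℝ F) x X Z)] at e1
  rw [real_inner_comm, real_inner_comm (fderiv ℝ (fderiv ℝ F) x Y Z), hs Y X, hs' Y X] at e2
  rw [real_inner_comm, real_inner_comm (fderiv ℝ (fderiv ℝ F) x Z Y), hs Z Y, hs' Z Y, hs Z X,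
    hs' Z X] at e3
  linarith

/-- The Gauss formulas of isometric hypersurfaces. -/
theorem fderiv_fderiv_eq (h : IsometricPair F N F' N' V) (hx : x ∈ V) (X Y : Euc n) :
    fderiv ℝ (fderiv ℝ F') x X Y
      = transition F N F' N' x (fderiv ℝ (fderiv ℝ F) x X Y)
        + (inner ℝ (fderiv ℝ (fderiv ℝ F') x X Y) (N' x)
            - inner ℝ (fderiv ℝ (fderiv ℝ F) x X Y) (N x)) • N' x := by
  refine h.right.eq_of_inner_eq hx (fun Z => ?_) ?_
  · rw [h.inner_fderiv_fderiv_fderiv hx, inner_add_left, real_inner_smul_left,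
      real_inner_comm _ (N' x), h.right.normal_orthogonal x hx, mul_zero, add_zero,
      h.symm.inner_transition_left hx, h.symm.transition_fderiv hx]
  · rw [inner_add_left, real_inner_smul_left, h.right.inner_normal_self hx,
      h.symm.inner_transition_left hx, h.symm.transition_normal hx]
    ring

/-- The Gauss equations of isometric hypersurfaces have the same left-hand side. -/
theorem inner_fderiv_fderiv_sub (h : IsometricPair F N F' N' V) (hx : x ∈ V)
    (X Y Z W : Euc n) :
    inner ℝ (fderiv ℝ (fderiv ℝ F') x Y Z) (fderiv ℝ (fderiv ℝ F') x X W)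
        - inner ℝ (fderiv ℝ (fderiv ℝ F') x Y X) (fderiv ℝ (fderiv ℝ F') x Z W)
      = inner ℝ (fderiv ℝ (fderiv ℝ F) x Y Z) (fderiv ℝ (fderiv ℝ F) x X W)
        - inner ℝ (fderiv ℝ (fderiv ℝ F) x Y X) (fderiv ℝ (fderiv ℝ F) x Z W) := by
  have third : ∀ {G : Euc n → Euc (n + 1)}, ContDiffOn ℝ ∞ G V → ∀ X Y Z,
      fderiv ℝ (fderiv ℝ (fderiv ℝ G)) x X Y Z = fderiv ℝ (fderiv ℝ (fderiv ℝ G)) x Z Y X := by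
    intro G hG X Y Z
    have hV := h.left.isOpen
    have hd := ((hG.fderiv_infty hV).fderiv_infty hV).differentiableAt_of_isOpen hV hx
    have hlast : ∀ X Y Z, fderiv ℝ (fderiv ℝ (fderiv ℝ G)) x X Y Z
        = fderiv ℝ (fderiv ℝ (fderiv ℝ G)) x X Z Y := by
      intro X Y Z
      have e := congrArg (fun L => L X) (fderiv_eq_of_eqOn hV
        (fun y hy => hG.fderiv_fderiv_comm hV hy Y Z) hx)
      have hY : ∀ Y, DifferentiableAt ℝ (fun y => fderiv ℝ (fderiv ℝ G) y Y) x :=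
        fun Y => hd.clm_apply (differentiableAt_const Y)
      simpa only [fderiv_clm_apply_const (hY _), fderiv_clm_apply_const hd] using e
    have hfirst := (hG.fderiv_infty hV).fderiv_fderiv_comm hV hx
    rw [hlast X Y Z, hfirst X Z, hlast Z X Y]
  -- This is the derivative of the equality of Christoffel symbols. Third derivatives are symmetric,
  -- so they drop out when X and Z are exchanged and the two versions subtracted.
  have key : ∀ X Y Z W,
      inner ℝ (fderiv ℝ (fderiv ℝ F') x Y Z) (fderiv ℝ (fderiv ℝ F') x X W)
        + inner ℝ (fderiv ℝ (fderiv ℝ (fderiv ℝ F')) x X Y Z) (fderiv ℝ F' x W)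
      = inner ℝ (fderiv ℝ (fderiv ℝ F) x Y Z) (fderiv ℝ (fderiv ℝ F) x X W)
        + inner ℝ (fderiv ℝ (fderiv ℝ (fderiv ℝ F)) x X Y Z) (fderiv ℝ F x W) := by
    intro X Y Z W
    have hV := h.left.isOpen
    have hd := h.left.differentiableAt_fderiv hx
    have hd' := h.right.differentiableAt_fderiv hx
    have h2 := ((h.left.smooth.fderiv_infty hV).fderiv_infty hV).differentiableAt_of_isOpen hV hx
    have h2' := ((h.right.smooth.fderiv_infty hV).fderiv_infty hV).differentiableAt_of_isOpen hV hx
    have h3 := h2.clm_apply (differentiableAt_const Y)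
    have h3' := h2'.clm_apply (differentiableAt_const Y)
    have e := congrArg (fun L => L X) (fderiv_eq_of_eqOn hV
      (fun y hy => h.inner_fderiv_fderiv_fderiv hy Y Z W) hx)
    simp only [fderiv_inner_apply ℝ (h3.clm_apply (differentiableAt_const Z))
      (hd.clm_apply (differentiableAt_const W)),
      fderiv_inner_apply ℝ (h3'.clm_apply (differentiableAt_const Z))
      (hd'.clm_apply (differentiableAt_const W)), fderiv_clm_apply_const h3,
      fderiv_clm_apply_const h2, fderiv_clm_apply_const hd, fderiv_clm_apply_const h3',
      fderiv_clm_apply_const h2', fderiv_clm_apply_const hd'] at e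
    exact e
  have e1 := key X Y Z W
  have e2 := key Z Y X W
  rw [third h.left.smooth X Y Z, third h.right.smooth X Y Z] at e1
  linarith

theorem contDiffOn_relShape (h : IsometricPair F N F' N' V) :
    ContDiffOn ℝ ∞ (relShape F N F' N') V :=
  (h.symm.contDiffOn_transition.clm_comp ((h.right.smooth_normal.fderiv_infty
    h.left.isOpen).clm_comp h.left.contDiffOn_tangentCoord)).neg

theorem relShape_fderiv (h : IsometricPair F N F' N' V) (hx : x ∈ V) (X : Euc n) :
    relShape F N F' N' x (fderiv ℝ F x X) = -transition F' N' F N x (fderiv ℝ N' x X) := by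
  simp [relShape, h.left.tangentCoord_fderiv hx]

theorem relShape_normal (h : IsometricPair F N F' N' V) (hx : x ∈ V) :
    relShape F N F' N' x (N x) = 0 := by
  simp [relShape, h.left.tangentCoord_normal hx]

theorem inner_relShape_fderiv (h : IsometricPair F N F' N' V) (hx : x ∈ V) (X Y : Euc n) :
    inner ℝ (relShape F N F' N' x (fderiv ℝ F x X)) (fderiv ℝ F x Y)
      = -inner ℝ (fderiv ℝ N' x X) (fderiv ℝ F' x Y) := by
  rw [h.relShape_fderiv hx, inner_neg_left, h.inner_transition_left hx, h.transition_fderiv hx]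

theorem inner_relShape_fderiv_eq (h : IsometricPair F N F' N' V) (hx : x ∈ V) (X Y : Euc n) :
    inner ℝ (relShape F N F' N' x (fderiv ℝ F x X)) (fderiv ℝ F x Y)
      = inner ℝ (fderiv ℝ (fderiv ℝ F') x X Y) (N' x) := by
  rw [h.inner_relShape_fderiv hx, h.right.inner_fderiv_fderiv_normal hx, real_inner_comm]

theorem inner_relShape_normal (h : IsometricPair F N F' N' V) (hx : x ∈ V)
    (v : Euc (n + 1)) : inner ℝ (relShape F N F' N' x v) (N x) = 0 := by
  obtain ⟨X, s, rfl⟩ := h.left.exists_eq_add hx v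
  rw [map_add, map_smul, h.relShape_normal hx, h.relShape_fderiv hx, smul_zero, add_zero,
    inner_neg_left, h.inner_transition_left hx, h.transition_normal hx,
    h.right.inner_fderiv_normal hx, neg_zero]

theorem relShape_add (h : IsometricPair F N F' N' V) (hx : x ∈ V) (X Y : Euc n) (s t : ℝ) :
    inner ℝ (relShape F N F' N' x (fderiv ℝ F x X + s • N x)) (fderiv ℝ F x Y + t • N x)
      = inner ℝ (fderiv ℝ (fderiv ℝ F') x X Y) (N' x) := by
  rw [inner_add_right, real_inner_smul_right, h.inner_relShape_normal hx, map_add, map_smul,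
    h.relShape_normal hx, smul_zero, add_zero, mul_zero, add_zero, h.inner_relShape_fderiv_eq hx]

theorem inner_relShape_comm (h : IsometricPair F N F' N' V) (hx : x ∈ V)
    (v w : Euc (n + 1)) :
    inner ℝ (relShape F N F' N' x v) w = inner ℝ v (relShape F N F' N' x w) := by
  obtain ⟨X, s, rfl⟩ := h.left.exists_eq_add hx v
  obtain ⟨Y, t, rfl⟩ := h.left.exists_eq_add hx w
  rw [h.relShape_add hx, real_inner_comm _ (_ + _), h.relShape_add hx,
    h.right.smooth.fderiv_fderiv_comm h.left.isOpen hx]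

/-- The Gauss equation. -/
theorem relShape_gauss (h : IsometricPair F N F' N' V) (hx : x ∈ V) (a b c d : Euc (n + 1)) :
    inner ℝ (relShape F N F' N' x a) c * inner ℝ (relShape F N F' N' x b) d
        - inner ℝ (relShape F N F' N' x a) d * inner ℝ (relShape F N F' N' x b) c
      = inner ℝ (relShape F N F N x a) c * inner ℝ (relShape F N F N x b) d
        - inner ℝ (relShape F N F N x a) d * inner ℝ (relShape F N F N x b) c := by
  obtain ⟨Y, s, rfl⟩ := h.left.exists_eq_add hx a
  obtain ⟨W, t, rfl⟩ := h.left.exists_eq_add hx b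
  obtain ⟨Z, u, rfl⟩ := h.left.exists_eq_add hx c
  obtain ⟨X, v, rfl⟩ := h.left.exists_eq_add hx d
  have h0 := h.left.isometricPair_self
  simp only [h.relShape_add hx, h0.relShape_add hx]
  have key := h.inner_fderiv_fderiv_sub hx X Y Z W
  -- By the Gauss formulas, products of second derivatives of F' and of F differ only through their
  -- normal components.
  have prod : ∀ A B C D : Euc n,
      inner ℝ (fderiv ℝ (fderiv ℝ F') x A B) (fderiv ℝ (fderiv ℝ F') x C D)
        = inner ℝ (fderiv ℝ (fderiv ℝ F) x A B) (fderiv ℝ (fderiv ℝ F) x C D)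
          + inner ℝ (fderiv ℝ (fderiv ℝ F') x A B) (N' x)
            * inner ℝ (fderiv ℝ (fderiv ℝ F') x C D) (N' x)
          - inner ℝ (fderiv ℝ (fderiv ℝ F) x A B) (N x)
            * inner ℝ (fderiv ℝ (fderiv ℝ F) x C D) (N x) := by
    intro A B C D
    rw [h.fderiv_fderiv_eq hx A B, h.fderiv_fderiv_eq hx C D]
    simp only [inner_add_left, inner_add_right, real_inner_smul_left, real_inner_smul_right,
      h.inner_transition hx, h.right.inner_normal_self hx, h.symm.inner_transition_left hx,
      h.symm.transition_normal hx, real_inner_comm _ (N' x), map_smul]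
    ring
  rw [prod, prod] at key
  have hs := h.left.smooth.fderiv_fderiv_comm h.left.isOpen hx
  have hs' := h.right.smooth.fderiv_fderiv_comm h.left.isOpen hx
  rw [hs W X, hs' W X, hs W Z, hs' W Z]
  linarith

/-- The Codazzi equation. -/
theorem relShape_codazzi (h : IsometricPair F N F' N' V) (hx : x ∈ V) (X Y Z : Euc n) :
    inner ℝ (fderiv ℝ (relShape F N F' N') x X (fderiv ℝ F x Y)) (fderiv ℝ F x Z)
      = inner ℝ (fderiv ℝ (relShape F N F' N') x Y (fderiv ℝ F x X)) (fderiv ℝ F x Z) := by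
  have hV := h.left.isOpen
  have hd := h.left.differentiableAt_fderiv hx
  have hd' := h.right.differentiableAt_fderiv hx
  have hn := h.right.differentiableAt_fderiv_normal hx
  have hL := h.contDiffOn_relShape.differentiableAt_of_isOpen hV hx
  have key : ∀ X Y,
      inner ℝ (fderiv ℝ (relShape F N F' N') x X (fderiv ℝ F x Y)) (fderiv ℝ F x Z)
      = -inner ℝ (fderiv ℝ (fderiv ℝ N') x X Y) (fderiv ℝ F' x Z)
        - inner ℝ (relShape F N F' N' x (fderiv ℝ (fderiv ℝ F) x X Y)) (fderiv ℝ F x Z) := by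
    intro X Y
    have e := congrArg (fun L => L X) (fderiv_eq_of_eqOn hV
      (fun y hy => h.inner_relShape_fderiv hy Y Z) hx)
    have hY := hd.clm_apply (differentiableAt_const Y)
    have hZ := hd.clm_apply (differentiableAt_const Z)
    have hZ' := hd'.clm_apply (differentiableAt_const Z)
    simp only [fderiv_fun_neg, neg_apply, fderiv_inner_apply ℝ (hL.clm_apply hY) hZ,
      fderiv_clm_apply_apply hL hY, fderiv_clm_apply_const hd, fderiv_clm_apply_const hn,
      fderiv_clm_apply_const hd', inner_add_left,
      fderiv_inner_apply ℝ (hn.clm_apply (differentiableAt_const Y)) hZ'] at e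
    have e2 : inner ℝ (relShape F N F' N' x (fderiv ℝ F x Y)) (fderiv ℝ (fderiv ℝ F) x X Z)
        = -inner ℝ (fderiv ℝ N' x Y) (fderiv ℝ (fderiv ℝ F') x X Z) := by
      rw [h.relShape_fderiv hx, inner_neg_left, h.inner_transition_left hx,
        h.fderiv_fderiv_eq hx X Z, inner_add_right, real_inner_smul_right,
        h.right.inner_fderiv_normal hx, mul_zero, add_zero]
    linarith
  rw [key X Y, key Y X, h.left.smooth.fderiv_fderiv_comm hV hx,
    h.right.smooth_normal.fderiv_fderiv_comm hV hx]

/-- An isometry between connected hypersurfaces that preserves the second fundamental form is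
induced by a rigid motion. -/
theorem exists_affineIsometryEquiv (h : IsometricPair F N F' N' V) (hV : IsConnected V)
    (hD : ∀ x ∈ V, relShape F N F' N' x = relShape F N F N x) :
    ∃ Φ : Euc (n + 1) ≃ᵃⁱ[ℝ] Euc (n + 1), ∀ x ∈ V, F' x = Φ (F x) := by
  have h0 := h.left.isometricPair_self
  -- With equal shape operators the Gauss and the Weingarten formulas of F are carried to those of
  -- F' without correction term, so the derivative of the transition vanishes on the frame dF, N.
  have hdR : ∀ x ∈ V, fderiv ℝ (transition F N F' N') x = 0 := by
    intro x hx
    have hR := h.contDiffOn_transition.differentiableAt_of_isOpen h.left.isOpen hx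
    ext1 X
    refine h.left.clm_ext hx (fun Y => ?_) ?_
    · have e := congrArg (fun L => L X) (fderiv_eq_of_eqOn h.left.isOpen
        (fun y hy => h.transition_fderiv hy Y) hx)
      have hd := h.left.differentiableAt_fderiv hx
      simp only [fderiv_clm_apply_apply hR (hd.clm_apply (differentiableAt_const Y)),
        fderiv_clm_apply_const hd, fderiv_clm_apply_const (h.right.differentiableAt_fderiv hx)] at e
      rw [h.fderiv_fderiv_eq hx, ← h.inner_relShape_fderiv_eq hx, hD x hx,
        h0.inner_relShape_fderiv_eq hx, sub_self, zero_smul, add_zero] at e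
      simpa using e
    · have e := congrArg (fun L => L X) (fderiv_eq_of_eqOn h.left.isOpen
        (fun y hy => h.transition_normal hy) hx)
      simp only [fderiv_clm_apply_apply hR (h.left.differentiableAt_normal hx)] at e
      have e2 := congrArg (transition F N F' N' x) (congrArg (fun L => L (fderiv ℝ F x X)) (hD x hx))
      simp only [h.relShape_fderiv hx, h0.relShape_fderiv hx, map_neg, neg_inj] at e2
      rw [h.symm.transition_transition hx] at e2
      have e3 : transition F N F N x (fderiv ℝ N x X) = fderiv ℝ N x X := by
        have : transition F N F N x = ContinuousLinearMap.id ℝ _ :=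
          h.left.clm_ext hx (fun Y => h0.transition_fderiv hx Y) (h0.transition_normal hx)
        rw [this]; rfl
      rw [e3] at e2
      rw [e2] at e
      simpa using e
  obtain ⟨x₀, hx₀⟩ := hV.nonempty
  set R := transition F N F' N' x₀ with hR
  have hconst : ∀ x ∈ V, transition F N F' N' x = R := fun x hx =>
    h.left.isOpen.is_const_of_fderiv_eq_zero (𝕜 := ℝ) hV.isPreconnected
      (fun y hy => (h.contDiffOn_transition.differentiableAt_of_isOpen h.left.isOpen
        hy).differentiableWithinAt) hdR hx hx₀
  let ι : Euc (n + 1) →ₗᵢ[ℝ] Euc (n + 1) :=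
    ⟨R.toLinearMap, fun v => by
      have := h.inner_transition hx₀ v v
      rw [real_inner_self_eq_norm_sq, real_inner_self_eq_norm_sq] at this
      exact (pow_left_inj₀ (norm_nonneg _) (norm_nonneg _) two_ne_zero).1 this⟩
  let e := ι.toLinearIsometryEquiv rfl
  have hF' : ∀ x ∈ V, F' x - R (F x) = F' x₀ - R (F x₀) := by
    intro x hx
    refine h.left.isOpen.is_const_of_fderiv_eq_zero (𝕜 := ℝ) (f := fun y => F' y - R (F y))
      hV.isPreconnected (fun y hy => ?_) (fun y hy => ?_) hx hx₀
    · exact ((h.right.differentiableAt hy).sub (R.differentiableAt.comp y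
        (h.left.differentiableAt hy))).differentiableWithinAt
    · have hc : HasFDerivAt (fun y => F' y - R (F y)) (fderiv ℝ F' y - R ∘L fderiv ℝ F y) y :=
        (h.right.differentiableAt hy).hasFDerivAt.sub
          (R.hasFDerivAt.comp y (h.left.differentiableAt hy).hasFDerivAt)
      rw [hc.fderiv]
      ext1 X
      simp [← hconst y hy, h.transition_fderiv hy]
  refine ⟨e.toAffineIsometryEquiv.trans
    (AffineIsometryEquiv.constVAdd ℝ _ (F' x₀ - R (F x₀))), fun x hx => ?_⟩
  have : e (F x) = R (F x) := rfl
  simp [this, ← hF' x hx]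

end IsometricPair

end Bonnet

end


/-! ### Traces, principal curvatures, and the operators D and S -/

open scoped ContDiff

noncomputable section

namespace Bonnet

/-- The trace, as a continuous linear functional on operators of Euclidean space. -/
def opTrace (k : ℕ) : (Euc k →L[ℝ] Euc k) →L[ℝ] ℝ :=
  LinearMap.toContinuousLinearMap (LinearMap.trace ℝ (Euc k) ∘ₗ ContinuousLinearMap.coeLM ℝ)

theorem opTrace_apply {k : ℕ} (A : Euc k →L[ℝ] Euc k) :
    opTrace k A = LinearMap.trace ℝ (Euc k) A.toLinearMap := rfl

theorem opTrace_eq_sum {k : ℕ} {ι : Type*} [Fintype ι] (A : Euc k →L[ℝ] Euc k)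
    (e : OrthonormalBasis ι ℝ (Euc k)) : opTrace k A = ∑ i, inner ℝ (e i) (A (e i)) := by
  rw [opTrace_apply, LinearMap.trace_eq_sum_inner _ e]
  rfl

variable {n : ℕ} {F N F' N' : Euc n → Euc (n + 1)} {V : Set (Euc n)} {x : Euc n}

/-- The standard basis of Euclidean space. -/
abbrev stdBasis (n : ℕ) : Module.Basis (Fin n) ℝ (Euc n) :=
  (EuclideanSpace.basisFun (Fin n) ℝ).toBasis

theorem isUnit_det_firstForm (h : Function.Injective (fderiv ℝ F x)) :
    IsUnit (firstForm F x).det := by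
  have hli : LinearIndependent ℝ fun A => fderiv ℝ F x (coordVec A) := by
    have := (stdBasis n).linearIndependent.map' (fderiv ℝ F x).toLinearMap
      (LinearMap.ker_eq_bot.2 h)
    have he : (fun A => fderiv ℝ F x (coordVec A))
        = (fderiv ℝ F x).toLinearMap ∘ (stdBasis n) := by
      ext1 A; simp [coordVec]
    rw [he]; exact this
  exact (Matrix.posDef_gram_of_linearIndependent hli).det_pos.ne'.isUnit

/-- The shape matrix is the matrix of any operator `A` with `dF ∘ A = -dN`. -/
theorem IsHypersurface.shapeMatrix_eq_toMatrix (hF : IsHypersurface F N V) (hx : x ∈ V)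
    {A : Euc n →L[ℝ] Euc n} (hA : ∀ X, fderiv ℝ F x (A X) = -fderiv ℝ N x X) :
    shapeMatrix F N x = LinearMap.toMatrix (stdBasis n) (stdBasis n) A.toLinearMap := by
  have hG := isUnit_det_firstForm (hF.immersion x hx)
  have key : firstForm F x * LinearMap.toMatrix (stdBasis n) (stdBasis n) A.toLinearMap
      = secondForm F N x := by
    ext i j
    have hsum : A (coordVec j) = ∑ k, (A (coordVec j)) k • coordVec k := by
      conv_lhs => rw [← (EuclideanSpace.basisFun (Fin n) ℝ).sum_repr (A (coordVec j))]
      simp [coordVec]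
    have h1 : inner ℝ (fderiv ℝ F x (coordVec i)) (fderiv ℝ F x (A (coordVec j)))
        = secondForm F N x i j := by
      rw [hA, inner_neg_right, ← hF.inner_fderiv_fderiv_normal hx]
      simp only [secondForm, Matrix.of_apply]
      rw [hF.smooth.fderiv_fderiv_comm hF.isOpen hx]
    rw [← h1]
    conv_rhs => rw [hsum]
    simp [Matrix.mul_apply, LinearMap.toMatrix_apply, firstForm, inner_sum,
      real_inner_smul_right, mul_comm, coordVec]
  rw [shapeMatrix, ← key, ← Matrix.mul_assoc, Matrix.nonsing_inv_mul _ hG, Matrix.one_mul]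

theorem IsHypersurface.fderiv_neg_tangentCoord (hF : IsHypersurface F N V) (hx : x ∈ V)
    (X : Euc n) :
    fderiv ℝ F x ((-(tangentCoord F N x ∘L fderiv ℝ N x)) X) = -fderiv ℝ N x X := by
  rw [neg_apply, map_neg, ContinuousLinearMap.comp_apply,
    hF.fderiv_tangentCoord_of_inner_eq_zero hx]
  rw [real_inner_comm, hF.inner_fderiv_normal hx]

/-- Cyclicity of the trace: `relShape` is dF ∘ A ∘ `tangentCoord` for the shape operator A of F' in
the parameter space, and `tangentCoord` ∘ dF is the identity. -/
theorem IsometricPair.opTrace_relShape (h : IsometricPair F N F' N' V) (hx : x ∈ V) :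
    opTrace (n + 1) (relShape F N F' N' x) = (shapeMatrix F' N' x).trace := by
  rw [h.right.shapeMatrix_eq_toMatrix hx (h.right.fderiv_neg_tangentCoord hx),
    ← LinearMap.trace_eq_matrix_trace ℝ, opTrace_apply]
  have e1 : (relShape F N F' N' x).toLinearMap
      = (fderiv ℝ F x ∘L (-(tangentCoord F' N' x ∘L fderiv ℝ N' x))).toLinearMap ∘ₗ
        (tangentCoord F N x).toLinearMap := by
    ext1 v
    have := h.right.inner_fderiv_normal hx (tangentCoord F N x v)
    rw [real_inner_comm] at this
    simp [relShape, transition, this]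
  rw [e1, ← LinearMap.trace_comp_comm']
  congr 1
  ext1 X
  simp [h.left.tangentCoord_fderiv hx]

theorem IsHypersurface.relShape_self (hF : IsHypersurface F N V) (hx : x ∈ V) :
    relShape F N F N x = -(fderiv ℝ N x ∘L tangentCoord F N x) := by
  have h := hF.isometricPair_self
  have : transition F N F N x = ContinuousLinearMap.id ℝ _ :=
    hF.clm_ext hx (fun Y => h.transition_fderiv hx Y) (h.transition_normal hx)
  rw [relShape, this, ContinuousLinearMap.id_comp]

theorem IsHypersurface.fderiv_normal_eq (hF : IsHypersurface F N V) (hx : x ∈ V) (X : Euc n) :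
    fderiv ℝ N x X = -relShape F N F N x (fderiv ℝ F x X) := by
  rw [hF.relShape_self hx]
  simp [hF.tangentCoord_fderiv hx]

/-- Products BC and CB of rectangular matrices have the same characteristic polynomial up to a power
of X. The additional factor X is the eigenvalue zero on the normal. -/
theorem IsHypersurface.charpoly_relShape (hF : IsHypersurface F N V) (hx : x ∈ V) :
    (relShape F N F N x).toLinearMap.charpoly = Polynomial.X * (shapeMatrix F N x).charpoly := by
  rw [hF.shapeMatrix_eq_toMatrix hx (hF.fderiv_neg_tangentCoord hx),
    ← LinearMap.charpoly_toMatrix _ (stdBasis (n + 1)), hF.relShape_self hx]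
  have e1 : (-(fderiv ℝ N x ∘L tangentCoord F N x)).toLinearMap
      = (-(fderiv ℝ N x)).toLinearMap ∘ₗ (tangentCoord F N x).toLinearMap := by
    ext1 v; simp
  have e2 : (-(tangentCoord F N x ∘L fderiv ℝ N x)).toLinearMap
      = (tangentCoord F N x).toLinearMap ∘ₗ (-(fderiv ℝ N x)).toLinearMap := by
    ext1 v; simp
  rw [e1, e2, LinearMap.toMatrix_comp _ (stdBasis n), LinearMap.toMatrix_comp _ (stdBasis (n + 1))]
  have key := Matrix.charpoly_mul_comm'
    (LinearMap.toMatrix (stdBasis n) (stdBasis (n + 1)) (-(fderiv ℝ N x)).toLinearMap)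
    (LinearMap.toMatrix (stdBasis (n + 1)) (stdBasis n) (tangentCoord F N x).toLinearMap)
  simp only [Fintype.card_fin, pow_succ, mul_assoc] at key
  exact mul_left_cancel₀ (pow_ne_zero n Polynomial.X_ne_zero) key

/-- If the shape operator `L` has trace `2k ≠ 0` and satisfies `L (L - k)² = 0`, then the principal
curvatures are `k, k, 0, …, 0`. -/
theorem isUmbilical_of_cubic {m : ℕ} {F N : Euc (m + 2) → Euc (m + 2 + 1)}
    {V : Set (Euc (m + 2))} {x : Euc (m + 2)} (hF : IsHypersurface F N V) (hx : x ∈ V) {k : ℝ}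
    (hk : k ≠ 0) (htr : opTrace (m + 2 + 1) (relShape F N F N x) = 2 * k)
    (hcub : ∀ v, relShape F N F N x (relShape F N F N x (relShape F N F N x v))
      - (2 * k) • relShape F N F N x (relShape F N F N x v) + k ^ 2 • relShape F N F N x v = 0) :
    IsUmbilical F N x := by
  set L := relShape F N F N x with hL
  have hs : L.toLinearMap.IsSymmetric := fun v w =>
    hF.isometricPair_self.inner_relShape_comm hx v w
  have hn : Module.finrank ℝ (Euc (m + 2 + 1)) = m + 2 + 1 := by simp
  set β := hs.eigenvalues hn with hβ
  have hβ2 : ∀ a, β a = 0 ∨ β a = k := by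
    intro a
    have ha : L (hs.eigenvectorBasis hn a) = β a • hs.eigenvectorBasis hn a :=
      hs.apply_eigenvectorBasis hn a
    have h3 := hcub (hs.eigenvectorBasis hn a)
    simp only [ha, map_smul, smul_smul, ← sub_smul, ← add_smul] at h3
    have h4 := (smul_eq_zero.1 h3).resolve_right
      ((hs.eigenvectorBasis hn).orthonormal.ne_zero a)
    have h5 : β a * (β a - k) ^ 2 = 0 := by rw [← h4]; ring
    rcases mul_eq_zero.1 h5 with h | h
    · exact Or.inl h
    · exact Or.inr (sub_eq_zero.1 (pow_eq_zero_iff two_ne_zero |>.1 h))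
  have hroots := hs.roots_charpoly_eq_eigenvalues hn
  have hchar : L.toLinearMap.charpoly = Polynomial.X * (shapeMatrix F N x).charpoly :=
    hF.charpoly_relShape hx
  rw [hchar, Polynomial.roots_mul
    (mul_ne_zero Polynomial.X_ne_zero (Matrix.charpoly_monic _).ne_zero),
    Polynomial.roots_X] at hroots
  have hsum : (Multiset.map β Finset.univ.val).sum = 2 * k := by
    rw [← htr, opTrace_eq_sum _ (hs.eigenvectorBasis hn)]
    refine Finset.sum_congr rfl fun a _ => ?_
    have ha : L (hs.eigenvectorBasis hn a) = β a • hs.eigenvectorBasis hn a :=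
      hs.apply_eigenvectorBasis hn a
    rw [ha, real_inner_smul_right, real_inner_self_eq_norm_sq,
      (hs.eigenvectorBasis hn).norm_eq_one]
    simp
  set s : Multiset ℝ := Multiset.map β Finset.univ.val with hsdef
  have hroots' : {0} + (shapeMatrix F N x).charpoly.roots = s := hroots
  have hcard : s.card = m + 2 + 1 := by simp [s]
  have hmem : ∀ b ∈ s, b = 0 ∨ b = k := by
    intro b hb
    obtain ⟨a, -, rfl⟩ := Multiset.mem_map.1 hb
    exact hβ2 a
  have hsplit : s = Multiset.replicate (s.count k) k
      + Multiset.replicate (Multiset.card (s.filter fun b => ¬ b = k)) 0 := by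
    conv_lhs => rw [← Multiset.filter_add_not (fun b => b = k) s]
    rw [Multiset.filter_eq']
    congr 1
    refine Multiset.eq_replicate.2 ⟨rfl, fun b hb => ?_⟩
    rw [Multiset.mem_filter] at hb
    exact (hmem b hb.1).resolve_right hb.2
  -- Zero eigenvalues do not contribute to the trace 2k, so k ≠ 0 occurs exactly twice.
  have hcount : s.count k = 2 := by
    rw [hsplit] at hsum
    simp only [Multiset.sum_add, Multiset.sum_replicate, nsmul_eq_mul, mul_zero, add_zero] at hsum
    exact_mod_cast mul_right_cancel₀ hk hsum
  have hcard2 : Multiset.card (s.filter fun b => ¬ b = k) = m + 1 := by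
    have := congrArg Multiset.card hsplit
    rw [Multiset.card_add, Multiset.card_replicate, Multiset.card_replicate, hcount, hcard] at this
    omega
  rw [hcount, hcard2] at hsplit
  refine ⟨k, ?_⟩
  rw [principalCurvatures]
  rw [hsplit] at hroots'
  -- Of the m + 1 zero eigenvalues in the ambient space one belongs to the normal; cancelling it
  -- leaves m.
  refine add_left_cancel (a := ({0} : Multiset ℝ)) (hroots'.trans ?_)
  ext a
  simp only [Multiset.count_add, Multiset.count_cons, Multiset.count_replicate,
    Multiset.count_singleton]
  grind

/-- The difference `D` and the sum `S` of the shape operators of two isometric hypersurfaces with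
the same mean curvature, seen as operators of the ambient space that annihilate the normal. -/
structure ShapePair (F N : Euc n → Euc (n + 1))
    (D S : Euc n → Euc (n + 1) →L[ℝ] Euc (n + 1)) (V : Set (Euc n)) : Prop where
  hyp : IsHypersurface F N V
  smooth_D : ContDiffOn ℝ ∞ D V
  smooth_S : ContDiffOn ℝ ∞ S V
  symm_D : ∀ x ∈ V, ∀ v w, inner ℝ (D x v) w = inner ℝ v (D x w)
  symm_S : ∀ x ∈ V, ∀ v w, inner ℝ (S x v) w = inner ℝ v (S x w)
  normal_D : ∀ x ∈ V, D x (N x) = 0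
  normal_S : ∀ x ∈ V, S x (N x) = 0
  codazzi_D : ∀ x ∈ V, ∀ X Y Z, inner ℝ (fderiv ℝ D x X (fderiv ℝ F x Y)) (fderiv ℝ F x Z)
    = inner ℝ (fderiv ℝ D x Y (fderiv ℝ F x X)) (fderiv ℝ F x Z)
  codazzi_S : ∀ x ∈ V, ∀ X Y Z, inner ℝ (fderiv ℝ S x X (fderiv ℝ F x Y)) (fderiv ℝ F x Z)
    = inner ℝ (fderiv ℝ S x Y (fderiv ℝ F x X)) (fderiv ℝ F x Z)
  trace_D : ∀ x ∈ V, opTrace (n + 1) (D x) = 0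
  trace_S : ∀ x ∈ V, opTrace (n + 1) (S x) ≠ 0
  gauss : ∀ x ∈ V, ∀ a b c d,
    inner ℝ (S x a) c * inner ℝ (D x b) d + inner ℝ (D x a) c * inner ℝ (S x b) d
      - inner ℝ (S x a) d * inner ℝ (D x b) c - inner ℝ (D x a) d * inner ℝ (S x b) c = 0
  weingarten : ∀ x ∈ V, relShape F N F N x = (1 / 2 : ℝ) • (S x + D x)

/-- The Gauss relation is a difference of squares: L ∧ L = L' ∧ L' becomes the vanishing of the
mixed product of L - L' and L + L'. The trace of the sum is twice the trace of L, nonzero by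
non-minimality. -/
theorem IsometricPair.shapePair (h : IsometricPair F N F' N' V) (hn : n ≠ 0)
    (hmean : ∀ x ∈ V, meanCurvature F' N' x = meanCurvature F N x)
    (hH : ∀ x ∈ V, meanCurvature F N x ≠ 0) :
    ShapePair F N (fun x => relShape F N F N x - relShape F N F' N' x)
      (fun x => relShape F N F N x + relShape F N F' N' x) V := by
  have h0 := h.left.isometricPair_self
  have hn' : (n : ℝ) ≠ 0 := Nat.cast_ne_zero.2 hn
  have htr : ∀ x ∈ V, opTrace (n + 1) (relShape F N F' N' x)
      = opTrace (n + 1) (relShape F N F N x) := by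
    intro x hx
    rw [h.opTrace_relShape hx, h0.opTrace_relShape hx]
    have := hmean x hx
    rw [meanCurvature, meanCurvature] at this
    exact (div_left_inj' hn').1 this
  have hd : ∀ x ∈ V, DifferentiableAt ℝ (relShape F N F' N') x := fun x hx =>
    h.contDiffOn_relShape.differentiableAt_of_isOpen h.left.isOpen hx
  have hd0 : ∀ x ∈ V, DifferentiableAt ℝ (relShape F N F N) x := fun x hx =>
    h0.contDiffOn_relShape.differentiableAt_of_isOpen h.left.isOpen hx
  refine ⟨h.left, h0.contDiffOn_relShape.sub h.contDiffOn_relShape,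
    h0.contDiffOn_relShape.add h.contDiffOn_relShape, ?_, ?_, ?_, ?_, ?_, ?_, ?_, ?_, ?_, ?_⟩
  · intro x hx v w
    simp only [sub_apply, inner_sub_left, inner_sub_right,
      h.inner_relShape_comm hx, h0.inner_relShape_comm hx]
  · intro x hx v w
    simp only [add_apply, inner_add_left, inner_add_right,
      h.inner_relShape_comm hx, h0.inner_relShape_comm hx]
  · intro x hx
    simp [h.relShape_normal hx, h0.relShape_normal hx]
  · intro x hx
    simp [h.relShape_normal hx, h0.relShape_normal hx]
  · intro x hx X Y Z
    rw [fderiv_fun_sub (hd0 x hx) (hd x hx)]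
    simp only [sub_apply, inner_sub_left]
    rw [h.relShape_codazzi hx X, h0.relShape_codazzi hx X]
  · intro x hx X Y Z
    rw [fderiv_fun_add (hd0 x hx) (hd x hx)]
    simp only [add_apply, inner_add_left]
    rw [h.relShape_codazzi hx X, h0.relShape_codazzi hx X]
  · intro x hx
    rw [map_sub, htr x hx, sub_self]
  · intro x hx h2
    rw [map_add, htr x hx, h0.opTrace_relShape hx] at h2
    have h3 : (shapeMatrix F N x).trace = 0 := by linarith
    exact hH x hx (by rw [meanCurvature, h3, zero_div])
  · intro x hx a b c d
    have := h.relShape_gauss hx a b c d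
    simp only [sub_apply, add_apply, inner_add_left, inner_sub_left]
    linarith
  · intro x hx
    ext1 v
    simp only [add_add_sub_cancel, smul_apply, add_apply]
    rw [← two_smul ℝ, smul_smul]; norm_num

end Bonnet

end


/-! ### Pointwise algebra: the common normal form of D and S -/

open scoped ContDiff

noncomputable section

namespace Bonnet

/-- An orthonormal basis in which `D = diag(l, -l, 0, …)` and `S` is `t`, `r`, `r`, `t` on the first
two vectors and zero on the others; the first two vectors have the indices `i` and `j`. -/
structure AdaptedFrame {k : ℕ} (D S : Euc k →L[ℝ] Euc k) (e : OrthonormalBasis (Fin k) ℝ (Euc k))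
    (i j : Fin k) (l r t : ℝ) : Prop where
  ne : i ≠ j
  pos : 0 < l
  ne_zero : t ≠ 0
  D_fst : D (e i) = l • e i
  D_snd : D (e j) = -l • e j
  D_other : ∀ a, a ≠ i → a ≠ j → D (e a) = 0
  S_fst : S (e i) = t • e i + r • e j
  S_snd : S (e j) = r • e i + t • e j
  S_other : ∀ a, a ≠ i → a ≠ j → S (e a) = 0

theorem _root_.OrthonormalBasis.ext_inner {k : ℕ} (e : OrthonormalBasis (Fin k) ℝ (Euc k))
    {v w : Euc k} (h : ∀ a, inner ℝ v (e a) = inner ℝ w (e a)) : v = w := by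
  refine e.repr.injective ?_
  ext a
  rw [e.repr_apply_apply, e.repr_apply_apply, real_inner_comm, h, real_inner_comm]

/-- Two symmetric operators with vanishing Kulkarni–Nomizu product, one of them trace-free and the
other not, have a common normal form. -/
theorem exists_adaptedFrame {k : ℕ} {D S : Euc k →L[ℝ] Euc k}
    (hD : ∀ v w, inner ℝ (D v) w = inner ℝ v (D w)) (hS : ∀ v w, inner ℝ (S v) w = inner ℝ v (S w))
    (htD : opTrace k D = 0) (htS : opTrace k S ≠ 0)
    (hg : ∀ a b c d, inner ℝ (S a) c * inner ℝ (D b) d + inner ℝ (D a) c * inner ℝ (S b) d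
      - inner ℝ (S a) d * inner ℝ (D b) c - inner ℝ (D a) d * inner ℝ (S b) c = 0)
    (hD0 : D ≠ 0) :
    ∃ (e : OrthonormalBasis (Fin k) ℝ (Euc k)) (i j : Fin k) (l r t : ℝ),
      AdaptedFrame D S e i j l r t := by
  have hsym : D.toLinearMap.IsSymmetric := hD
  have hn : Module.finrank ℝ (Euc k) = k := by simp
  set e := hsym.eigenvectorBasis hn
  set d := hsym.eigenvalues hn
  have hde : ∀ a, D (e a) = d a • e a := hsym.apply_eigenvectorBasis hn
  have hee : ∀ a b, inner ℝ (e a) (e b) = if a = b then (1 : ℝ) else 0 :=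
    orthonormal_iff_ite.1 e.orthonormal
  have hDe : ∀ a b, inner ℝ (D (e a)) (e b) = if a = b then d a else 0 := by
    intro a b
    rw [hde, real_inner_smul_left, hee]; split_ifs <;> simp
  have hSc : ∀ a b, inner ℝ (S (e a)) (e b) = inner ℝ (S (e b)) (e a) := by
    intro a b
    rw [hS, real_inner_comm]
  -- In an eigenbasis of D the relation at (a, b; a, b) couples the diagonal entries of S with the
  -- eigenvalues; at (a, b; a, c) it kills off-diagonal entries of S as soon as some third
  -- eigenvalue is nonzero.
  have hdiag : ∀ a b, a ≠ b →
      inner ℝ (S (e a)) (e a) * d b + d a * inner ℝ (S (e b)) (e b) = 0 := by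
    intro a b hab
    have := hg (e a) (e b) (e a) (e b)
    simpa [hDe, hab, hab.symm] using this
  have hoff : ∀ a b c, a ≠ b → a ≠ c → b ≠ c → d a * inner ℝ (S (e b)) (e c) = 0 := by
    intro a b c hab hac hbc
    have := hg (e a) (e b) (e a) (e c)
    simpa [hDe, hab, hab.symm, hac, hac.symm, hbc] using this
  set s := opTrace k S with hs
  have hsS : ∑ a, inner ℝ (S (e a)) (e a) = s := by
    rw [hs, opTrace_eq_sum _ e]
    exact Finset.sum_congr rfl fun a _ => real_inner_comm _ _
  have hsD : ∑ a, d a = 0 := by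
    rw [← htD, opTrace_eq_sum _ e]
    refine Finset.sum_congr rfl fun a _ => ?_
    rw [real_inner_comm, hDe, if_pos rfl]
  -- Summation of `hdiag` over b. Off the diagonal every term vanishes, so the sum collapses to b =
  -- a, while tr D = 0 evaluates the full sum as d_a tr S.
  have hhalf : ∀ a, d a ≠ 0 → inner ℝ (S (e a)) (e a) = s / 2 := by
    intro a ha
    have h1 : ∑ b, (inner ℝ (S (e a)) (e a) * d b + d a * inner ℝ (S (e b)) (e b)) = d a * s := by
      rw [Finset.sum_add_distrib, ← Finset.mul_sum, ← Finset.mul_sum, hsD, hsS]; ring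
    rw [Finset.sum_eq_single a (fun b _ hb => hdiag a b hb.symm) (by simp)] at h1
    have h2 : d a * (2 * inner ℝ (S (e a)) (e a) - s) = 0 := by linarith
    have := (mul_eq_zero.1 h2).resolve_left ha
    linarith
  -- Nonzero eigenvalues of D are pairwise opposite, which leaves room for only two of them.
  have hneg : ∀ a b, a ≠ b → d a ≠ 0 → d b ≠ 0 → d b = -d a := by
    intro a b hab ha hb
    have := hdiag a b hab
    rw [hhalf a ha, hhalf b hb] at this
    have h2 : s / 2 * (d b + d a) = 0 := by linarith
    have := (mul_eq_zero.1 h2).resolve_left (div_ne_zero htS two_ne_zero)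
    linarith
  obtain ⟨a, b, hab, hpos, hb⟩ : ∃ a b, a ≠ b ∧ 0 < d a ∧ d b = -d a := by
    obtain ⟨a, ha⟩ : ∃ a, d a ≠ 0 := by
      by_contra! hcon
      apply hD0
      ext1 v
      exact e.ext_inner fun a => by rw [hD, hde, hcon]; simp
    obtain ⟨b, hba, hb⟩ : ∃ b, b ≠ a ∧ d b ≠ 0 := by
      by_contra! hcon
      rw [Finset.sum_eq_single a (fun b _ hb => hcon b hb) (by simp)] at hsD
      exact ha hsD
    have h1 := hneg a b hba.symm ha hb
    rcases lt_or_gt_of_ne ha with h | h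
    · exact ⟨b, a, hba, by linarith, by linarith⟩
    · exact ⟨a, b, hba.symm, h, h1⟩
  have ha0 : d a ≠ 0 := hpos.ne'
  have hb0 : d b ≠ 0 := by rw [hb]; exact neg_ne_zero.2 ha0
  have hother : ∀ c, c ≠ a → c ≠ b → d c = 0 := by
    intro c hca hcb
    by_contra hc
    have h1 := hneg a c hca.symm ha0 hc
    have h2 := hneg b c hcb.symm hb0 hc
    linarith
  have hSother : ∀ c, c ≠ a → c ≠ b → ∀ f, inner ℝ (S (e c)) (e f) = 0 := by
    intro c hca hcb f
    by_cases hcf : c = f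
    · subst hcf
      have := hdiag a c hca.symm
      rw [hother c hca hcb, mul_zero, zero_add] at this
      exact (mul_eq_zero.1 this).resolve_left ha0
    by_cases hfa : f = a
    · subst hfa
      exact (mul_eq_zero.1 (hoff b c f hcb.symm hab.symm hcf)).resolve_left hb0
    · exact (mul_eq_zero.1 (hoff a c f hca.symm (Ne.symm hfa) hcf)).resolve_left ha0
  refine ⟨e, a, b, d a, inner ℝ (S (e a)) (e b), s / 2, hab, hpos, div_ne_zero htS two_ne_zero,
    hde a, by rw [hde, hb], fun c hca hcb => by rw [hde, hother c hca hcb, zero_smul],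
    ?_, ?_, fun c hca hcb => e.ext_inner fun f => by rw [hSother c hca hcb, inner_zero_left]⟩
  · refine e.ext_inner fun c => ?_
    rw [inner_add_left, real_inner_smul_left, real_inner_smul_left, hee, hee]
    by_cases hca : c = a
    · subst hca; simp [hhalf c ha0, hab.symm]
    by_cases hcb : c = b
    · subst hcb; simp [hab]
    · rw [hSc, hSother c hca hcb, if_neg (Ne.symm hca), if_neg (Ne.symm hcb)]; simp
  · refine e.ext_inner fun c => ?_
    rw [inner_add_left, real_inner_smul_left, real_inner_smul_left, hee, hee]
    by_cases hca : c = a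
    · subst hca; simp [hSc b c, hab.symm]
    by_cases hcb : c = b
    · subst hcb; simp [hhalf c hb0, hab]
    · rw [hSc, hSother c hca hcb, if_neg (Ne.symm hca), if_neg (Ne.symm hcb)]; simp

namespace AdaptedFrame

variable {k : ℕ} {D S : Euc k →L[ℝ] Euc k} {e : OrthonormalBasis (Fin k) ℝ (Euc k)}
  {i j : Fin k} {l r t : ℝ}

theorem sum_eq (h : AdaptedFrame D S e i j l r t) {f : Fin k → ℝ}
    (hf : ∀ a, a ≠ i → a ≠ j → f a = 0) : ∑ a, f a = f i + f j := by
  rw [← Finset.sum_subset (Finset.subset_univ {i, j}) (fun a _ ha => by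
    simp only [Finset.mem_insert, Finset.mem_singleton, not_or] at ha
    exact hf a ha.1 ha.2), Finset.sum_pair h.ne]

theorem eq_zero_of_orthogonal {G : Type*} [NormedAddCommGroup G] [NormedSpace ℝ G]
    {A : Euc k →L[ℝ] G}
    (hA : ∀ a, a ≠ i → a ≠ j → A (e a) = 0) {p : Euc k} (hi : inner ℝ p (e i) = 0)
    (hj : inner ℝ p (e j) = 0) : A p = 0 := by
  rw [← e.sum_repr' p, map_sum]
  refine Finset.sum_eq_zero fun a _ => ?_
  rw [map_smul, real_inner_comm]
  by_cases hai : a = i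
  · rw [hai, hi, zero_smul]
  by_cases haj : a = j
  · rw [haj, hj, zero_smul]
  · rw [hA a hai haj, smul_zero]

theorem D_apply (h : AdaptedFrame D S e i j l r t) (v : Euc k) :
    D v = (l * inner ℝ v (e i)) • e i - (l * inner ℝ v (e j)) • e j := by
  have hp : D (v - inner ℝ v (e i) • e i - inner ℝ v (e j) • e j) = 0 := by
    refine eq_zero_of_orthogonal h.D_other ?_ ?_ <;>
    simp [inner_sub_left, real_inner_smul_left, h.ne, h.ne.symm]
  rw [map_sub, map_sub, map_smul, map_smul, h.D_fst, h.D_snd, sub_sub, sub_eq_zero] at hp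
  rw [hp]; module

theorem S_apply (h : AdaptedFrame D S e i j l r t) (v : Euc k) :
    S v = (t * inner ℝ v (e i) + r * inner ℝ v (e j)) • e i
      + (r * inner ℝ v (e i) + t * inner ℝ v (e j)) • e j := by
  have hp : S (v - inner ℝ v (e i) • e i - inner ℝ v (e j) • e j) = 0 := by
    refine eq_zero_of_orthogonal h.S_other ?_ ?_ <;>
    simp [inner_sub_left, real_inner_smul_left, h.ne, h.ne.symm]
  rw [map_sub, map_sub, map_smul, map_smul, h.S_fst, h.S_snd, sub_sub, sub_eq_zero] at hp
  rw [hp]; module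

theorem opTrace_eq (h : AdaptedFrame D S e i j l r t) {A : Euc k →L[ℝ] Euc k}
    (hA : ∀ a, a ≠ i → a ≠ j → inner ℝ (e a) (A (e a)) = 0) :
    opTrace k A = inner ℝ (e i) (A (e i)) + inner ℝ (e j) (A (e j)) := by
  rw [opTrace_eq_sum _ e, h.sum_eq hA]

theorem opTrace_D_comp_D (h : AdaptedFrame D S e i j l r t) :
    opTrace k (D ∘L D) = 2 * l ^ 2 := by
  rw [h.opTrace_eq fun a hi hj => by simp [h.D_other a hi hj]]
  simp [h.D_fst, h.D_snd, inner_smul_right]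
  ring

theorem opTrace_half (h : AdaptedFrame D S e i j l r t) :
    opTrace k ((1 / 2 : ℝ) • (S + D)) = t := by
  rw [h.opTrace_eq fun a hi hj => by simp [h.D_other a hi hj, h.S_other a hi hj]]
  simp [h.D_fst, h.D_snd, h.S_fst, h.S_snd, inner_smul_right, inner_add_right, h.ne,
    h.ne.symm]
  ring

/-- Together with the other two traces this expresses r² by tr L, tr L² and tr D², that is, by
quantities that are continuous across the zeros of D. -/
theorem opTrace_half_sq (h : AdaptedFrame D S e i j l r t) :
    opTrace k (((1 / 2 : ℝ) • (S + D)) ∘L ((1 / 2 : ℝ) • (S + D)))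
      = (t ^ 2 + l ^ 2 + r ^ 2) / 2 := by
  rw [h.opTrace_eq fun a hi hj => by simp [h.D_other a hi hj, h.S_other a hi hj]]
  simp [h.D_fst, h.D_snd, h.S_fst, h.S_snd, inner_smul_right, inner_add_right, h.ne,
    h.ne.symm]
  ring

/-- Cayley–Hamilton for the block of rank two, multiplied by L so that it holds on the kernel as
well; the coefficients are the trace and the determinant of the block. Being written with traces
only, the equation passes to limits at zeros of D, where no adapted frame is available. -/
theorem half_cubic (h : AdaptedFrame D S e i j l r t) {L : Euc k →L[ℝ] Euc k}
    (hL : L = (1 / 2 : ℝ) • (S + D)) :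
    L ∘L L ∘L L - opTrace k L • (L ∘L L)
      + ((opTrace k L ^ 2 - opTrace k (L ∘L L)) / 2) • L = 0 := by
  have h1 : opTrace k L = t := by rw [hL, h.opTrace_half]
  have h2 : opTrace k (L ∘L L) = (t ^ 2 + l ^ 2 + r ^ 2) / 2 := by rw [hL, h.opTrace_half_sq]
  rw [h1, h2]
  have hi : L (e i) = ((t + l) / 2) • e i + (r / 2) • e j := by
    rw [hL]; simp only [smul_apply, add_apply, h.S_fst, h.D_fst]; module
  have hj : L (e j) = (r / 2) • e i + ((t - l) / 2) • e j := by
    rw [hL]; simp only [smul_apply, add_apply, h.S_snd, h.D_snd]; module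
  have ho : ∀ a, a ≠ i → a ≠ j → L (e a) = 0 := by
    intro a h1 h2
    rw [hL]; simp [h.S_other a h1 h2, h.D_other a h1 h2]
  refine ContinuousLinearMap.coe_inj.1 (e.toBasis.ext fun a => ?_)
  by_cases hai : a = i
  · subst hai
    simp only [OrthonormalBasis.coe_toBasis, ContinuousLinearMap.coe_coe, add_apply, sub_apply,
      smul_apply, ContinuousLinearMap.comp_apply, hi, hj, map_add, map_smul]
    simp
    module
  by_cases haj : a = j
  · subst haj
    simp only [OrthonormalBasis.coe_toBasis, ContinuousLinearMap.coe_coe, add_apply, sub_apply,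
      smul_apply, ContinuousLinearMap.comp_apply, hi, hj, map_add, map_smul]
    simp
    module
  · simp [ho a hai haj]

end AdaptedFrame

end Bonnet

end


/-! ### First-order consequences of the Gauss relation and of Codazzi -/

open scoped ContDiff

noncomputable section

namespace Bonnet

/-- A function with `‖df‖ ≤ C ‖f‖` on a ball that vanishes at the centre vanishes on the ball. -/
theorem eq_zero_of_norm_fderiv_le {E G : Type*} [NormedAddCommGroup E] [NormedSpace ℝ E]
    [NormedAddCommGroup G] [NormedSpace ℝ G] {f : E → G} {x₀ : E} {R C : ℝ}
    (hf : ∀ x ∈ Metric.ball x₀ R, DifferentiableAt ℝ f x)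
    (hb : ∀ x ∈ Metric.ball x₀ R, ‖fderiv ℝ f x‖ ≤ C * ‖f x‖) (h0 : f x₀ = 0)
    {x : E} (hx : x ∈ Metric.ball x₀ R) : f x = 0 := by
  have hmem : ∀ s ∈ Set.Icc (0 : ℝ) 1, x₀ + s • (x - x₀) ∈ Metric.ball x₀ R := by
    intro s hs
    rw [Metric.mem_ball, dist_eq_norm] at hx ⊢
    rw [add_sub_cancel_left, norm_smul, Real.norm_of_nonneg hs.1]
    exact (mul_le_of_le_one_left (norm_nonneg _) hs.2).trans_lt hx
  have hd : ∀ s ∈ Set.Icc (0 : ℝ) 1, HasDerivAt (fun s : ℝ => f (x₀ + s • (x - x₀)))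
      (fderiv ℝ f (x₀ + s • (x - x₀)) (x - x₀)) s := by
    intro s hs
    have h1 : HasDerivAt (fun s : ℝ => x₀ + s • (x - x₀)) (x - x₀) s := by
      simpa using ((hasDerivAt_id s).smul_const (x - x₀)).const_add x₀
    exact (hf _ (hmem s hs)).hasFDerivAt.comp_hasDerivAt s h1
  have := eq_zero_of_abs_deriv_le_mul_abs_self_of_eq_zero_right (K := C * ‖x - x₀‖)
    (fun s hs => (hd s hs).continuousAt.continuousWithinAt)
    (fun s hs => (hd s (Set.Ico_subset_Icc_self hs)).hasDerivWithinAt)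
    (by simpa using h0) (fun s hs => by
      refine (ContinuousLinearMap.le_opNorm _ _).trans ?_
      have := hb _ (hmem s (Set.Ico_subset_Icc_self hs))
      calc _ ≤ C * ‖f (x₀ + s • (x - x₀))‖ * ‖x - x₀‖ := by gcongr
        _ = _ := by ring) 1 (by simp)
  simpa using this

namespace ShapePair

variable {n : ℕ} {F N : Euc n → Euc (n + 1)} {D S : Euc n → Euc (n + 1) →L[ℝ] Euc (n + 1)}
  {V : Set (Euc n)} {x : Euc n} {e : OrthonormalBasis (Fin (n + 1)) ℝ (Euc (n + 1))}
  {i j : Fin (n + 1)} {l r t : ℝ}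

theorem exists_frame (h : ShapePair F N D S V) (hx : x ∈ V) (hD : D x ≠ 0) :
    ∃ (e : OrthonormalBasis (Fin (n + 1)) ℝ (Euc (n + 1))) (i j : Fin (n + 1)) (l r t : ℝ),
      AdaptedFrame (D x) (S x) e i j l r t :=
  exists_adaptedFrame (h.symm_D x hx) (h.symm_S x hx) (h.trace_D x hx) (h.trace_S x hx)
    (h.gauss x hx) hD

theorem differentiableAt_D (h : ShapePair F N D S V) (hx : x ∈ V) : DifferentiableAt ℝ D x :=
  h.smooth_D.differentiableAt_of_isOpen h.hyp.isOpen hx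

theorem differentiableAt_S (h : ShapePair F N D S V) (hx : x ∈ V) : DifferentiableAt ℝ S x :=
  h.smooth_S.differentiableAt_of_isOpen h.hyp.isOpen hx

theorem fderiv_inner_clm {A : Euc n → Euc (n + 1) →L[ℝ] Euc (n + 1)}
    (hA : DifferentiableAt ℝ A x) (v w : Euc (n + 1)) (X : Euc n) :
    fderiv ℝ (fun y => inner ℝ (A y v) w) x X = inner ℝ (fderiv ℝ A x X v) w := by
  rw [fderiv_inner_apply ℝ (hA.clm_apply (differentiableAt_const v)) (differentiableAt_const w),
    fderiv_clm_apply_const hA]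
  simp

theorem fderiv_clm_symm {A : Euc n → Euc (n + 1) →L[ℝ] Euc (n + 1)} (hV : IsOpen V)
    (hx : x ∈ V) (hA : DifferentiableAt ℝ A x)
    (hs : ∀ y ∈ V, ∀ v w, inner ℝ (A y v) w = inner ℝ v (A y w)) (X : Euc n)
    (v w : Euc (n + 1)) :
    inner ℝ (fderiv ℝ A x X v) w = inner ℝ (fderiv ℝ A x X w) v := by
  rw [← fderiv_inner_clm hA, ← fderiv_inner_clm hA]
  have : fderiv ℝ (fun y => inner ℝ (A y v) w) x = fderiv ℝ (fun y => inner ℝ (A y w) v) x :=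
    fderiv_eq_of_eqOn hV (fun y hy => by rw [hs y hy, real_inner_comm]) hx
  rw [this]

/-- The relation is differentiated with constant arguments a, b, c, d. Inserting the adapted frame
of the single point x afterwards avoids any question about the smoothness of that frame. -/
theorem fderiv_gauss (h : ShapePair F N D S V) (hx : x ∈ V) (X : Euc n)
    (a b c d : Euc (n + 1)) :
    inner ℝ (fderiv ℝ S x X a) c * inner ℝ (D x b) d
      + inner ℝ (S x a) c * inner ℝ (fderiv ℝ D x X b) d
      + (inner ℝ (fderiv ℝ D x X a) c * inner ℝ (S x b) d
        + inner ℝ (D x a) c * inner ℝ (fderiv ℝ S x X b) d)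
      - (inner ℝ (fderiv ℝ S x X a) d * inner ℝ (D x b) c
        + inner ℝ (S x a) d * inner ℝ (fderiv ℝ D x X b) c)
      - (inner ℝ (fderiv ℝ D x X a) d * inner ℝ (S x b) c
        + inner ℝ (D x a) d * inner ℝ (fderiv ℝ S x X b) c) = 0 := by
  have e0 := congrArg (fun L => L X) (fderiv_eq_of_eqOn h.hyp.isOpen
    (fun y hy => h.gauss y hy a b c d) hx)
  have hd : ∀ {A : Euc n → Euc (n + 1) →L[ℝ] Euc (n + 1)}, DifferentiableAt ℝ A x →
      ∀ v w, DifferentiableAt ℝ (fun y => inner ℝ (A y v) w) x := fun hA v w =>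
    (hA.clm_apply (differentiableAt_const v)).inner ℝ (differentiableAt_const w)
  have hD := hd (h.differentiableAt_D hx)
  have hS := hd (h.differentiableAt_S hx)
  have hmul : ∀ {f g : Euc n → ℝ}, DifferentiableAt ℝ f x → DifferentiableAt ℝ g x →
      fderiv ℝ (fun y => f y * g y) x X = fderiv ℝ f x X * g x + f x * fderiv ℝ g x X := by
    intro f g hf hg
    rw [fderiv_fun_mul hf hg]
    simp only [add_apply, smul_apply, smul_eq_mul]
    ring
  rw [fderiv_fun_sub ((((hS a c).fun_mul (hD b d)).fun_add ((hD a c).fun_mul (hS b d))).fun_sub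
      ((hS a d).fun_mul (hD b c))) ((hD a d).fun_mul (hS b c)),
    fderiv_fun_sub (((hS a c).fun_mul (hD b d)).fun_add ((hD a c).fun_mul (hS b d)))
      ((hS a d).fun_mul (hD b c)),
    fderiv_fun_add ((hS a c).fun_mul (hD b d)) ((hD a c).fun_mul (hS b d))] at e0
  simp only [sub_apply, add_apply] at e0
  rw [hmul (hS a c) (hD b d), hmul (hD a c) (hS b d), hmul (hS a d) (hD b c),
    hmul (hD a d) (hS b c)] at e0
  simpa only [fderiv_inner_clm (h.differentiableAt_D hx), fderiv_inner_clm
    (h.differentiableAt_S hx), fderiv_fun_const, Pi.zero_apply, zero_apply] using e0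

theorem opTrace_fderiv_D (h : ShapePair F N D S V) (hx : x ∈ V) (X : Euc n) :
    opTrace (n + 1) (fderiv ℝ D x X) = 0 := by
  have e0 := congrArg (fun L => L X) (fderiv_eq_of_eqOn h.hyp.isOpen
    (fun y hy => h.trace_D y hy) hx)
  have := ((opTrace (n + 1)).hasFDerivAt.comp x (h.differentiableAt_D hx).hasFDerivAt).fderiv
  simp only [Function.comp_def] at this
  rw [this] at e0
  simpa using e0

theorem inner_normal_fst
    (h : ShapePair F N D S V) (hx : x ∈ V) (hf : AdaptedFrame (D x) (S x) e i j l r t) : inner ℝ (N x) (e i) = 0 := by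
  have h1 := h.symm_D x hx (N x) (e i)
  rw [h.normal_D x hx, hf.D_fst, inner_zero_left, real_inner_smul_right] at h1
  exact (mul_eq_zero.1 h1.symm).resolve_left hf.pos.ne'

theorem inner_normal_snd
    (h : ShapePair F N D S V) (hx : x ∈ V) (hf : AdaptedFrame (D x) (S x) e i j l r t) : inner ℝ (N x) (e j) = 0 := by
  have h1 := h.symm_D x hx (N x) (e j)
  rw [h.normal_D x hx, hf.D_snd, inner_zero_left, real_inner_smul_right] at h1
  exact (mul_eq_zero.1 h1.symm).resolve_left (neg_ne_zero.2 hf.pos.ne')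

/-- Both D and S vanish on p, so the differentiated relation at (e_i, p; e_i, q) and at (e_j, p;
e_j, q) involves only the p, q entries of dD and dS. Adding the two cancels dS and leaves a multiple
of t ≠ 0. -/
theorem inner_fderiv_D_of_orthogonal
    (h : ShapePair F N D S V) (hx : x ∈ V) (hf : AdaptedFrame (D x) (S x) e i j l r t)
    (X : Euc n) {p q : Euc (n + 1)}
    (hpi : inner ℝ p (e i) = 0) (hpj : inner ℝ p (e j) = 0)
    (hqi : inner ℝ q (e i) = 0) (hqj : inner ℝ q (e j) = 0) :
    inner ℝ (fderiv ℝ D x X p) q = 0 := by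
  have hDp : D x p = 0 := by rw [hf.D_apply, hpi, hpj]; simp
  have hSp : S x p = 0 := by rw [hf.S_apply, hpi, hpj]; simp
  have hiq : inner ℝ (e i) q = 0 := by rw [real_inner_comm, hqi]
  have hjq : inner ℝ (e j) q = 0 := by rw [real_inner_comm, hqj]
  have h1 := h.fderiv_gauss hx X (e i) p (e i) q
  have h2 := h.fderiv_gauss hx X (e j) p (e j) q
  simp [hDp, hSp, hf.D_fst, hf.S_fst, inner_add_left, real_inner_smul_left, hiq, hjq,
    hf.ne.symm] at h1
  simp [hDp, hSp, hf.D_snd, hf.S_snd, inner_add_left, real_inner_smul_left, hiq, hjq,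
    hf.ne] at h2
  have : t * inner ℝ (fderiv ℝ D x X p) q = 0 := by linarith
  exact (mul_eq_zero.1 this).resolve_left hf.ne_zero

theorem inner_fderiv_D_add
    (h : ShapePair F N D S V) (hx : x ∈ V) (hf : AdaptedFrame (D x) (S x) e i j l r t)
    (X : Euc n) :
    inner ℝ (fderiv ℝ D x X (e i)) (e i) + inner ℝ (fderiv ℝ D x X (e j)) (e j) = 0 := by
  rw [← h.opTrace_fderiv_D hx X, hf.opTrace_eq fun a hi hj => ?_, real_inner_comm,
    real_inner_comm (e j)]
  rw [real_inner_comm]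
  exact h.inner_fderiv_D_of_orthogonal hx hf X (by simp [hi]) (by simp [hj]) (by simp [hi])
    (by simp [hj])

/-- This is where r enters: when r stays away from zero, an off-diagonal derivative of D is bounded
by l times derivatives of S. -/
theorem inner_fderiv_D_fst_snd
    (h : ShapePair F N D S V) (hx : x ∈ V) (hf : AdaptedFrame (D x) (S x) e i j l r t)
    (X : Euc n) :
    l * (inner ℝ (fderiv ℝ S x X (e j)) (e j) - inner ℝ (fderiv ℝ S x X (e i)) (e i))
      = 2 * r * inner ℝ (fderiv ℝ D x X (e i)) (e j) := by
  have h1 := h.fderiv_gauss hx X (e i) (e j) (e i) (e j)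
  have h2 := h.inner_fderiv_D_add hx hf X
  have h3 := fderiv_clm_symm h.hyp.isOpen hx (h.differentiableAt_D hx) h.symm_D X (e j) (e i)
  simp [hf.D_fst, hf.S_fst, hf.D_snd, hf.S_snd, inner_add_left, real_inner_smul_left, hf.ne,
    hf.ne.symm] at h1
  linear_combination h1 - t * h2 + r * h3

/-- With the symmetry of the operator dD, this makes the trilinear form ⟨(dD along u) v, w⟩
symmetric in all three tangent vectors. -/
theorem fderiv_D_swap
    (h : ShapePair F N D S V) (hx : x ∈ V) {u v w : Euc (n + 1)} (hu : inner ℝ (N x) u = 0)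
    (hv : inner ℝ (N x) v = 0) (hw : inner ℝ (N x) w = 0) :
    inner ℝ (fderiv ℝ D x (tangentCoord F N x u) v) w
      = inner ℝ (fderiv ℝ D x (tangentCoord F N x v) u) w := by
  have := h.codazzi_D x hx (tangentCoord F N x u) (tangentCoord F N x v) (tangentCoord F N x w)
  simpa only [h.hyp.fderiv_tangentCoord_of_inner_eq_zero hx hu,
    h.hyp.fderiv_tangentCoord_of_inner_eq_zero hx hv,
    h.hyp.fderiv_tangentCoord_of_inner_eq_zero hx hw] using this

theorem fderiv_S_swap
    (h : ShapePair F N D S V) (hx : x ∈ V) {u v w : Euc (n + 1)} (hu : inner ℝ (N x) u = 0)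
    (hv : inner ℝ (N x) v = 0) (hw : inner ℝ (N x) w = 0) :
    inner ℝ (fderiv ℝ S x (tangentCoord F N x u) v) w
      = inner ℝ (fderiv ℝ S x (tangentCoord F N x v) u) w := by
  have := h.codazzi_S x hx (tangentCoord F N x u) (tangentCoord F N x v) (tangentCoord F N x w)
  simpa only [h.hyp.fderiv_tangentCoord_of_inner_eq_zero hx hu,
    h.hyp.fderiv_tangentCoord_of_inner_eq_zero hx hv,
    h.hyp.fderiv_tangentCoord_of_inner_eq_zero hx hw] using this

theorem fderiv_D_symm
    (h : ShapePair F N D S V) (hx : x ∈ V) (X : Euc n) (v w : Euc (n + 1)) :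
    inner ℝ (fderiv ℝ D x X v) w = inner ℝ (fderiv ℝ D x X w) v :=
  fderiv_clm_symm h.hyp.isOpen hx (h.differentiableAt_D hx) h.symm_D X v w

/-- The differentiated relation at (i, j; i, p), taken along e_i, and at (j, i; j, p), taken along
e_j, contain the same terms up to Codazzi. In their sum dS cancels and the terms with r add up to
the trace of dD along p, which is zero; the remaining factor 2t is nonzero. -/
theorem fderiv_D_mixed
    (h : ShapePair F N D S V) (hx : x ∈ V) (hf : AdaptedFrame (D x) (S x) e i j l r t)
    {p : Euc (n + 1)} (hpi : inner ℝ p (e i) = 0) (hpj : inner ℝ p (e j) = 0)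
    (hpN : inner ℝ (N x) p = 0) :
    inner ℝ (fderiv ℝ D x (tangentCoord F N x (e i)) (e j)) p = 0 ∧
    l * inner ℝ (fderiv ℝ S x (tangentCoord F N x (e i)) (e i)) p
      = t * inner ℝ (fderiv ℝ D x (tangentCoord F N x (e i)) (e i)) p := by
  have hip : inner ℝ (e i) p = 0 := by rw [real_inner_comm, hpi]
  have hjp : inner ℝ (e j) p = 0 := by rw [real_inner_comm, hpj]
  have hNi := h.inner_normal_fst hx hf
  have hNj := h.inner_normal_snd hx hf
  have gen1 : ∀ X, l * inner ℝ (fderiv ℝ S x X (e j)) p + t * inner ℝ (fderiv ℝ D x X (e j)) p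
      - r * inner ℝ (fderiv ℝ D x X (e i)) p = 0 := by
    intro X
    have h1 := h.fderiv_gauss hx X (e i) (e j) (e i) p
    simp [hf.D_fst, hf.S_fst, hf.D_snd, hf.S_snd, inner_add_left, real_inner_smul_left,
      hf.ne.symm, hip, hjp] at h1
    linear_combination h1
  have gen2 : ∀ X, -l * inner ℝ (fderiv ℝ S x X (e i)) p + t * inner ℝ (fderiv ℝ D x X (e i)) p
      - r * inner ℝ (fderiv ℝ D x X (e j)) p = 0 := by
    intro X
    have h1 := h.fderiv_gauss hx X (e j) (e i) (e j) p
    simp [hf.D_fst, hf.S_fst, hf.D_snd, hf.S_snd, inner_add_left, real_inner_smul_left, hf.ne,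
      hip, hjp] at h1
    linear_combination h1
  have a1 := gen1 (tangentCoord F N x (e i))
  have a2 := gen2 (tangentCoord F N x (e j))
  have a3 := gen2 (tangentCoord F N x (e i))
  have s1 := h.fderiv_D_swap hx hNi hNj hpN
  have s2 := h.fderiv_S_swap hx hNi hNj hpN
  have tr := h.inner_fderiv_D_add hx hf (tangentCoord F N x p)
  have s3 : inner ℝ (fderiv ℝ D x (tangentCoord F N x p) (e i)) (e i)
      = inner ℝ (fderiv ℝ D x (tangentCoord F N x (e i)) (e i)) p := by
    rw [h.fderiv_D_swap hx hpN hNi hNi, h.fderiv_D_symm hx]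
  have s4 : inner ℝ (fderiv ℝ D x (tangentCoord F N x p) (e j)) (e j)
      = inner ℝ (fderiv ℝ D x (tangentCoord F N x (e j)) (e j)) p := by
    rw [h.fderiv_D_swap hx hpN hNj hNj, h.fderiv_D_symm hx]
  rw [s3, s4] at tr
  have key : inner ℝ (fderiv ℝ D x (tangentCoord F N x (e i)) (e j)) p = 0 := by
    rw [← s1, ← s2] at a2
    have : t * (2 * inner ℝ (fderiv ℝ D x (tangentCoord F N x (e i)) (e j)) p) = 0 := by
      linear_combination a1 + a2 + r * tr
    have := (mul_eq_zero.1 this).resolve_left hf.ne_zero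
    linarith
  refine ⟨key, ?_⟩
  rw [key] at a3
  linear_combination -a3

theorem fderiv_opTrace_sq
    (h : ShapePair F N D S V) (hx : x ∈ V) (X : Euc n) :
    fderiv ℝ (fun y => opTrace (n + 1) (D y ∘L D y)) x X
      = 2 * opTrace (n + 1) (D x ∘L fderiv ℝ D x X) := by
  have hd := (h.differentiableAt_D hx).hasFDerivAt
  have := ((opTrace (n + 1)).hasFDerivAt.comp x (hd.clm_comp hd)).fderiv
  simp only [Function.comp_def] at this
  rw [this]
  simp only [ContinuousLinearMap.comp_apply, add_apply, map_add, ContinuousLinearMap.compL_apply,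
    ContinuousLinearMap.flip_apply]
  have hc : opTrace (n + 1) (fderiv ℝ D x X ∘L D x) = opTrace (n + 1) (D x ∘L fderiv ℝ D x X) := by
    rw [opTrace_apply, opTrace_apply]
    exact LinearMap.trace_mul_comm ℝ _ _
  rw [hc]; ring

theorem fderiv_opTrace_sq_eq
    (h : ShapePair F N D S V) (hx : x ∈ V) (hf : AdaptedFrame (D x) (S x) e i j l r t)
    (X : Euc n) :
    fderiv ℝ (fun y => opTrace (n + 1) (D y ∘L D y)) x X
      = 4 * l * inner ℝ (fderiv ℝ D x X (e i)) (e i) := by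
  rw [h.fderiv_opTrace_sq hx, hf.opTrace_eq fun a hi hj => ?_]
  · have h1 := h.inner_fderiv_D_add hx hf X
    rw [ContinuousLinearMap.comp_apply, ContinuousLinearMap.comp_apply, ← h.symm_D x hx,
      ← h.symm_D x hx, hf.D_fst, hf.D_snd, real_inner_smul_left, real_inner_smul_left,
      real_inner_comm, real_inner_comm _ (e j)]
    linear_combination -2 * l * h1
  · rw [ContinuousLinearMap.comp_apply, ← h.symm_D x hx, hf.D_other a hi hj, inner_zero_left]

/-- The derivative of `D` across its kernel is determined by the derivative of `|D|²`. -/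
theorem inner_fderiv_D_kernel
    (h : ShapePair F N D S V) (hx : x ∈ V) (hf : AdaptedFrame (D x) (S x) e i j l r t)
    (X : Euc n) (z : Euc (n + 1)) {p : Euc (n + 1)}
    (hpi : inner ℝ p (e i) = 0) (hpj : inner ℝ p (e j) = 0) (hpN : inner ℝ (N x) p = 0) :
    inner ℝ (fderiv ℝ D x X z) p
      = fderiv ℝ (fun y => opTrace (n + 1) (D y ∘L D y)) x (tangentCoord F N x p)
        / (2 * opTrace (n + 1) (D x ∘L D x)) * inner ℝ (D x z) (fderiv ℝ F x X) := by
  have hip : inner ℝ (e i) p = 0 := by rw [real_inner_comm, hpi]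
  have hjp : inner ℝ (e j) p = 0 := by rw [real_inner_comm, hpj]
  have hNi := h.inner_normal_fst hx hf
  have hNj := h.inner_normal_snd hx hf
  have hl := hf.pos.ne'
  obtain ⟨m1, -⟩ := h.fderiv_D_mixed hx hf hpi hpj hpN
  set τ := inner ℝ (fderiv ℝ D x (tangentCoord F N x p) (e i)) (e i) with hτ
  -- Since tr D² = 2l² has derivative 4lτ, the coefficient is τ/l, the logarithmic derivative of l
  -- along p.
  have hcoef : fderiv ℝ (fun y => opTrace (n + 1) (D y ∘L D y)) x (tangentCoord F N x p)
      / (2 * opTrace (n + 1) (D x ∘L D x)) = τ / l := by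
    rw [h.fderiv_opTrace_sq_eq hx hf, hf.opTrace_D_comp_D, ← hτ]
    field_simp
    ring
  have s3 : inner ℝ (fderiv ℝ D x (tangentCoord F N x (e i)) (e i)) p = τ := by
    rw [hτ, h.fderiv_D_swap hx hpN hNi hNi, h.fderiv_D_symm hx]
  have s4 : inner ℝ (fderiv ℝ D x (tangentCoord F N x (e j)) (e j)) p = -τ := by
    have tr := h.inner_fderiv_D_add hx hf (tangentCoord F N x p)
    rw [h.fderiv_D_symm hx, ← h.fderiv_D_swap hx hpN hNj hNj]
    linarith
  have m2 : inner ℝ (fderiv ℝ D x (tangentCoord F N x (e j)) (e i)) p = 0 := by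
    rw [← h.fderiv_D_swap hx hNi hNj hpN, m1]
  rw [hcoef]
  -- decompose `dF(X)` and `z` along the frame
  set v := fderiv ℝ F x X with hv
  have hvN : inner ℝ (N x) v = 0 := by rw [real_inner_comm, hv, h.hyp.normal_orthogonal x hx]
  set v' := v - inner ℝ v (e i) • e i - inner ℝ v (e j) • e j with hv'
  have hv'i : inner ℝ v' (e i) = 0 := by
    simp [hv', inner_sub_left, real_inner_smul_left, hf.ne.symm]
  have hv'j : inner ℝ v' (e j) = 0 := by
    simp [hv', inner_sub_left, real_inner_smul_left, hf.ne]
  have hv'N : inner ℝ (N x) v' = 0 := by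
    simp [hv', inner_sub_right, real_inner_smul_right, hvN, hNi, hNj]
  have hX : X = tangentCoord F N x v' + inner ℝ v (e i) • tangentCoord F N x (e i)
      + inner ℝ v (e j) • tangentCoord F N x (e j) := by
    conv_lhs => rw [← h.hyp.tangentCoord_fderiv hx X, ← hv]
    rw [hv', map_sub, map_sub, map_smul, map_smul]
    abel
  have hi0 : inner ℝ (fderiv ℝ D x (tangentCoord F N x v') (e i)) p = 0 := by
    rw [h.fderiv_D_swap hx hv'N hNi hpN]
    exact h.inner_fderiv_D_of_orthogonal hx hf _ hv'i hv'j hpi hpj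
  have hj0 : inner ℝ (fderiv ℝ D x (tangentCoord F N x v') (e j)) p = 0 := by
    rw [h.fderiv_D_swap hx hv'N hNj hpN]
    exact h.inner_fderiv_D_of_orthogonal hx hf _ hv'i hv'j hpi hpj
  have Hi : inner ℝ (fderiv ℝ D x X (e i)) p = τ * inner ℝ v (e i) := by
    rw [hX]
    simp only [map_add, map_smul, add_apply, smul_apply, inner_add_left, real_inner_smul_left,
      hi0, s3, m2]
    ring
  have Hj : inner ℝ (fderiv ℝ D x X (e j)) p = -τ * inner ℝ v (e j) := by
    rw [hX]
    simp only [map_add, map_smul, add_apply, smul_apply, inner_add_left, real_inner_smul_left,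
      hj0, s4, m1]
    ring
  have hz : inner ℝ (fderiv ℝ D x X (z - inner ℝ z (e i) • e i - inner ℝ z (e j) • e j)) p = 0 :=
    h.inner_fderiv_D_of_orthogonal hx hf X
      (by simp [inner_sub_left, real_inner_smul_left, hf.ne.symm])
      (by simp [inner_sub_left, real_inner_smul_left, hf.ne]) hpi hpj
  simp only [map_sub, map_smul, inner_sub_left, real_inner_smul_left, Hi, Hj] at hz
  rw [hf.D_apply, inner_sub_left, real_inner_smul_left, real_inner_smul_left,
    real_inner_comm _ (e i), real_inner_comm _ (e j)]
  field_simp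
  linear_combination hz

end ShapePair

end Bonnet

end


/-! ### Zeros of D: the open-closed dichotomy -/

open scoped ContDiff Topology

noncomputable section

namespace Bonnet

namespace ShapePair

section Bound

variable {n : ℕ} {F N : Euc n → Euc (n + 1)} {D S : Euc n → Euc (n + 1) →L[ℝ] Euc (n + 1)}
  {V : Set (Euc n)} {x : Euc n} {e : OrthonormalBasis (Fin (n + 1)) ℝ (Euc (n + 1))}
  {i j : Fin (n + 1)} {l r t : ℝ}

/-- With q = tr D² = 2l², each component of dq is 4l times an entry of dD, and each such entry is at
most l times derivatives of S divided by |r| (in the plane of e_i, e_j) or by |t| (across it). This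
gives a linear differential inequality for q. -/
theorem norm_fderiv_opTrace_sq_le (h : ShapePair F N D S V) (hx : x ∈ V)
    (hf : AdaptedFrame (D x) (S x) e i j l r t) {c : ℝ} (hc : 0 < c) (hr : c ≤ |r|)
    (ht : c ≤ |t|) :
    ‖fderiv ℝ (fun y => opTrace (n + 1) (D y ∘L D y)) x‖
      ≤ 10 / c * (‖fderiv ℝ S x‖ * ‖tangentCoord F N x‖ * ‖fderiv ℝ F x‖)
        * ‖opTrace (n + 1) (D x ∘L D x)‖ := by
  have hNi := h.inner_normal_fst hx hf
  have hNj := h.inner_normal_snd hx hf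
  have hl := hf.pos
  set M := ‖fderiv ℝ S x‖ * ‖tangentCoord F N x‖ with hM
  have hM0 : 0 ≤ M := by positivity
  have hσ : ∀ u v w : Euc (n + 1),
      |inner ℝ (fderiv ℝ S x (tangentCoord F N x u) v) w| ≤ M * ‖u‖ * ‖v‖ * ‖w‖ := by
    intro u v w
    refine (abs_real_inner_le_norm _ _).trans ?_
    gcongr
    refine (ContinuousLinearMap.le_opNorm _ _).trans ?_
    gcongr
    refine (ContinuousLinearMap.le_opNorm _ _).trans ?_
    rw [hM, mul_assoc]
    gcongr
    exact ContinuousLinearMap.le_opNorm _ _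
  have hone : ∀ a, ‖e a‖ = 1 := e.norm_eq_one
  have div_bound : ∀ {y a b : ℝ}, c ≤ |y| → y * a = l * b → |a| ≤ l * |b| / c := by
    intro y a b hy hab
    rw [le_div_iff₀ hc]
    calc |a| * c ≤ |a| * |y| := by gcongr
      _ = |y * a| := by rw [abs_mul, mul_comm]
      _ = l * |b| := by rw [hab, abs_mul, abs_of_pos hl]
  have b1 : |inner ℝ (fderiv ℝ D x (tangentCoord F N x (e i)) (e i)) (e i)| ≤ l * M / c := by
    have h1 := h.inner_fderiv_D_add hx hf (tangentCoord F N x (e i))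
    have h2 := h.fderiv_D_swap hx hNi hNj hNj
    have h3 := h.inner_fderiv_D_fst_snd hx hf (tangentCoord F N x (e j))
    have := div_bound (y := r)
      (a := inner ℝ (fderiv ℝ D x (tangentCoord F N x (e i)) (e i)) (e i))
      (b := -(inner ℝ (fderiv ℝ S x (tangentCoord F N x (e j)) (e j)) (e j)
        - inner ℝ (fderiv ℝ S x (tangentCoord F N x (e j)) (e i)) (e i)) / 2) hr
      (by linear_combination r * h1 - r * h2 + h3 / 2)
    refine this.trans ?_
    gcongr
    have e1 := hσ (e j) (e j) (e j)
    have e2 := hσ (e j) (e i) (e i)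
    simp only [hone, mul_one] at e1 e2
    rw [abs_le] at e1 e2 ⊢
    constructor <;> linarith
  have b2 : |inner ℝ (fderiv ℝ D x (tangentCoord F N x (e j)) (e i)) (e i)| ≤ l * M / c := by
    have h2 := h.fderiv_D_swap hx hNi hNj hNi
    have h3 := h.inner_fderiv_D_fst_snd hx hf (tangentCoord F N x (e i))
    have h4 := h.fderiv_D_symm hx (tangentCoord F N x (e i)) (e i) (e j)
    have := div_bound (y := r)
      (a := inner ℝ (fderiv ℝ D x (tangentCoord F N x (e j)) (e i)) (e i))
      (b := (inner ℝ (fderiv ℝ S x (tangentCoord F N x (e i)) (e j)) (e j)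
        - inner ℝ (fderiv ℝ S x (tangentCoord F N x (e i)) (e i)) (e i)) / 2) hr
      (by linear_combination -r * h2 - h3 / 2 - r * h4)
    refine this.trans ?_
    gcongr
    have e1 := hσ (e i) (e j) (e j)
    have e2 := hσ (e i) (e i) (e i)
    simp only [hone, mul_one] at e1 e2
    rw [abs_le] at e1 e2 ⊢
    constructor <;> linarith
  refine ContinuousLinearMap.opNorm_le_bound _ (by positivity) fun X => ?_
  rw [h.fderiv_opTrace_sq_eq hx hf, hf.opTrace_D_comp_D]
  set v := fderiv ℝ F x X with hv
  have hvN : inner ℝ (N x) v = 0 := by rw [real_inner_comm, hv, h.hyp.normal_orthogonal x hx]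
  set v' := v - inner ℝ v (e i) • e i - inner ℝ v (e j) • e j with hv'
  have hv'i : inner ℝ v' (e i) = 0 := by
    simp [hv', inner_sub_left, real_inner_smul_left, hf.ne.symm]
  have hv'j : inner ℝ v' (e j) = 0 := by
    simp [hv', inner_sub_left, real_inner_smul_left, hf.ne]
  have hv'N : inner ℝ (N x) v' = 0 := by
    simp [hv', inner_sub_right, real_inner_smul_right, hvN, hNi, hNj]
  have hvi : ∀ a, |inner ℝ v (e a)| ≤ ‖v‖ := fun a => by
    simpa [hone] using abs_real_inner_le_norm v (e a)
  have hnv' : ‖v'‖ ≤ 3 * ‖v‖ := by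
    refine (norm_sub_le _ _).trans ?_
    have h1 := norm_sub_le v (inner ℝ v (e i) • e i)
    rw [norm_smul, hone, mul_one, Real.norm_eq_abs] at h1 ⊢
    linarith [hvi i, hvi j]
  have hX : X = tangentCoord F N x v' + inner ℝ v (e i) • tangentCoord F N x (e i)
      + inner ℝ v (e j) • tangentCoord F N x (e j) := by
    conv_lhs => rw [← h.hyp.tangentCoord_fderiv hx X, ← hv]
    rw [hv', map_sub, map_sub, map_smul, map_smul]
    abel
  have b3 : |inner ℝ (fderiv ℝ D x (tangentCoord F N x v') (e i)) (e i)|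
      ≤ l * (M * (3 * ‖v‖)) / c := by
    rw [h.fderiv_D_swap hx hv'N hNi hNi, h.fderiv_D_symm hx]
    have := div_bound ht (h.fderiv_D_mixed hx hf hv'i hv'j hv'N).2.symm
    refine this.trans ?_
    gcongr
    refine (hσ _ _ _).trans ?_
    rw [hone]
    simp only [mul_one]
    gcongr
  -- The kernel part of X contributes 3 and the two plane parts 1 each. The factor 5, with dq =
  -- 4l(…) and q = 2l², produces the constant 10.
  have hbound : |inner ℝ (fderiv ℝ D x X (e i)) (e i)| ≤ 5 * (l * M / c * ‖v‖) := by
    have hsplit : inner ℝ (fderiv ℝ D x X (e i)) (e i)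
        = inner ℝ (fderiv ℝ D x (tangentCoord F N x v') (e i)) (e i)
          + inner ℝ v (e i) * inner ℝ (fderiv ℝ D x (tangentCoord F N x (e i)) (e i)) (e i)
          + inner ℝ v (e j) * inner ℝ (fderiv ℝ D x (tangentCoord F N x (e j)) (e i)) (e i) := by
      conv_lhs => rw [hX]
      simp only [map_add, map_smul, add_apply, smul_apply, inner_add_left, real_inner_smul_left]
    rw [hsplit]
    refine (abs_add_three _ _ _).trans ?_
    rw [abs_mul, abs_mul]
    have e1 := mul_le_mul (hvi i) b1 (abs_nonneg _) (norm_nonneg _)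
    have e2 := mul_le_mul (hvi j) b2 (abs_nonneg _) (norm_nonneg _)
    have e3 : l * (M * (3 * ‖v‖)) / c = 3 * (l * M / c * ‖v‖) := by ring
    linarith
  have hvX : ‖v‖ ≤ ‖fderiv ℝ F x‖ * ‖X‖ := ContinuousLinearMap.le_opNorm _ _
  rw [Real.norm_eq_abs, Real.norm_eq_abs, abs_mul, abs_mul, abs_of_pos hl,
    abs_of_pos (show (0 : ℝ) < 4 by norm_num), abs_of_pos (show (0 : ℝ) < 2 * l ^ 2 by positivity)]
  calc 4 * l * |inner ℝ (fderiv ℝ D x X (e i)) (e i)|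
      ≤ 4 * l * (5 * (l * M / c * (‖fderiv ℝ F x‖ * ‖X‖))) := by
        gcongr
        exact hbound.trans (by gcongr)
    _ = _ := by ring

end Bound

variable {m : ℕ} {F N : Euc (m + 2) → Euc (m + 2 + 1)}
  {D S : Euc (m + 2) → Euc (m + 2 + 1) →L[ℝ] Euc (m + 2 + 1)} {V : Set (Euc (m + 2))}

/-- The zeros of `D` form an open set. -/
theorem eventually_D_eq_zero (h : ShapePair F N D S V) (hU : ∀ x ∈ V, ¬ IsUmbilical F N x)
    {x₀ : Euc (m + 2)} (hx₀ : x₀ ∈ V) (hD : D x₀ = 0) : ∀ᶠ x in 𝓝 x₀, D x = 0 := by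
  by_contra hcon
  have hfreq : ∃ᶠ x in 𝓝 x₀, D x ≠ 0 := Filter.not_eventually.1 hcon
  have hV := h.hyp.isOpen.mem_nhds hx₀
  set L : Euc (m + 2) → Euc (m + 2 + 1) →L[ℝ] Euc (m + 2 + 1) :=
    fun x => (1 / 2 : ℝ) • (S x + D x) with hL
  have cD : ContinuousAt D x₀ := (h.differentiableAt_D hx₀).continuousAt
  have cL : ContinuousAt L x₀ :=
    ((h.differentiableAt_S hx₀).continuousAt.add cD).const_smul (1 / 2 : ℝ)
  have cLL : ContinuousAt (fun x => L x ∘L L x) x₀ := cL.clm_comp cL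
  have ctr : ContinuousAt (fun x => opTrace (m + 2 + 1) (L x)) x₀ :=
    (opTrace _).continuous.continuousAt.comp cL
  have ctr2 : ContinuousAt (fun x => opTrace (m + 2 + 1) (L x ∘L L x)) x₀ :=
    (opTrace _).continuous.continuousAt.comp cLL
  have cq : ContinuousAt (fun x => opTrace (m + 2 + 1) (D x ∘L D x)) x₀ :=
    (opTrace _).continuous.continuousAt.comp (cD.clm_comp cD)
  -- Points with D ≠ 0 accumulate at x₀; the cubic equation holds at them and its left-hand side is
  -- continuous.
  have hcub : L x₀ ∘L L x₀ ∘L L x₀ - opTrace (m + 2 + 1) (L x₀) • (L x₀ ∘L L x₀)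
      + ((opTrace (m + 2 + 1) (L x₀) ^ 2 - opTrace (m + 2 + 1) (L x₀ ∘L L x₀)) / 2) • L x₀ = 0 := by
    have cc : ContinuousAt (fun x => L x ∘L L x ∘L L x
        - opTrace (m + 2 + 1) (L x) • (L x ∘L L x)
        + ((opTrace (m + 2 + 1) (L x) ^ 2 - opTrace (m + 2 + 1) (L x ∘L L x)) / 2) • L x) x₀ :=
      ((cL.clm_comp cLL).sub (ctr.smul cLL)).add ((((ctr.pow 2).sub ctr2).div_const 2).smul cL)
    by_contra hne
    have h1 := cc.eventually_ne hne
    obtain ⟨x, hxD, hxV, hxne⟩ := (hfreq.and_eventually (Filter.Eventually.and hV h1)).exists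
    obtain ⟨e, i, j, l, r, t, hf⟩ := h.exists_frame hxV hxD
    exact hxne (hf.half_cubic rfl)
  have htrS : opTrace (m + 2 + 1) (L x₀) ≠ 0 := by
    have := h.trace_S x₀ hx₀
    simpa [hL, h.trace_D x₀ hx₀] using this
  -- If the discriminant of the quadratic factor were zero, the cubic equation would read L (L - k)²
  -- = 0 with k = tr L / 2, and x₀ would be umbilical.
  have hdisc : 2 * opTrace (m + 2 + 1) (L x₀ ∘L L x₀) - opTrace (m + 2 + 1) (L x₀) ^ 2 ≠ 0 := by
    intro h0
    have hw : relShape F N F N x₀ = L x₀ := h.weingarten x₀ hx₀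
    refine hU x₀ hx₀ (isUmbilical_of_cubic h.hyp hx₀ (k := opTrace (m + 2 + 1) (L x₀) / 2)
      (div_ne_zero htrS two_ne_zero) (by rw [hw]; ring) fun v => ?_)
    rw [hw]
    have hc := congrArg (fun A => A v) hcub
    simp only [add_apply, sub_apply, smul_apply, ContinuousLinearMap.comp_apply, zero_apply] at hc
    have e1 : (opTrace (m + 2 + 1) (L x₀) ^ 2 - opTrace (m + 2 + 1) (L x₀ ∘L L x₀)) / 2
        = (opTrace (m + 2 + 1) (L x₀) / 2) ^ 2 := by linear_combination -h0 / 4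
    rw [e1] at hc
    rw [mul_div_cancel₀ _ (two_ne_zero' ℝ)]
    exact hc
  -- This function equals r² wherever D ≠ 0, and at x₀ it reduces to the discriminant because D
  -- vanishes there.
  set g := fun x => 2 * opTrace (m + 2 + 1) (L x ∘L L x) - opTrace (m + 2 + 1) (L x) ^ 2
    - opTrace (m + 2 + 1) (D x ∘L D x) / 2 with hg
  have cg : ContinuousAt g x₀ := ((ctr2.const_mul 2).sub (ctr.pow 2)).sub (cq.div_const 2)
  have hg0 : g x₀ ≠ 0 := by simpa [hg, hD] using hdisc
  -- A common lower bound for |t| and |r| near x₀: half the value of |tr L|, and the root of half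
  -- the value of |g|.
  set c := min (|opTrace (m + 2 + 1) (L x₀)| / 2) (Real.sqrt (|g x₀| / 2)) with hcdef
  have hc : 0 < c := by
    refine lt_min (by positivity) (Real.sqrt_pos.2 (by positivity))
  have ev1 : ∀ᶠ x in 𝓝 x₀, |opTrace (m + 2 + 1) (L x₀)| / 2 < |opTrace (m + 2 + 1) (L x)| :=
    ctr.abs.eventually_const_lt (half_lt_self (abs_pos.2 htrS))
  have ev2 : ∀ᶠ x in 𝓝 x₀, |g x₀| / 2 < |g x| :=
    cg.abs.eventually_const_lt (half_lt_self (abs_pos.2 hg0))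
  set K := fun x => ‖fderiv ℝ S x‖ * ‖tangentCoord F N x‖ * ‖fderiv ℝ F x‖ with hK
  have cK : ContinuousAt K x₀ := by
    have c1 := (h.smooth_S.fderiv_infty h.hyp.isOpen).differentiableAt_of_isOpen h.hyp.isOpen hx₀
    have c2 := h.hyp.contDiffOn_tangentCoord.differentiableAt_of_isOpen h.hyp.isOpen hx₀
    exact (c1.continuousAt.norm.mul c2.continuousAt.norm).mul
      (h.hyp.differentiableAt_fderiv hx₀).continuousAt.norm
  have ev3 : ∀ᶠ x in 𝓝 x₀, K x < K x₀ + 1 := cK.eventually_lt_const (lt_add_one _)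
  obtain ⟨R, hR, hball⟩ := Metric.eventually_nhds_iff_ball.1
    (Filter.Eventually.and hV (ev1.and (ev2.and ev3)))
  have hq0 : ∀ x ∈ Metric.ball x₀ R, opTrace (m + 2 + 1) (D x ∘L D x) = 0 := by
    intro x hx
    refine eq_zero_of_norm_fderiv_le (f := fun x => opTrace (m + 2 + 1) (D x ∘L D x))
      (x₀ := x₀) (R := R) (C := 10 / c * (K x₀ + 1)) (fun y hy => ?_)
      (fun y hy => ?_) (by simp [hD]) hx
    · have hd := (h.differentiableAt_D (hball y hy).1)
      exact (opTrace _).differentiableAt.comp y (hd.clm_comp hd)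
    · obtain ⟨hyV, h1, h2, h3⟩ := hball y hy
      by_cases hDy : D y = 0
      · have : fderiv ℝ (fun x => opTrace (m + 2 + 1) (D x ∘L D x)) y = 0 := by
          ext1 X
          rw [h.fderiv_opTrace_sq hyV, hDy]
          simp
        rw [this, hDy]
        simp
      · obtain ⟨e, i, j, l, r, t, hf⟩ := h.exists_frame hyV hDy
        have ht : opTrace (m + 2 + 1) (L y) = t := hf.opTrace_half
        have hr : g y = r ^ 2 := by
          have e2 : opTrace (m + 2 + 1) (L y ∘L L y) = (t ^ 2 + l ^ 2 + r ^ 2) / 2 :=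
            hf.opTrace_half_sq
          simp only [hg, e2, ht, hf.opTrace_D_comp_D]
          ring
        refine (h.norm_fderiv_opTrace_sq_le hyV hf hc ?_ ?_).trans ?_
        · refine (min_le_right _ _).trans ?_
          rw [← Real.sqrt_sq_eq_abs r]
          refine Real.sqrt_le_sqrt ?_
          rw [hr, abs_of_nonneg (sq_nonneg r)] at h2
          exact h2.le
        · rw [ht] at h1
          exact (min_le_left _ _).trans h1.le
        · gcongr
  obtain ⟨x, hxD, hxb⟩ := (hfreq.and_eventually (Metric.ball_mem_nhds x₀ hR)).exists
  obtain ⟨e, i, j, l, r, t, hf⟩ := h.exists_frame (hball x hxb).1 hxD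
  have := hq0 x hxb
  rw [hf.opTrace_D_comp_D] at this
  have := hf.pos
  nlinarith

/-- The zeros of D are open by the differential inequality, the other points by continuity;
connectedness leaves one of the two sets empty. -/
theorem D_eq_zero_or_ne_zero (h : ShapePair F N D S V) (hU : ∀ x ∈ V, ¬ IsUmbilical F N x)
    (hV : IsConnected V) : (∀ x ∈ V, D x = 0) ∨ ∀ x ∈ V, D x ≠ 0 := by
  by_contra! hcon
  obtain ⟨⟨x₁, hx₁, hD₁⟩, x₂, hx₂, hD₂⟩ := hcon
  have ho : IsOpen {x ∈ V | D x = 0} := by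
    refine isOpen_iff_mem_nhds.2 fun x hx => ?_
    exact Filter.inter_mem (h.hyp.isOpen.mem_nhds hx.1) (h.eventually_D_eq_zero hU hx.1 hx.2)
  have ho' : IsOpen {x ∈ V | D x ≠ 0} := by
    refine isOpen_iff_mem_nhds.2 fun x hx => ?_
    exact Filter.inter_mem (h.hyp.isOpen.mem_nhds hx.1)
      ((h.differentiableAt_D hx.1).continuousAt.eventually_ne hx.2)
  obtain ⟨x, -, hx, hx'⟩ := hV.isPreconnected _ _ ho ho'
    (fun x hx => by by_cases hx0 : D x = 0 <;> simp [hx, hx0]) ⟨x₂, hx₂, hx₂, hD₂⟩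
    ⟨x₁, hx₁, hx₁, hD₁⟩
  exact hx'.2 hx.2

end ShapePair

end Bonnet

end


/-! ### Structure equation of the nullity distribution -/

open scoped ContDiff Topology

noncomputable section

namespace Bonnet

/-- A field `Q` of orthogonal projections in the tangent spaces of `F`, with kernel of rank two,
whose derivative is controlled by a vector field `A` in its range. -/
structure NullityField {n : ℕ} (F : Euc n → Euc (n + 1))
    (Q : Euc n → Euc (n + 1) →L[ℝ] Euc (n + 1)) (A : Euc n → Euc (n + 1))
    (V : Set (Euc n)) : Prop where
  isOpen : IsOpen V
  smooth : ContDiffOn ℝ ∞ F V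
  smooth_Q : ContDiffOn ℝ ∞ Q V
  smooth_A : ContDiffOn ℝ ∞ A V
  symm : ∀ x ∈ V, ∀ v w, inner ℝ (Q x v) w = inner ℝ v (Q x w)
  proj : ∀ x ∈ V, ∀ v, Q x (Q x v) = Q x v
  map_A : ∀ x ∈ V, Q x (A x) = A x
  fderiv_Q : ∀ x ∈ V, ∀ X v, fderiv ℝ Q x X v
    = inner ℝ (A x) v • (fderiv ℝ F x X - Q x (fderiv ℝ F x X))
      + inner ℝ (fderiv ℝ F x X - Q x (fderiv ℝ F x X)) v • A x
  exists_orthogonal : ∀ x ∈ V, ∀ X, ∃ Y, fderiv ℝ F x Y - Q x (fderiv ℝ F x Y) ≠ 0 ∧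
    inner ℝ (fderiv ℝ F x Y - Q x (fderiv ℝ F x Y)) (fderiv ℝ F x X - Q x (fderiv ℝ F x X)) = 0

namespace NullityField

variable {n : ℕ} {F : Euc n → Euc (n + 1)} {Q : Euc n → Euc (n + 1) →L[ℝ] Euc (n + 1)}
  {A : Euc n → Euc (n + 1)} {V : Set (Euc n)} {x : Euc n}

theorem differentiableAt_Q (h : NullityField F Q A V) (hx : x ∈ V) : DifferentiableAt ℝ Q x :=
  h.smooth_Q.differentiableAt_of_isOpen h.isOpen hx

theorem differentiableAt_A (h : NullityField F Q A V) (hx : x ∈ V) : DifferentiableAt ℝ A x :=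
  h.smooth_A.differentiableAt_of_isOpen h.isOpen hx

theorem Q_sub (h : NullityField F Q A V) (hx : x ∈ V) (v : Euc (n + 1)) :
    Q x (v - Q x v) = 0 := by rw [map_sub, h.proj x hx, sub_self]

theorem inner_A_sub (h : NullityField F Q A V) (hx : x ∈ V) (v : Euc (n + 1)) :
    inner ℝ (A x) (v - Q x v) = 0 := by
  rw [← h.map_A x hx, h.symm x hx, h.Q_sub hx, inner_zero_right]

/-- The structure equation of the field `A`, from the symmetry of the second derivative of `Q`. -/
theorem fderiv_A (h : NullityField F Q A V) (hx : x ∈ V) (X : Euc n) :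
    fderiv ℝ A x X = -inner ℝ (A x) (fderiv ℝ F x X) • A x
      + ‖A x‖ ^ 2 • (fderiv ℝ F x X - Q x (fderiv ℝ F x X)) := by
  have hV := h.isOpen
  have hT := (h.smooth.fderiv_infty hV).differentiableAt_of_isOpen hV hx
  have hQ := h.differentiableAt_Q hx
  have hA := h.differentiableAt_A hx
  have hQ' := (h.smooth_Q.fderiv_infty hV).differentiableAt_of_isOpen hV hx
  set Z : Euc n → Euc n → Euc (n + 1) := fun Y y => fderiv ℝ F y Y - Q y (fderiv ℝ F y Y) with hZ
  have hZd : ∀ Y, DifferentiableAt ℝ (Z Y) x := fun Y =>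
    (hT.clm_apply (differentiableAt_const Y)).fun_sub
      (hQ.clm_apply (hT.clm_apply (differentiableAt_const Y)))
  have hZ' : ∀ X Y, fderiv ℝ (Z Y) x X = fderiv ℝ (fderiv ℝ F) x X Y
      - fderiv ℝ Q x X (fderiv ℝ F x Y) - Q x (fderiv ℝ (fderiv ℝ F) x X Y) := by
    intro X Y
    have hTY := hT.clm_apply (differentiableAt_const Y)
    rw [hZ, fderiv_fun_sub hTY (hQ.clm_apply hTY), sub_apply, fderiv_clm_apply_const hT,
      fderiv_clm_apply_apply hQ hTY, fderiv_clm_apply_const hT]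
    abel
  have hsecond : ∀ X Y v, fderiv ℝ (fderiv ℝ Q) x X Y v
      = inner ℝ (fderiv ℝ A x X) v • Z Y x + inner ℝ (A x) v • fderiv ℝ (Z Y) x X
        + (inner ℝ (fderiv ℝ (Z Y) x X) v • A x + inner ℝ (Z Y x) v • fderiv ℝ A x X) := by
    intro X Y v
    have e := congrArg (fun L => L X) (fderiv_eq_of_eqOn hV
      (fun y hy => h.fderiv_Q y hy Y v) hx)
    have i1 : DifferentiableAt ℝ (fun y => inner ℝ (A y) v) x :=
      hA.inner ℝ (differentiableAt_const v)
    have i2 : DifferentiableAt ℝ (fun y => inner ℝ (Z Y y) v) x :=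
      (hZd Y).inner ℝ (differentiableAt_const v)
    have hQY := hQ'.clm_apply (differentiableAt_const Y)
    change _ = fderiv ℝ (fun y => inner ℝ (A y) v • Z Y y + inner ℝ (Z Y y) v • A y) x X at e
    rw [fderiv_fun_add (i1.fun_smul (hZd Y)) (i2.fun_smul hA), fderiv_fun_smul i1 (hZd Y),
      fderiv_fun_smul i2 hA] at e
    simp only [add_apply, smul_apply, ContinuousLinearMap.smulRight_apply,
      fderiv_inner_apply ℝ hA (differentiableAt_const v),
      fderiv_inner_apply ℝ (hZd Y) (differentiableAt_const v), fderiv_fun_const, Pi.zero_apply,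
      zero_apply, inner_zero_right, zero_add, fderiv_clm_apply_const hQY,
      fderiv_clm_apply_const hQ'] at e
    rw [e]; abel
  have hQZ : ∀ Y, Q x (Z Y x) = 0 := fun Y => h.Q_sub hx _
  have hAZ : ∀ Y, inner ℝ (A x) (Z Y x) = 0 := fun Y => h.inner_A_sub hx _
  have hZT : ∀ X Y, inner ℝ (Z X x) (fderiv ℝ F x Y) = inner ℝ (Z X x) (Z Y x) := by
    intro X Y
    have : inner ℝ (Z X x) (Q x (fderiv ℝ F x Y)) = 0 := by
      rw [← h.symm x hx, hQZ, inner_zero_left]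
    simp only [hZ, inner_sub_right] at this ⊢
    rw [this, sub_zero]
  -- the exterior derivative of `Z`
  have hdZ : ∀ X Y, fderiv ℝ (Z Y) x X - fderiv ℝ (Z X) x Y
      = inner ℝ (A x) (fderiv ℝ F x X) • Z Y x - inner ℝ (A x) (fderiv ℝ F x Y) • Z X x := by
    intro X Y
    rw [hZ', hZ', h.smooth.fderiv_fderiv_comm hV hx X Y, h.fderiv_Q x hx, h.fderiv_Q x hx]
    have e1 : inner ℝ (Z X x) (fderiv ℝ F x Y) = inner ℝ (Z Y x) (fderiv ℝ F x X) := by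
      rw [hZT, hZT, real_inner_comm]
    simp only [hZ] at e1 ⊢
    rw [e1]
    abel
  -- After the exterior derivative of Z is substituted, the symmetry of d²Q involves dA only in this
  -- combination.
  set G : Euc n → Euc (n + 1) :=
    fun X => fderiv ℝ A x X + inner ℝ (A x) (fderiv ℝ F x X) • A x with hG
  have hsym : ∀ X Y v, inner ℝ (G X) v • Z Y x + inner ℝ (Z Y x) v • G X
      = inner ℝ (G Y) v • Z X x + inner ℝ (Z X x) v • G Y := by
    intro X Y v
    have e := congrArg (fun L => L v) (h.smooth_Q.fderiv_fderiv_comm hV hx X Y)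
    rw [hsecond X Y v, hsecond Y X v] at e
    have hd : fderiv ℝ (Z Y) x X = fderiv ℝ (Z X) x Y
        + (inner ℝ (A x) (fderiv ℝ F x X) • Z Y x - inner ℝ (A x) (fderiv ℝ F x Y) • Z X x) := by
      rw [← hdZ]; abel
    rw [hd] at e
    simp only [hG, inner_add_left, inner_sub_left, real_inner_smul_left] at e ⊢
    rw [← sub_eq_zero] at e ⊢
    rw [← e]
    module
  -- Test the symmetry on v = Z Y with Z Y ≠ 0 orthogonal to Z X and apply Q, which annihilates
  -- every Z: only |Z Y|² Q(G X) survives. Such a Y exists because the kernel plane of Q in the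
  -- tangent space has dimension two.
  have hQG : ∀ X, Q x (G X) = 0 := by
    intro X
    obtain ⟨Y, hY0, hYX⟩ := h.exists_orthogonal x hx X
    have e := congrArg (Q x) (hsym X Y (Z Y x))
    simp only [map_add, map_smul, hQZ, smul_zero, zero_add] at e
    have hYX' : inner ℝ (Z X x) (Z Y x) = 0 := by rw [real_inner_comm]; exact hYX
    rw [hYX', zero_smul] at e
    exact (smul_eq_zero.1 e).resolve_left (inner_self_ne_zero.2 hY0)
  -- the component of `dA` orthogonal to the range of `Q`
  have hperp : fderiv ℝ A x X - Q x (fderiv ℝ A x X) = ‖A x‖ ^ 2 • Z X x := by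
    have e := congrArg (fun L => L X) (fderiv_eq_of_eqOn hV (fun y hy => h.map_A y hy) hx)
    simp only [fderiv_clm_apply_apply hQ hA] at e
    rw [h.fderiv_Q x hx, real_inner_self_eq_norm_sq] at e
    have h0 : inner ℝ (fderiv ℝ F x X - Q x (fderiv ℝ F x X)) (A x) = 0 := by
      rw [real_inner_comm]; exact hAZ X
    rw [h0, zero_smul, add_zero] at e
    rw [sub_eq_iff_eq_add]
    exact e.symm
  have h1 := hQG X
  simp only [hG, map_add, map_smul, h.map_A x hx] at h1
  rw [add_eq_zero_iff_eq_neg.1 h1] at hperp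
  rw [sub_eq_iff_eq_add] at hperp
  rw [hperp]
  module

end NullityField

end Bonnet

end


/-! ### Integrating the structure equation: gradient frames and the weight ρ -/

open scoped ContDiff Topology

noncomputable section

namespace Bonnet

/-- Orthonormal fields `ε p` in the range of `Q` that are gradients of functions `ξ p`, together with
a positive function `ρ`, with `dρ = ρ A`, that is constant or a linear combination of the `ξ p`. -/
structure ParallelFrame {n m : ℕ} (F : Euc n → Euc (n + 1))
    (Q : Euc n → Euc (n + 1) →L[ℝ] Euc (n + 1)) (A : Euc n → Euc (n + 1))
    (ρ : Euc n → ℝ) (ε : Fin m → Euc n → Euc (n + 1)) (ξ : Fin m → Euc n → ℝ)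
    (V : Set (Euc n)) : Prop where
  smooth_ρ : ContDiffOn ℝ ∞ ρ V
  pos : ∀ x ∈ V, 0 < ρ x
  fderiv_ρ : ∀ x ∈ V, ∀ X, fderiv ℝ ρ x X = ρ x * inner ℝ (A x) (fderiv ℝ F x X)
  orthonormal : ∀ x ∈ V, ∀ p q, inner ℝ (ε p x) (ε q x) = if p = q then (1 : ℝ) else 0
  map_ε : ∀ x ∈ V, ∀ p, Q x (ε p x) = ε p x
  smooth_ξ : ∀ p, ContDiffOn ℝ ∞ (ξ p) V
  fderiv_ξ : ∀ p, ∀ x ∈ V, ∀ X, fderiv ℝ (ξ p) x X = inner ℝ (ε p x) (fderiv ℝ F x X)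
  weight : (∀ x, ρ x = 1) ∨ ∃ C : Fin m → ℝ, C ≠ 0 ∧ ∀ x ∈ V, ρ x = ∑ p, C p * ξ p x

theorem ParallelFrame.mono {n m : ℕ} {F : Euc n → Euc (n + 1)}
    {Q : Euc n → Euc (n + 1) →L[ℝ] Euc (n + 1)} {A : Euc n → Euc (n + 1)}
    {ρ : Euc n → ℝ} {ε : Fin m → Euc n → Euc (n + 1)} {ξ : Fin m → Euc n → ℝ}
    {V V' : Set (Euc n)} (h : ParallelFrame F Q A ρ ε ξ V) (hV : V' ⊆ V) :
    ParallelFrame F Q A ρ ε ξ V' :=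
  ⟨h.smooth_ρ.mono hV, fun x hx => h.pos x (hV hx), fun x hx => h.fderiv_ρ x (hV hx),
    fun x hx => h.orthonormal x (hV hx), fun x hx => h.map_ε x (hV hx),
    fun p => (h.smooth_ξ p).mono hV, fun p x hx => h.fderiv_ξ p x (hV hx),
    h.weight.imp id fun ⟨C, hC, h⟩ => ⟨C, hC, fun x hx => h x (hV hx)⟩⟩

/-- An orthonormal basis of the range of an orthogonal projection of trace `m`. -/
theorem exists_orthonormal_range {k m : ℕ} {Q : Euc k →L[ℝ] Euc k}
    (hproj : ∀ v, Q (Q v) = Q v) (htr : opTrace k Q = m) :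
    ∃ ε : Fin m → Euc k, (∀ p q, inner ℝ (ε p) (ε q) = if p = q then (1 : ℝ) else 0) ∧
      (∀ p, Q (ε p) = ε p) ∧ ∀ v, Q v = v → ∑ p, inner ℝ v (ε p) • ε p = v := by
  have hP : LinearMap.IsProj (LinearMap.range Q.toLinearMap) Q.toLinearMap :=
    ⟨fun v => LinearMap.mem_range_self _ v, by
      rintro _ ⟨v, rfl⟩
      exact hproj v⟩
  have hfin : Module.finrank ℝ (LinearMap.range Q.toLinearMap) = m := by
    have := hP.trace
    rw [← opTrace_apply, htr] at this
    exact_mod_cast this.symm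
  let b := (stdOrthonormalBasis ℝ (LinearMap.range Q.toLinearMap)).reindex (finCongr hfin)
  refine ⟨fun p => (b p : Euc k), fun p q => ?_, fun p => hP.map_id _ (b p).2, fun v hv => ?_⟩
  · rw [← orthonormal_iff_ite.1 b.orthonormal p q]
    rfl
  · have hmem : v ∈ LinearMap.range Q.toLinearMap := ⟨v, hv⟩
    have := congrArg (fun w : LinearMap.range Q.toLinearMap => (w : Euc k))
      (b.sum_repr' ⟨v, hmem⟩)
    simp only [Submodule.coe_sum, Submodule.coe_smul, Submodule.coe_inner] at this
    conv_rhs => rw [← this]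
    exact Finset.sum_congr rfl fun p _ => by rw [real_inner_comm]

namespace NullityField

variable {n m : ℕ} {F : Euc n → Euc (n + 1)} {Q : Euc n → Euc (n + 1) →L[ℝ] Euc (n + 1)}
  {A : Euc n → Euc (n + 1)} {V : Set (Euc n)} {x₀ : Euc n}

theorem differentiableAt (h : NullityField F Q A V) {x : Euc n} (hx : x ∈ V) :
    DifferentiableAt ℝ F x := h.smooth.differentiableAt_of_isOpen h.isOpen hx

/-- The structure equation bounds dA by a multiple of A, so A vanishes on a whole ball and Q is
constant there. A fixed orthonormal basis of its range then consists of gradients of linear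
functions of F. -/
theorem exists_parallelFrame_of_eq_zero (h : NullityField F Q A V) (hx₀ : x₀ ∈ V)
    (hm : opTrace (n + 1) (Q x₀) = m) (hA : A x₀ = 0) :
    ∃ R > 0, Metric.ball x₀ R ⊆ V ∧ ∃ (ρ : Euc n → ℝ) (ε : Fin m → Euc n → Euc (n + 1))
      (ξ : Fin m → Euc n → ℝ), ParallelFrame F Q A ρ ε ξ (Metric.ball x₀ R) := by
  have hV := h.isOpen.mem_nhds hx₀
  set K := fun x => ‖A x‖ * ((2 + ‖Q x‖) * ‖fderiv ℝ F x‖) with hK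
  have cK : ContinuousAt K x₀ := by
    have c1 := (h.smooth.fderiv_infty h.isOpen).differentiableAt_of_isOpen h.isOpen hx₀
    exact (h.differentiableAt_A hx₀).continuousAt.norm.mul
      (((h.differentiableAt_Q hx₀).continuousAt.norm.const_add 2).mul c1.continuousAt.norm)
  have ev : ∀ᶠ x in 𝓝 x₀, K x < K x₀ + 1 := cK.eventually_lt_const (lt_add_one _)
  obtain ⟨R, hR, hball⟩ := Metric.eventually_nhds_iff_ball.1 (Filter.Eventually.and hV ev)
  have hsub : Metric.ball x₀ R ⊆ V := fun x hx => (hball x hx).1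
  have hA0 : ∀ x ∈ Metric.ball x₀ R, A x = 0 := by
    intro x hx
    refine eq_zero_of_norm_fderiv_le (C := K x₀ + 1)
      (fun y hy => h.differentiableAt_A (hsub hy)) (fun y hy => ?_) hA hx
    have hK0 : 0 ≤ K x₀ := by positivity
    refine ContinuousLinearMap.opNorm_le_bound _ (by positivity) fun X => ?_
    rw [h.fderiv_A (hsub hy)]
    have h1 : ‖fderiv ℝ F y X‖ ≤ ‖fderiv ℝ F y‖ * ‖X‖ := ContinuousLinearMap.le_opNorm _ _
    have h2 : ‖Q y (fderiv ℝ F y X)‖ ≤ ‖Q y‖ * (‖fderiv ℝ F y‖ * ‖X‖) :=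
      (ContinuousLinearMap.le_opNorm _ _).trans (by gcongr)
    have h3 := abs_real_inner_le_norm (A y) (fderiv ℝ F y X)
    have h4 := norm_sub_le (fderiv ℝ F y X) (Q y (fderiv ℝ F y X))
    refine (norm_add_le _ _).trans ?_
    rw [norm_smul, norm_smul, norm_neg, Real.norm_eq_abs, Real.norm_of_nonneg (by positivity)]
    calc _ ≤ ‖A y‖ * (‖fderiv ℝ F y‖ * ‖X‖) * ‖A y‖
          + ‖A y‖ ^ 2 * (‖fderiv ℝ F y‖ * ‖X‖ + ‖Q y‖ * (‖fderiv ℝ F y‖ * ‖X‖)) := by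
          gcongr
          · exact h3.trans (by gcongr)
          · exact h4.trans (add_le_add h1 h2)
      _ = K y * ‖A y‖ * ‖X‖ := by rw [hK]; ring
      _ ≤ _ := by gcongr; exact (hball y hy).2.le
  have hQ0 : ∀ x ∈ Metric.ball x₀ R, Q x = Q x₀ := by
    intro x hx
    refine Metric.isOpen_ball.is_const_of_fderiv_eq_zero (𝕜 := ℝ)
      (convex_ball x₀ R).isPreconnected (fun y hy =>
        (h.differentiableAt_Q (hsub hy)).differentiableWithinAt) (fun y hy => ?_) hx
      (Metric.mem_ball_self hR)
    ext1 X
    ext1 v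
    rw [h.fderiv_Q y (hsub hy), hA0 y hy]
    simp
  obtain ⟨ε, ho, hQε, -⟩ := exists_orthonormal_range (h.proj x₀ hx₀) hm
  refine ⟨R, hR, hsub, fun _ => 1, fun p _ => ε p, fun p x => inner ℝ (ε p) (F x),
    contDiffOn_const, fun _ _ => one_pos, fun x hx X => ?_, fun x _ => ho,
    fun x hx p => by rw [hQ0 x hx, hQε], fun p => contDiffOn_const.inner ℝ (h.smooth.mono hsub),
    fun p x hx X => ?_, Or.inl fun _ => rfl⟩
  · rw [hA0 x hx]; simp
  · rw [fderiv_inner_apply ℝ (differentiableAt_const _) (h.differentiableAt (hsub hx))]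
    simp

/-- The weight is ρ = 1/|A|, and the unit field E = ρA is dual to dρ. Although E turns, the
projection Q - ⟨E, ·⟩E is constant. So an orthonormal frame of the range of Q is obtained by adding
multiples c_p E to fixed vectors u_p, and its members are dual to the differentials of ⟨u_p, F⟩ +
c_p ρ. -/
theorem exists_parallelFrame_of_ne_zero (h : NullityField F Q A V) (hx₀ : x₀ ∈ V)
    (hm : opTrace (n + 1) (Q x₀) = m) (hA : A x₀ ≠ 0) :
    ∃ R > 0, Metric.ball x₀ R ⊆ V ∧ ∃ (ρ : Euc n → ℝ) (ε : Fin m → Euc n → Euc (n + 1))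
      (ξ : Fin m → Euc n → ℝ), ParallelFrame F Q A ρ ε ξ (Metric.ball x₀ R) := by
  obtain ⟨R, hR, hball⟩ := Metric.eventually_nhds_iff_ball.1 (Filter.Eventually.and
    (h.isOpen.mem_nhds hx₀) ((h.differentiableAt_A hx₀).continuousAt.eventually_ne hA))
  have hsub : Metric.ball x₀ R ⊆ V := fun x hx => (hball x hx).1
  have hne : ∀ x ∈ Metric.ball x₀ R, A x ≠ 0 := fun x hx => (hball x hx).2
  have hmem := Metric.mem_ball_self (x := x₀) hR
  have hopen : IsOpen (Metric.ball x₀ R) := Metric.isOpen_ball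
  set ρ : Euc n → ℝ := fun x => ‖A x‖⁻¹ with hρ
  have sρ : ContDiffOn ℝ ∞ ρ (Metric.ball x₀ R) :=
    ((h.smooth_A.mono hsub).norm ℝ hne).inv fun x hx => norm_ne_zero_iff.2 (hne x hx)
  have hρpos : ∀ x ∈ Metric.ball x₀ R, 0 < ρ x := fun x hx =>
    inv_pos.2 (norm_pos_iff.2 (hne x hx))
  have hρA : ∀ x ∈ Metric.ball x₀ R, ρ x * ρ x * inner ℝ (A x) (A x) = 1 := by
    intro x hx
    have := norm_ne_zero_iff.2 (hne x hx)
    rw [hρ, real_inner_self_eq_norm_sq]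
    field_simp
  have dρ : ∀ x ∈ Metric.ball x₀ R, ∀ X,
      fderiv ℝ ρ x X = ρ x * inner ℝ (A x) (fderiv ℝ F x X) := by
    intro x hx X
    have d1 := sρ.differentiableAt_of_isOpen hopen hx
    have dA := h.differentiableAt_A (hsub hx)
    have dAA : DifferentiableAt ℝ (fun y => inner ℝ (A y) (A y)) x := dA.inner ℝ dA
    have e := congrArg (fun L => L X) (fderiv_eq_of_eqOn hopen hρA hx)
    rw [fderiv_fun_mul (d1.fun_mul d1) dAA, fderiv_fun_mul d1 d1] at e
    simp only [add_apply, smul_apply, smul_eq_mul, fderiv_inner_apply ℝ dA dA, fderiv_fun_const,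
      Pi.zero_apply, zero_apply, h.fderiv_A (hsub hx), inner_add_left, inner_add_right,
      real_inner_smul_left, real_inner_smul_right, h.inner_A_sub (hsub hx),
      real_inner_comm (A x) (fderiv ℝ F x X - Q x (fderiv ℝ F x X))] at e
    have hAA := hρA x hx
    have hp := (hρpos x hx).ne'
    have e2 : (2 * ρ x * inner ℝ (A x) (A x))
        * (fderiv ℝ ρ x X - ρ x * inner ℝ (A x) (fderiv ℝ F x X)) = 0 := by
      linear_combination e
    have hne2 : 2 * ρ x * inner ℝ (A x) (A x) ≠ 0 := by
      have := inner_self_ne_zero (𝕜 := ℝ).2 (hne x hx)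
      positivity
    exact sub_eq_zero.1 ((mul_eq_zero.1 e2).resolve_left hne2)
  set E : Euc n → Euc (n + 1) := fun x => ρ x • A x with hE
  have dE : ∀ x ∈ Metric.ball x₀ R, DifferentiableAt ℝ E x := fun x hx =>
    (sρ.differentiableAt_of_isOpen hopen hx).fun_smul (h.differentiableAt_A (hsub hx))
  have fE : ∀ x ∈ Metric.ball x₀ R, ∀ X, fderiv ℝ E x X
      = (ρ x * ‖A x‖ ^ 2) • (fderiv ℝ F x X - Q x (fderiv ℝ F x X)) := by
    intro x hx X
    rw [hE, fderiv_fun_smul (sρ.differentiableAt_of_isOpen hopen hx)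
      (h.differentiableAt_A (hsub hx))]
    simp only [add_apply, smul_apply, ContinuousLinearMap.smulRight_apply, dρ x hx,
      h.fderiv_A (hsub hx)]
    module
  have hEE : ∀ x ∈ Metric.ball x₀ R, inner ℝ (E x) (E x) = 1 := by
    intro x hx
    rw [hE, real_inner_smul_left, real_inner_smul_right, ← mul_assoc, hρA x hx]
  have hQE : ∀ x ∈ Metric.ball x₀ R, Q x (E x) = E x := by
    intro x hx
    rw [hE, map_smul, h.map_A x (hsub hx)]
  -- the projection orthogonal to `E` is constant
  have hconst : ∀ v, ∀ x ∈ Metric.ball x₀ R,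
      Q x v - inner ℝ (E x) v • E x = Q x₀ v - inner ℝ (E x₀) v • E x₀ := by
    intro v x hx
    refine hopen.is_const_of_fderiv_eq_zero (𝕜 := ℝ)
      (f := fun y => Q y v - inner ℝ (E y) v • E y)
      (convex_ball x₀ R).isPreconnected (fun y hy => ?_) (fun y hy => ?_) hx hmem
    · exact (((h.differentiableAt_Q (hsub hy)).clm_apply (differentiableAt_const v)).fun_sub
        (((dE y hy).inner ℝ (differentiableAt_const v)).fun_smul
          (dE y hy))).differentiableWithinAt
    · ext1 X
      have d1 := (h.differentiableAt_Q (hsub hy)).clm_apply (differentiableAt_const v)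
      have d2 : DifferentiableAt ℝ (fun y => inner ℝ (E y) v) y :=
        (dE y hy).inner ℝ (differentiableAt_const v)
      rw [fderiv_fun_sub d1 (d2.fun_smul (dE y hy)), fderiv_fun_smul d2 (dE y hy)]
      simp only [sub_apply, add_apply, smul_apply, ContinuousLinearMap.smulRight_apply,
        fderiv_clm_apply_const (h.differentiableAt_Q (hsub hy)),
        fderiv_inner_apply ℝ (dE y hy) (differentiableAt_const v), fE y hy,
        h.fderiv_Q y (hsub hy), fderiv_fun_const, Pi.zero_apply, zero_apply, inner_zero_right,
        zero_add, real_inner_smul_left]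
      have hr : ρ y * (ρ y * ‖A y‖ ^ 2) = 1 := by
        rw [← real_inner_self_eq_norm_sq, ← mul_assoc, hρA y hy]
      rw [hE]
      simp only [real_inner_smul_left]
      rw [sub_eq_zero]
      congr 1
      · rw [smul_smul]
        congr 1
        linear_combination -inner ℝ (A y) v * hr
      · rw [smul_smul]
        congr 1
        linear_combination -inner ℝ (fderiv ℝ F y X - Q y (fderiv ℝ F y X)) v * hr
  obtain ⟨ε₀, ho, hQε, hsum⟩ := exists_orthonormal_range (h.proj x₀ hx₀) hm
  -- The coefficients of E(x₀) in the chosen basis. They satisfy ∑ c_p² = 1 and ∑ c_p u_p = 0, which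
  -- is what turns ∑ c_p ξ_p into ρ.
  set c : Fin m → ℝ := fun p => inner ℝ (E x₀) (ε₀ p) with hc
  set u : Fin m → Euc (n + 1) := fun p => ε₀ p - c p • E x₀ with hu
  have hux : ∀ p, ∀ x ∈ Metric.ball x₀ R, u p = Q x (ε₀ p) - inner ℝ (E x) (ε₀ p) • E x := by
    intro p x hx
    rw [hconst _ x hx, hQε]
  have hQu : ∀ p, ∀ x ∈ Metric.ball x₀ R, Q x (u p) = u p := by
    intro p x hx
    rw [hux p x hx, map_sub, map_smul, h.proj x (hsub hx), hQE x hx]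
  have huE : ∀ p, ∀ x ∈ Metric.ball x₀ R, inner ℝ (u p) (E x) = 0 := by
    intro p x hx
    rw [hux p x hx, inner_sub_left, real_inner_smul_left, hEE x hx, h.symm x (hsub hx), hQE x hx,
      real_inner_comm]
    ring
  have huu : ∀ p q, inner ℝ (u p) (u q) = (if p = q then (1 : ℝ) else 0) - c p * c q := by
    intro p q
    have h1 := huE p x₀ hmem
    calc inner ℝ (u p) (u q) = inner ℝ (u p) (ε₀ q) := by
          rw [hu] at h1 ⊢
          rw [inner_sub_right, real_inner_smul_right, h1, mul_zero, sub_zero]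
      _ = _ := by rw [hu, inner_sub_left, real_inner_smul_left, ho]
  have hcE : ∑ p, c p • ε₀ p = E x₀ := hsum _ (hQE x₀ hmem)
  have hcc : ∑ p, c p * c p = 1 := by
    rw [← hEE x₀ hmem]
    conv_rhs => rw [← hcE, inner_sum]
    rw [hcE]
    exact Finset.sum_congr rfl fun p _ => by rw [real_inner_smul_right]
  have hcu : ∑ p, c p • u p = 0 := by
    rw [hu]
    simp only [smul_sub, Finset.sum_sub_distrib, smul_smul, ← Finset.sum_smul]
    rw [hcE, hcc, one_smul, sub_self]
  refine ⟨R, hR, hsub, ρ, fun p x => u p + c p • E x, fun p x => inner ℝ (u p) (F x) + c p * ρ x,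
    sρ, hρpos, dρ, fun x hx p q => ?_, fun x hx p => ?_, fun p => ?_, fun p x hx X => ?_,
    Or.inr ⟨c, ?_, fun x _ => ?_⟩⟩
  · have h1 := huE p x hx
    have h2 := huE q x hx
    rw [real_inner_comm] at h2
    simp only [inner_add_left, inner_add_right, real_inner_smul_left, real_inner_smul_right, huu,
      h1, h2, hEE x hx]
    ring
  · rw [map_add, map_smul, hQu p x hx, hQE x hx]
  · exact (contDiffOn_const.inner ℝ (h.smooth.mono hsub)).add (contDiffOn_const.mul sρ)
  · have d1 : DifferentiableAt ℝ (fun y => inner ℝ (u p) (F y)) x :=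
      (differentiableAt_const _).inner ℝ (h.differentiableAt (hsub hx))
    have d2 := sρ.differentiableAt_of_isOpen hopen hx
    rw [fderiv_fun_add d1 (d2.const_mul _), fderiv_const_mul d2]
    simp only [add_apply, smul_apply, smul_eq_mul, dρ x hx,
      fderiv_inner_apply ℝ (differentiableAt_const _) (h.differentiableAt (hsub hx)), hE,
      inner_add_left, real_inner_smul_left]
    simp
  · intro h0
    rw [h0] at hcc
    simp at hcc
  · have h1 : ∑ p, c p * inner ℝ (u p) (F x) = 0 := by
      have := congrArg (fun w => inner ℝ w (F x)) hcu
      simpa [sum_inner, real_inner_smul_left] using this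
    simp only [mul_add, Finset.sum_add_distrib, h1, zero_add, ← mul_assoc, ← Finset.sum_mul, hcc,
      one_mul]

theorem exists_parallelFrame (h : NullityField F Q A V) (hx₀ : x₀ ∈ V)
    (hm : opTrace (n + 1) (Q x₀) = m) :
    ∃ R > 0, Metric.ball x₀ R ⊆ V ∧ ∃ (ρ : Euc n → ℝ) (ε : Fin m → Euc n → Euc (n + 1))
      (ξ : Fin m → Euc n → ℝ), ParallelFrame F Q A ρ ε ξ (Metric.ball x₀ R) := by
  by_cases hA : A x₀ = 0
  · exact h.exists_parallelFrame_of_eq_zero hx₀ hm hA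
  · exact h.exists_parallelFrame_of_ne_zero hx₀ hm hA

end NullityField

end Bonnet

end


/-! ### The kernel of D is a nullity field -/

open scoped ContDiff Topology

noncomputable section

namespace Bonnet

/-- The orthogonal projection onto the kernel of `D` in the tangent space, for a field `D` with
eigenvalues `l, -l, 0, …, 0`. -/
def nullityProj {n : ℕ} (N : Euc n → Euc (n + 1)) (D : Euc n → Euc (n + 1) →L[ℝ] Euc (n + 1))
    (x : Euc n) : Euc (n + 1) →L[ℝ] Euc (n + 1) :=
  ContinuousLinearMap.id ℝ _ - (innerSL ℝ (N x)).smulRight (N x)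
    - (2 / opTrace (n + 1) (D x ∘L D x)) • (D x ∘L D x)

/-- The vector field, in the range of `nullityProj N D`, dual to `-d(log |D|)/2`. -/
def nullityGrad {n : ℕ} (F N : Euc n → Euc (n + 1)) (D : Euc n → Euc (n + 1) →L[ℝ] Euc (n + 1))
    (x : Euc n) : Euc (n + 1) :=
  ∑ a, (-(1 / (2 * opTrace (n + 1) (D x ∘L D x)))
    * fderiv ℝ (fun y => opTrace (n + 1) (D y ∘L D y)) x
      (tangentCoord F N x (nullityProj N D x (coordVec a)))) • coordVec a

theorem inner_nullityGrad {n : ℕ} (F N : Euc n → Euc (n + 1))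
    (D : Euc n → Euc (n + 1) →L[ℝ] Euc (n + 1)) (x : Euc n) (v : Euc (n + 1)) :
    inner ℝ (nullityGrad F N D x) v = -(1 / (2 * opTrace (n + 1) (D x ∘L D x)))
      * fderiv ℝ (fun y => opTrace (n + 1) (D y ∘L D y)) x
        (tangentCoord F N x (nullityProj N D x v)) := by
  have hv : v = ∑ a, v a • coordVec a := by
    have := (EuclideanSpace.basisFun (Fin (n + 1)) ℝ).sum_repr v
    simpa [coordVec] using this.symm
  have hc : ∀ a, inner ℝ (coordVec a) v = v a := fun a => by
    simp [coordVec, EuclideanSpace.inner_single_left]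
  rw [nullityGrad, sum_inner]
  conv_rhs => rw [hv]
  simp only [map_sum, map_smul, real_inner_smul_left, Finset.mul_sum, smul_eq_mul, hc]
  exact Finset.sum_congr rfl fun a _ => by ring

namespace ShapePair

variable {n : ℕ} {F N : Euc n → Euc (n + 1)} {D S : Euc n → Euc (n + 1) →L[ℝ] Euc (n + 1)}
  {V : Set (Euc n)} {x : Euc n} {e : OrthonormalBasis (Fin (n + 1)) ℝ (Euc (n + 1))}
  {i j : Fin (n + 1)} {l r t : ℝ}

theorem contDiffOn_opTrace_sq (h : ShapePair F N D S V) :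
    ContDiffOn ℝ ∞ (fun y => opTrace (n + 1) (D y ∘L D y)) V :=
  (opTrace (n + 1)).contDiff.comp_contDiffOn (h.smooth_D.clm_comp h.smooth_D)

theorem opTrace_sq_pos (h : ShapePair F N D S V) (hx : x ∈ V) (hD : D x ≠ 0) :
    0 < opTrace (n + 1) (D x ∘L D x) := by
  obtain ⟨e, i, j, l, r, t, hf⟩ := h.exists_frame hx hD
  rw [hf.opTrace_D_comp_D]
  have := hf.pos
  positivity

theorem nullityProj_apply (hf : AdaptedFrame (D x) (S x) e i j l r t) (v : Euc (n + 1)) :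
    nullityProj N D x v = v - inner ℝ (N x) v • N x - inner ℝ v (e i) • e i
      - inner ℝ v (e j) • e j := by
  have hl := hf.pos.ne'
  simp only [nullityProj, hf.opTrace_D_comp_D, sub_apply, smul_apply,
    ContinuousLinearMap.comp_apply, ContinuousLinearMap.smulRight_apply, innerSL_apply_apply,
    ContinuousLinearMap.id_apply]
  rw [hf.D_apply v, map_sub, map_smul, map_smul, hf.D_fst, hf.D_snd, sub_sub _ (_ • e i)]
  congr 1
  simp only [smul_sub, smul_smul]
  rw [sub_eq_add_neg, ← neg_smul]
  congr 2 <;> field_simp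

theorem nullityProj_symm (h : ShapePair F N D S V) (hx : x ∈ V) (v w : Euc (n + 1)) :
    inner ℝ (nullityProj N D x v) w = inner ℝ v (nullityProj N D x w) := by
  simp only [nullityProj, sub_apply, smul_apply,
    ContinuousLinearMap.comp_apply, ContinuousLinearMap.smulRight_apply, innerSL_apply_apply,
    ContinuousLinearMap.id_apply, inner_sub_left, inner_sub_right, real_inner_smul_left,
    real_inner_smul_right, h.symm_D x hx]
  rw [real_inner_comm (N x) v]
  ring

theorem nullityProj_fst (h : ShapePair F N D S V) (hx : x ∈ V)
    (hf : AdaptedFrame (D x) (S x) e i j l r t) : nullityProj N D x (e i) = 0 := by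
  simp [nullityProj_apply hf, h.inner_normal_fst hx hf, hf.ne]

theorem nullityProj_snd (h : ShapePair F N D S V) (hx : x ∈ V)
    (hf : AdaptedFrame (D x) (S x) e i j l r t) : nullityProj N D x (e j) = 0 := by
  simp [nullityProj_apply hf, h.inner_normal_snd hx hf, hf.ne.symm]

theorem nullityProj_normal (h : ShapePair F N D S V) (hx : x ∈ V) :
    nullityProj N D x (N x) = 0 := by
  simp [nullityProj, h.normal_D x hx, h.hyp.norm_normal x hx]

theorem nullityProj_D (h : ShapePair F N D S V) (hx : x ∈ V) (hD : D x ≠ 0) (v : Euc (n + 1)) :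
    nullityProj N D x (D x v) = 0 := by
  obtain ⟨e, i, j, l, r, t, hf⟩ := h.exists_frame hx hD
  rw [hf.D_apply, map_sub, map_smul, map_smul, h.nullityProj_fst hx hf, h.nullityProj_snd hx hf]
  simp

theorem nullityProj_S (h : ShapePair F N D S V) (hx : x ∈ V) (hD : D x ≠ 0) (v : Euc (n + 1)) :
    nullityProj N D x (S x v) = 0 := by
  obtain ⟨e, i, j, l, r, t, hf⟩ := h.exists_frame hx hD
  rw [hf.S_apply, map_add, map_smul, map_smul, h.nullityProj_fst hx hf, h.nullityProj_snd hx hf]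
  simp

theorem nullityProj_nullityProj (h : ShapePair F N D S V) (hx : x ∈ V) (hD : D x ≠ 0)
    (v : Euc (n + 1)) : nullityProj N D x (nullityProj N D x v) = nullityProj N D x v := by
  obtain ⟨e, i, j, l, r, t, hf⟩ := h.exists_frame hx hD
  conv_lhs => rw [nullityProj_apply hf v]
  simp only [map_sub, map_smul, h.nullityProj_fst hx hf, h.nullityProj_snd hx hf,
    h.nullityProj_normal hx]
  simp

theorem nullityProj_fderiv_normal (h : ShapePair F N D S V) (hx : x ∈ V) (hD : D x ≠ 0)
    (X : Euc n) : nullityProj N D x (fderiv ℝ N x X) = 0 := by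
  rw [h.hyp.fderiv_normal_eq hx, h.weingarten x hx]
  simp [h.nullityProj_D hx hD, h.nullityProj_S hx hD]

theorem contDiffOn_nullityProj (h : ShapePair F N D S V) (hD : ∀ x ∈ V, D x ≠ 0) :
    ContDiffOn ℝ ∞ (nullityProj N D) V := by
  have hq := h.contDiffOn_opTrace_sq
  refine (contDiffOn_const.sub (ContDiffOn.smulRight ?_ h.hyp.smooth_normal)).sub
    (ContDiffOn.smul (contDiffOn_const.div hq fun x hx => (h.opTrace_sq_pos hx (hD x hx)).ne')
      (h.smooth_D.clm_comp h.smooth_D))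
  exact (innerSL ℝ).contDiff.comp_contDiffOn h.hyp.smooth_normal

theorem contDiffOn_nullityGrad (h : ShapePair F N D S V) (hD : ∀ x ∈ V, D x ≠ 0) :
    ContDiffOn ℝ ∞ (nullityGrad F N D) V := by
  have hq := h.contDiffOn_opTrace_sq
  refine ContDiffOn.sum fun a _ => ContDiffOn.fun_smul (ContDiffOn.mul ?_ ?_) contDiffOn_const
  · exact (contDiffOn_const.div (contDiffOn_const.mul hq)
      fun x hx => mul_ne_zero two_ne_zero (h.opTrace_sq_pos hx (hD x hx)).ne').neg
  · exact (hq.fderiv_infty h.hyp.isOpen).clm_apply (h.hyp.contDiffOn_tangentCoord.clm_apply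
      ((h.contDiffOn_nullityProj hD).clm_apply contDiffOn_const))

theorem opTrace_nullityProj (h : ShapePair F N D S V) (hx : x ∈ V) (hD : D x ≠ 0) :
    opTrace (n + 1) (nullityProj N D x) = (n : ℝ) - 2 := by
  have hq := (h.opTrace_sq_pos hx hD).ne'
  have h1 : opTrace (n + 1) ((innerSL ℝ (N x)).smulRight (N x)) = 1 := by
    have h0 := (EuclideanSpace.basisFun (Fin (n + 1)) ℝ).sum_sq_norm_inner_right (N x)
    rw [h.hyp.norm_normal x hx, one_pow] at h0
    rw [opTrace_eq_sum _ (EuclideanSpace.basisFun (Fin (n + 1)) ℝ), ← h0]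
    refine Finset.sum_congr rfl fun a _ => ?_
    simp [EuclideanSpace.inner_single_left, EuclideanSpace.inner_single_right, sq]
  have h2 : opTrace (n + 1) (ContinuousLinearMap.id ℝ (Euc (n + 1))) = n + 1 := by
    rw [opTrace_apply]
    simp
  rw [nullityProj, map_sub, map_sub, map_smul, h1, h2, smul_eq_mul, div_mul_cancel₀ _ hq]
  ring

/-- Differentiating Q D z = 0 converts the derivative of Q on the range of D into the kernel
component of dD, which `inner_fderiv_D_kernel` evaluates. -/
theorem fderiv_nullityProj_D (h : ShapePair F N D S V) (hD : ∀ x ∈ V, D x ≠ 0) (hx : x ∈ V)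
    (X : Euc n) (z : Euc (n + 1)) :
    fderiv ℝ (nullityProj N D) x X (D x z)
      = inner ℝ (D x z) (fderiv ℝ F x X) • nullityGrad F N D x := by
  have hV := h.hyp.isOpen
  have hQ := (h.contDiffOn_nullityProj hD).differentiableAt_of_isOpen hV hx
  have e0 := congrArg (fun L => L X) (fderiv_eq_of_eqOn hV
    (fun y hy => h.nullityProj_D hy (hD y hy) z) hx)
  simp only [fderiv_clm_apply_apply hQ
    ((h.differentiableAt_D hx).clm_apply (differentiableAt_const z)),
    fderiv_clm_apply_const (h.differentiableAt_D hx), fderiv_fun_const, Pi.zero_apply,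
    zero_apply] at e0
  obtain ⟨e, i, j, l, r, t, hf⟩ := h.exists_frame hx (hD x hx)
  refine ext_inner_right ℝ fun w => ?_
  have hker := h.inner_fderiv_D_kernel hx hf X z (p := nullityProj N D x w)
    (by rw [h.nullityProj_symm hx, h.nullityProj_fst hx hf, inner_zero_right])
    (by rw [h.nullityProj_symm hx, h.nullityProj_snd hx hf, inner_zero_right])
    (by rw [← h.nullityProj_symm hx, h.nullityProj_normal hx, inner_zero_left])
  rw [eq_neg_of_add_eq_zero_left e0, inner_neg_left, h.nullityProj_symm hx, hker,
    real_inner_smul_left, inner_nullityGrad]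
  ring

/-- The derivative of Q is known on the range of D, and it kills N because dN lies in the ranges of
D and S, on which Q vanishes. Symmetry of dQ and the identity Q dQ Q = 0, a consequence of Q² = Q,
determine the rest. -/
theorem nullityField (h : ShapePair F N D S V) (hD : ∀ x ∈ V, D x ≠ 0) :
    NullityField F (nullityProj N D) (nullityGrad F N D) V := by
  have hV := h.hyp.isOpen
  have hA : ∀ x ∈ V, nullityProj N D x (nullityGrad F N D x) = nullityGrad F N D x := by
    intro x hx
    refine ext_inner_right ℝ fun w => ?_
    rw [h.nullityProj_symm hx, inner_nullityGrad, inner_nullityGrad,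
      h.nullityProj_nullityProj hx (hD x hx)]
  refine ⟨hV, h.hyp.smooth, h.contDiffOn_nullityProj hD, h.contDiffOn_nullityGrad hD,
    fun x hx => h.nullityProj_symm hx, fun x hx => h.nullityProj_nullityProj hx (hD x hx), hA,
    ?_, ?_⟩
  · intro x hx X v
    have hQ := (h.contDiffOn_nullityProj hD).differentiableAt_of_isOpen hV hx
    set Q := nullityProj N D with hQdef
    set A := nullityGrad F N D with hAdef
    have hQs : ∀ v w, inner ℝ (Q x v) w = inner ℝ v (Q x w) := h.nullityProj_symm hx
    have hsymm : ∀ v w, inner ℝ (fderiv ℝ Q x X v) w = inner ℝ v (fderiv ℝ Q x X w) := fun v w => by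
      rw [fderiv_clm_symm hV hx hQ (fun y hy => h.nullityProj_symm hy), real_inner_comm]
    have hproj : ∀ v, fderiv ℝ Q x X (Q x v) + Q x (fderiv ℝ Q x X v) = fderiv ℝ Q x X v := by
      intro v
      have e0 := congrArg (fun L => L X) (fderiv_eq_of_eqOn (f := fun y => Q y (Q y v))
        (g := fun y => Q y v) hV (fun y hy => h.nullityProj_nullityProj hy (hD y hy) v) hx)
      simpa only [fderiv_clm_apply_apply hQ (hQ.clm_apply (differentiableAt_const v)),
        fderiv_clm_apply_const hQ] using e0
    have hnorm : fderiv ℝ Q x X (N x) = 0 := by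
      have e0 := congrArg (fun L => L X) (fderiv_eq_of_eqOn (f := fun y => Q y (N y))
        (g := fun _ => 0) hV (fun y hy => h.nullityProj_normal hy) hx)
      have e1 : Q x (fderiv ℝ N x X) = 0 := h.nullityProj_fderiv_normal hx (hD x hx) X
      simpa only [fderiv_clm_apply_apply hQ (h.hyp.differentiableAt_normal hx), e1, add_zero,
        fderiv_fun_const, Pi.zero_apply, zero_apply] using e0
    have hQQ : ∀ v, Q x (fderiv ℝ Q x X (Q x v)) = 0 := by
      intro v
      have hp : ∀ v, Q x (Q x v) = Q x v := h.nullityProj_nullityProj hx (hD x hx)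
      have e0 := congrArg (Q x) (hproj (Q x v))
      rw [map_add, hp, hp] at e0
      simpa using e0
    set Z := fderiv ℝ F x X - Q x (fderiv ℝ F x X) with hZ
    have hdec : ∀ v, ∃ z, v = Q x v + inner ℝ (N x) v • N x + D x z := by
      intro v
      refine ⟨(2 / opTrace (n + 1) (D x ∘L D x)) • D x v, ?_⟩
      simp only [hQdef, nullityProj, sub_apply, ContinuousLinearMap.id_apply,
        ContinuousLinearMap.smulRight_apply, innerSL_apply_apply, smul_apply,
        ContinuousLinearMap.comp_apply, map_smul]
      abel
    have hDZ : ∀ z, inner ℝ (D x z) (fderiv ℝ F x X) = inner ℝ Z (D x z) := by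
      intro z
      rw [hZ, inner_sub_left, hQs, h.nullityProj_D hx (hD x hx), inner_zero_right, sub_zero,
        real_inner_comm]
    have hZQ : ∀ v, inner ℝ Z (Q x v) = 0 := by
      intro v
      rw [← hQs, hZ, map_sub, h.nullityProj_nullityProj hx (hD x hx), sub_self, inner_zero_left]
    have hZN : inner ℝ Z (N x) = 0 := by
      rw [hZ, inner_sub_left, hQs, h.nullityProj_normal hx, inner_zero_right,
        h.hyp.normal_orthogonal x hx, sub_zero]
    have hAN : inner ℝ (A x) (N x) = 0 := by
      rw [← hA x hx, hQs, h.nullityProj_normal hx, inner_zero_right]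
    have hAD : ∀ z, inner ℝ (A x) (D x z) = 0 := by
      intro z
      rw [← hA x hx, hQs, h.nullityProj_D hx (hD x hx), inner_zero_right]
    have hder : ∀ z, fderiv ℝ Q x X (D x z) = inner ℝ Z (D x z) • A x := by
      intro z
      rw [← hDZ]
      exact h.fderiv_nullityProj_D hD hx X z
    refine ext_inner_right ℝ fun w => ?_
    obtain ⟨z, hz⟩ := hdec v
    obtain ⟨z', hz'⟩ := hdec w
    have h1 : inner ℝ (fderiv ℝ Q x X (Q x v)) w = inner ℝ (A x) v * inner ℝ Z w := by
      have hw : inner ℝ Z w = inner ℝ Z (D x z') := by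
        conv_lhs => rw [hz']
        rw [inner_add_right, inner_add_right, hZQ, real_inner_smul_right, hZN]
        ring
      have hv : inner ℝ (A x) v = inner ℝ (A x) (Q x v) := by rw [← hQs, hA x hx]
      rw [hsymm, hw, hv]
      conv_lhs => rw [hz']
      rw [map_add, map_add, map_smul, hnorm, inner_add_right, inner_add_right, hder, hQs, hQQ,
        real_inner_smul_right, real_inner_smul_right, inner_zero_right, inner_zero_right,
        real_inner_comm (A x)]
      ring
    have hZv : inner ℝ Z v = inner ℝ Z (D x z) := by
      conv_lhs => rw [hz]
      rw [inner_add_right, inner_add_right, hZQ, real_inner_smul_right, hZN]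
      ring
    conv_lhs => rw [hz]
    rw [map_add, map_add, map_smul, hnorm, inner_add_left, inner_add_left, h1, hder, hZv,
      inner_add_left, real_inner_smul_left, real_inner_smul_left, real_inner_smul_left]
    simp
  · intro x hx X
    obtain ⟨e, i, j, l, r, t, hf⟩ := h.exists_frame hx (hD x hx)
    have hNi := h.inner_normal_fst hx hf
    have hNj := h.inner_normal_snd hx hf
    have hTN : inner ℝ (N x) (fderiv ℝ F x X) = 0 := by
      rw [real_inner_comm, h.hyp.normal_orthogonal x hx]
    have hex : ∀ a b : ℝ, fderiv ℝ F x (tangentCoord F N x (a • e i + b • e j))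
        = a • e i + b • e j := fun a b =>
      h.hyp.fderiv_tangentCoord_of_inner_eq_zero hx (by
        simp [inner_add_right, real_inner_smul_right, hNi, hNj])
    have hQe : ∀ a b : ℝ, nullityProj N D x (a • e i + b • e j) = 0 := fun a b => by
      simp [h.nullityProj_fst hx hf, h.nullityProj_snd hx hf]
    set a := inner ℝ (fderiv ℝ F x X) (e i) with ha
    set b := inner ℝ (fderiv ℝ F x X) (e j) with hb
    have hZ : fderiv ℝ F x X - nullityProj N D x (fderiv ℝ F x X) = a • e i + b • e j := by
      rw [nullityProj_apply hf, hTN]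
      module
    have hin : ∀ c d : ℝ, inner ℝ (c • e i + d • e j) (a • e i + b • e j) = c * a + d * b := by
      intro c d
      simp [inner_add_right, inner_add_left, real_inner_smul_right, real_inner_smul_left, hf.ne,
        hf.ne.symm]
      ring
    have hne : ∀ c d : ℝ, c • e i + d • e j = 0 → c = 0 ∧ d = 0 := by
      intro c d h0
      have h1 := congrArg (fun v => inner ℝ v (e i)) h0
      have h2 := congrArg (fun v => inner ℝ v (e j)) h0
      simp [inner_add_left, real_inner_smul_left, hf.ne, hf.ne.symm] at h1 h2
      exact ⟨h1, h2⟩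
    -- A quarter turn of the plane component of X gives the orthogonal vector; if that component is
    -- zero, e_i will do.
    by_cases h0 : a = 0 ∧ b = 0
    · refine ⟨tangentCoord F N x ((1 : ℝ) • e i + (0 : ℝ) • e j), ?_, ?_⟩
      · rw [hex, hQe, sub_zero]
        exact fun h1 => one_ne_zero (hne _ _ h1).1
      · rw [hex, hQe, sub_zero, hZ, hin, h0.1, h0.2]; ring
    · refine ⟨tangentCoord F N x ((-b) • e i + a • e j), ?_, ?_⟩
      · rw [hex, hQe, sub_zero]
        exact fun h1 => h0 ⟨(hne _ _ h1).2, neg_eq_zero.1 (hne _ _ h1).1⟩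
      · rw [hex, hQe, sub_zero, hZ, hin]; ring

end ShapePair

end Bonnet

end


/-! ### Smooth eigenvector fields of D and their closed one-forms -/

open scoped ContDiff Topology

noncomputable section

namespace Bonnet

/-- The positive eigenvalue of `D x`. -/
def topEigenvalue {n : ℕ} (D : Euc n → Euc (n + 1) →L[ℝ] Euc (n + 1)) (x : Euc n) : ℝ :=
  √(opTrace (n + 1) (D x ∘L D x) / 2)

theorem AdaptedFrame.eq_smul_fst {k : ℕ} {D S : Euc k →L[ℝ] Euc k}
    {e : OrthonormalBasis (Fin k) ℝ (Euc k)} {i j : Fin k} {l r t : ℝ}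
    (h : AdaptedFrame D S e i j l r t) {v : Euc k} (hv : D v = l • v) :
    v = inner ℝ v (e i) • e i := by
  have hl := h.pos.ne'
  rw [h.D_apply] at hv
  have h1 := congrArg (fun w => inner ℝ w (e j)) hv
  simp [inner_sub_left, real_inner_smul_left, h.ne] at h1
  have h2 : inner ℝ v (e j) = 0 := by
    have : l * inner ℝ v (e j) = 0 := by linarith
    exact (mul_eq_zero.1 this).resolve_left hl
  rw [h2, mul_zero, zero_smul, sub_zero, mul_smul] at hv
  exact (smul_right_injective _ hl hv).symm

theorem AdaptedFrame.eq_smul_snd {k : ℕ} {D S : Euc k →L[ℝ] Euc k}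
    {e : OrthonormalBasis (Fin k) ℝ (Euc k)} {i j : Fin k} {l r t : ℝ}
    (h : AdaptedFrame D S e i j l r t) {v : Euc k} (hv : D v = -l • v) :
    v = inner ℝ v (e j) • e j := by
  have hl := h.pos.ne'
  rw [h.D_apply] at hv
  have h1 := congrArg (fun w => inner ℝ w (e i)) hv
  simp [inner_sub_left, real_inner_smul_left, h.ne.symm] at h1
  have h2 : inner ℝ v (e i) = 0 := by
    have : l * inner ℝ v (e i) = 0 := by linarith
    exact (mul_eq_zero.1 this).resolve_left hl
  rw [h2, mul_zero, zero_smul, zero_sub, ← neg_smul, ← neg_mul, mul_smul] at hv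
  exact (smul_right_injective _ (neg_ne_zero.2 hl) hv).symm

/-- Smooth unit eigenvector fields of `D` for its two nonzero eigenvalues. -/
structure EigenFrame {n : ℕ} (N : Euc n → Euc (n + 1))
    (D S : Euc n → Euc (n + 1) →L[ℝ] Euc (n + 1)) (h₁ h₂ : Euc n → Euc (n + 1))
    (V : Set (Euc n)) : Prop where
  smooth_fst : ContDiffOn ℝ ∞ h₁ V
  smooth_snd : ContDiffOn ℝ ∞ h₂ V
  unit_fst : ∀ x ∈ V, inner ℝ (h₁ x) (h₁ x) = 1
  unit_snd : ∀ x ∈ V, inner ℝ (h₂ x) (h₂ x) = 1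
  orthogonal : ∀ x ∈ V, inner ℝ (h₁ x) (h₂ x) = 0
  D_fst : ∀ x ∈ V, D x (h₁ x) = topEigenvalue D x • h₁ x
  D_snd : ∀ x ∈ V, D x (h₂ x) = -topEigenvalue D x • h₂ x
  S_eq : ∀ x ∈ V, inner ℝ (S x (h₁ x)) (h₁ x) = inner ℝ (S x (h₂ x)) (h₂ x)
  decomp : ∀ x ∈ V, ∀ v, v = nullityProj N D x v + inner ℝ (N x) v • N x
    + inner ℝ (h₁ x) v • h₁ x + inner ℝ (h₂ x) v • h₂ x

theorem EigenFrame.mono {n : ℕ} {N : Euc n → Euc (n + 1)}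
    {D S : Euc n → Euc (n + 1) →L[ℝ] Euc (n + 1)} {h₁ h₂ : Euc n → Euc (n + 1)}
    {V V' : Set (Euc n)} (h : EigenFrame N D S h₁ h₂ V) (hV : V' ⊆ V) :
    EigenFrame N D S h₁ h₂ V' :=
  ⟨h.smooth_fst.mono hV, h.smooth_snd.mono hV, fun x hx => h.unit_fst x (hV hx),
    fun x hx => h.unit_snd x (hV hx), fun x hx => h.orthogonal x (hV hx),
    fun x hx => h.D_fst x (hV hx), fun x hx => h.D_snd x (hV hx), fun x hx => h.S_eq x (hV hx),
    fun x hx => h.decomp x (hV hx)⟩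

namespace ShapePair

variable {n : ℕ} {F N : Euc n → Euc (n + 1)} {D S : Euc n → Euc (n + 1) →L[ℝ] Euc (n + 1)}
  {V : Set (Euc n)} {x : Euc n} {e : OrthonormalBasis (Fin (n + 1)) ℝ (Euc (n + 1))}
  {i j : Fin (n + 1)} {l r t : ℝ}

theorem mono (h : ShapePair F N D S V) {V' : Set (Euc n)} (ho : IsOpen V') (hV : V' ⊆ V) :
    ShapePair F N D S V' :=
  ⟨h.hyp.mono ho hV, h.smooth_D.mono hV, h.smooth_S.mono hV, fun x hx => h.symm_D x (hV hx),
    fun x hx => h.symm_S x (hV hx), fun x hx => h.normal_D x (hV hx),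
    fun x hx => h.normal_S x (hV hx), fun x hx => h.codazzi_D x (hV hx),
    fun x hx => h.codazzi_S x (hV hx), fun x hx => h.trace_D x (hV hx),
    fun x hx => h.trace_S x (hV hx), fun x hx => h.gauss x (hV hx),
    fun x hx => h.weingarten x (hV hx)⟩

theorem topEigenvalue_eq (hf : AdaptedFrame (D x) (S x) e i j l r t) :
    topEigenvalue D x = l := by
  rw [topEigenvalue, hf.opTrace_D_comp_D, mul_div_cancel_left₀ _ two_ne_zero,
    Real.sqrt_sq hf.pos.le]

theorem topEigenvalue_pos (h : ShapePair F N D S V) (hx : x ∈ V) (hD : D x ≠ 0) :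
    0 < topEigenvalue D x :=
  Real.sqrt_pos.2 (half_pos (h.opTrace_sq_pos hx hD))

theorem contDiffOn_topEigenvalue (h : ShapePair F N D S V) (hD : ∀ x ∈ V, D x ≠ 0) :
    ContDiffOn ℝ ∞ (topEigenvalue D) V :=
  (h.contDiffOn_opTrace_sq.div_const 2).sqrt
    fun x hx => Ne.symm (half_pos (h.opTrace_sq_pos hx (hD x hx))).ne

/-- A unit eigenvector of `D x₀` for the eigenvalue `σ l`, `σ = ±1`, extends to a smooth field. -/
theorem exists_eigenfield (h : ShapePair F N D S V) (hD : ∀ x ∈ V, D x ≠ 0) {x₀ : Euc n}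
    (hx₀ : x₀ ∈ V) {σ : ℝ} (hσ : σ * σ = 1) {v : Euc (n + 1)} (hv0 : v ≠ 0)
    (hv : D x₀ v = (σ * topEigenvalue D x₀) • v) :
    ∃ R > 0, Metric.ball x₀ R ⊆ V ∧ ∃ u : Euc n → Euc (n + 1),
      ContDiffOn ℝ ∞ u (Metric.ball x₀ R) ∧ ∀ x ∈ Metric.ball x₀ R,
        inner ℝ (u x) (u x) = 1 ∧ D x (u x) = (σ * topEigenvalue D x) • u x := by
  -- From D³ = l²D it follows that D² + σlD maps every vector to an eigenvector for σl or to zero.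
  -- Applied to the fixed vector v it is smooth in x, and nonzero at x₀ since v is already an
  -- eigenvector there.
  set k : Euc n → Euc (n + 1) := fun x => D x (D x v) + (σ * topEigenvalue D x) • D x v with hk
  have hDk : ∀ x ∈ V, D x (k x) = (σ * topEigenvalue D x) • k x := by
    intro x hx
    obtain ⟨e, i, j, l, r, t, hf⟩ := h.exists_frame hx (hD x hx)
    have h3 : D x (D x (D x v)) = (l * l) • D x v := by
      rw [hf.D_apply v]
      simp only [map_sub, map_smul, hf.D_fst, hf.D_snd]
      module
    have h4 : (l * l) = (σ * l) * (σ * l) := by linear_combination -(l * l) * hσ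
    simp only [hk, topEigenvalue_eq hf, map_add, map_smul, h3]
    rw [h4]
    module
  have hks : ContDiffOn ℝ ∞ k V := by
    have h1 := h.smooth_D.clm_apply (contDiffOn_const (c := v))
    exact (h.smooth_D.clm_apply h1).add
      ((contDiffOn_const.mul (h.contDiffOn_topEigenvalue hD)).smul h1)
  have hk0 : k x₀ ≠ 0 := by
    have : k x₀ = (2 * (topEigenvalue D x₀) ^ 2) • v := by
      simp only [hk, hv, map_smul, smul_smul]
      rw [← add_smul]
      congr 1
      linear_combination 2 * (topEigenvalue D x₀) ^ 2 * hσ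
    rw [this]
    have := h.topEigenvalue_pos hx₀ (hD x₀ hx₀)
    exact smul_ne_zero (by positivity) hv0
  have hev : ∀ᶠ x in 𝓝 x₀, x ∈ V ∧ k x ≠ 0 :=
    Filter.Eventually.and (h.hyp.isOpen.mem_nhds hx₀)
      ((hks.continuousOn.continuousAt (h.hyp.isOpen.mem_nhds hx₀)).eventually_ne hk0)
  obtain ⟨R, hR, hball⟩ := Metric.eventually_nhds_iff_ball.1 hev
  refine ⟨R, hR, fun x hx => (hball x hx).1, fun x => ‖k x‖⁻¹ • k x, ?_, fun x hx => ⟨?_, ?_⟩⟩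
  · have h1 := hks.mono fun x hx => (hball x hx).1
    exact ((h1.norm ℝ fun x hx => (hball x hx).2).inv
      fun x hx => norm_ne_zero_iff.2 (hball x hx).2).smul h1
  · have := norm_ne_zero_iff.2 (hball x hx).2
    rw [real_inner_smul_left, real_inner_smul_right, real_inner_self_eq_norm_sq]
    field_simp
  · rw [map_smul, hDk x (hball x hx).1, smul_comm]

/-- The eigenspaces for l and -l are lines, so at each point the smooth eigenvectors agree up to
sign with the first two vectors of an adapted frame, and its algebraic relations carry over. -/
theorem exists_eigenFrame (h : ShapePair F N D S V) (hD : ∀ x ∈ V, D x ≠ 0) {x₀ : Euc n}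
    (hx₀ : x₀ ∈ V) :
    ∃ R > 0, Metric.ball x₀ R ⊆ V ∧ ∃ h₁ h₂ : Euc n → Euc (n + 1),
      EigenFrame N D S h₁ h₂ (Metric.ball x₀ R) := by
  obtain ⟨e, i, j, l, r, t, hf⟩ := h.exists_frame hx₀ (hD x₀ hx₀)
  obtain ⟨R₁, hR₁, hV₁, h₁, hs₁, hh₁⟩ := h.exists_eigenfield hD hx₀ (σ := 1) (by norm_num)
    (e.orthonormal.ne_zero i) (by rw [topEigenvalue_eq hf, one_mul, hf.D_fst])
  obtain ⟨R₂, hR₂, -, h₂, hs₂, hh₂⟩ := h.exists_eigenfield hD hx₀ (σ := -1) (by norm_num)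
    (e.orthonormal.ne_zero j) (by rw [topEigenvalue_eq hf, neg_one_mul, hf.D_snd])
  have hb₁ : Metric.ball x₀ (min R₁ R₂) ⊆ Metric.ball x₀ R₁ :=
    Metric.ball_subset_ball (min_le_left _ _)
  have hb₂ : Metric.ball x₀ (min R₁ R₂) ⊆ Metric.ball x₀ R₂ :=
    Metric.ball_subset_ball (min_le_right _ _)
  have hfr : ∀ x ∈ Metric.ball x₀ (min R₁ R₂), ∃ (e : OrthonormalBasis (Fin (n + 1)) ℝ
      (Euc (n + 1))) (i j : Fin (n + 1)) (l r t a b : ℝ), AdaptedFrame (D x) (S x) e i j l r t ∧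
        a * a = 1 ∧ b * b = 1 ∧ h₁ x = a • e i ∧ h₂ x = b • e j := by
    intro x hx
    obtain ⟨e, i, j, l, r, t, hf⟩ := h.exists_frame (hV₁ (hb₁ hx)) (hD x (hV₁ (hb₁ hx)))
    obtain ⟨u₁, d₁⟩ := hh₁ x (hb₁ hx)
    obtain ⟨u₂, d₂⟩ := hh₂ x (hb₂ hx)
    rw [topEigenvalue_eq hf, one_mul] at d₁
    rw [topEigenvalue_eq hf, neg_one_mul] at d₂
    have a₁ := hf.eq_smul_fst d₁
    have a₂ := hf.eq_smul_snd d₂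
    refine ⟨e, i, j, l, r, t, _, _, hf, ?_, ?_, a₁, a₂⟩
    · rw [a₁, real_inner_smul_left, real_inner_smul_right, real_inner_self_eq_norm_sq,
        e.norm_eq_one] at u₁
      linarith
    · rw [a₂, real_inner_smul_left, real_inner_smul_right, real_inner_self_eq_norm_sq,
        e.norm_eq_one] at u₂
      linarith
  refine ⟨min R₁ R₂, lt_min hR₁ hR₂, hb₁.trans hV₁, h₁, h₂, hs₁.mono hb₁, hs₂.mono hb₂,
    fun x hx => (hh₁ x (hb₁ hx)).1, fun x hx => (hh₂ x (hb₂ hx)).1, ?_, fun x hx => ?_,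
    fun x hx => ?_, ?_, ?_⟩
  · intro x hx
    obtain ⟨e, i, j, l, r, t, a, b, hf, -, -, e₁, e₂⟩ := hfr x hx
    simp [e₁, e₂, real_inner_smul_left, real_inner_smul_right, hf.ne]
  · simpa using (hh₁ x (hb₁ hx)).2
  · simpa using (hh₂ x (hb₂ hx)).2
  · intro x hx
    obtain ⟨e, i, j, l, r, t, a, b, hf, ha, hb, e₁, e₂⟩ := hfr x hx
    simp [e₁, e₂, real_inner_smul_left, real_inner_smul_right, hf.S_fst, hf.S_snd, inner_add_left,
      hf.ne, hf.ne.symm]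
    linear_combination t * ha - t * hb
  · intro x hx v
    obtain ⟨e, i, j, l, r, t, a, b, hf, ha, hb, e₁, e₂⟩ := hfr x hx
    rw [nullityProj_apply hf, e₁, e₂]
    simp only [real_inner_smul_left, smul_smul]
    rw [show a * inner ℝ (e i) v * a = inner ℝ v (e i) by
        rw [real_inner_comm]; linear_combination inner ℝ v (e i) * ha,
      show b * inner ℝ (e j) v * b = inner ℝ v (e j) by
        rw [real_inner_comm]; linear_combination inner ℝ v (e j) * hb]
    abel

/-- The exterior derivative of the one-form dual to an eigenvector field. -/
theorem fderiv_eigenform (h : ShapePair F N D S V) (hD : ∀ x ∈ V, D x ≠ 0) (hx : x ∈ V)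
    {μ : Euc n → ℝ} {u u' : Euc n → Euc (n + 1)} (hμ : DifferentiableAt ℝ μ x) (hμ0 : μ x ≠ 0)
    (hu : DifferentiableAt ℝ u x) (hunit : ∀ y ∈ V, inner ℝ (u y) (u y) = 1)
    (hDu : ∀ y ∈ V, D y (u y) = μ y • u y) (hDu' : D x (u' x) = -μ x • u' x)
    (hdec : ∀ v, v = nullityProj N D x v + inner ℝ (N x) v • N x + inner ℝ (u x) v • u x
      + inner ℝ (u' x) v • u' x) (X Y : Euc n) :
    fderiv ℝ μ x X * inner ℝ (u x) (fderiv ℝ F x Y) - fderiv ℝ μ x Y * inner ℝ (u x) (fderiv ℝ F x X)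
      + 2 * μ x * (inner ℝ (fderiv ℝ u x X) (fderiv ℝ F x Y)
        - inner ℝ (fderiv ℝ u x Y) (fderiv ℝ F x X))
      = μ x * (inner ℝ (nullityGrad F N D x) (fderiv ℝ F x X) * inner ℝ (u x) (fderiv ℝ F x Y)
        - inner ℝ (nullityGrad F N D x) (fderiv ℝ F x Y) * inner ℝ (u x) (fderiv ℝ F x X)) := by
  have hV := h.hyp.isOpen
  have hT := h.hyp.differentiableAt_fderiv hx
  have hDd := h.differentiableAt_D hx
  have hnf := h.nullityField hD
  have hQu : ∀ y ∈ V, μ y ≠ 0 → nullityProj N D y (u y) = 0 := by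
    intro y hy h0
    have := h.nullityProj_D hy (hD y hy) (u y)
    rw [hDu y hy, map_smul] at this
    exact (smul_eq_zero.1 this).resolve_left h0
  have hNu : inner ℝ (N x) (u x) = 0 := by
    have := h.symm_D x hx (N x) (u x)
    rw [h.normal_D x hx, hDu x hx, inner_zero_left, real_inner_smul_right] at this
    exact (mul_eq_zero.1 this.symm).resolve_left hμ0
  have hDQ : ∀ v, D x (nullityProj N D x v) = 0 := by
    intro v
    refine ext_inner_right ℝ fun w => ?_
    rw [h.symm_D x hx, h.nullityProj_symm hx, h.nullityProj_D hx (hD x hx), inner_zero_right,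
      inner_zero_left]
  -- the derivative of `Q u = 0`
  have hQd : ∀ X Y, inner ℝ (fderiv ℝ u x X) (nullityProj N D x (fderiv ℝ F x Y))
      = -(inner ℝ (u x) (fderiv ℝ F x X) * inner ℝ (nullityGrad F N D x) (fderiv ℝ F x Y)) := by
    intro X Y
    have hev : ∀ᶠ y in 𝓝 x, nullityProj N D y (u y) = 0 := by
      filter_upwards [hV.mem_nhds hx, hμ.continuousAt.eventually_ne hμ0] with y hy h0
      exact hQu y hy h0
    have e0 := congrArg (fun L => L X) (Filter.EventuallyEq.fderiv_eq
      (f₁ := fun y => nullityProj N D y (u y)) (f := fun _ => (0 : Euc (n + 1))) (𝕜 := ℝ) hev)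
    simp only [fderiv_clm_apply_apply (hnf.differentiableAt_Q hx) hu, fderiv_fun_const,
      Pi.zero_apply, zero_apply, hnf.fderiv_Q x hx] at e0
    have hAu : inner ℝ (nullityGrad F N D x) (u x) = 0 := by
      rw [← hnf.map_A x hx, hnf.symm x hx, hQu x hx hμ0, inner_zero_right]
    rw [hAu, zero_smul, zero_add, inner_sub_left, hnf.symm x hx, hQu x hx hμ0, inner_zero_right,
      sub_zero] at e0
    rw [← hnf.symm x hx, eq_neg_of_add_eq_zero_right e0, inner_neg_left, real_inner_smul_left,
      real_inner_comm (u x)]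
  have huu : ∀ X, inner ℝ (fderiv ℝ u x X) (u x) = 0 := by
    intro X
    have e0 := congrArg (fun L => L X) (fderiv_eq_of_eqOn hV hunit hx)
    simp only [fderiv_inner_apply ℝ hu hu, fderiv_fun_const, Pi.zero_apply, zero_apply] at e0
    rw [real_inner_comm] at e0
    linarith
  have hTN : ∀ Y, inner ℝ (N x) (fderiv ℝ F x Y) = 0 := fun Y => by
    rw [real_inner_comm, h.hyp.normal_orthogonal x hx]
  have hdY : ∀ X Y, inner ℝ (fderiv ℝ u x X) (fderiv ℝ F x Y)
      = inner ℝ (fderiv ℝ u x X) (nullityProj N D x (fderiv ℝ F x Y))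
        + inner ℝ (u' x) (fderiv ℝ F x Y) * inner ℝ (fderiv ℝ u x X) (u' x) := by
    intro X Y
    conv_lhs => rw [hdec (fderiv ℝ F x Y)]
    simp only [inner_add_right, real_inner_smul_right, huu, hTN]
    ring
  have hdD : ∀ X Y, inner ℝ (fderiv ℝ u x X) (D x (fderiv ℝ F x Y))
      = -(μ x * inner ℝ (u' x) (fderiv ℝ F x Y) * inner ℝ (fderiv ℝ u x X) (u' x)) := by
    intro X Y
    conv_lhs => rw [hdec (fderiv ℝ F x Y)]
    simp only [map_add, map_smul, hDQ, h.normal_D x hx, hDu x hx, hDu', inner_add_right,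
      real_inner_smul_right, huu, inner_zero_right]
    ring
  -- Derivative of μ⟨u, dF Y⟩ = ⟨u, D dF Y⟩. The second derivatives of F cancel on the spot, and the
  -- term with dD disappears by Codazzi once X and Y are antisymmetrized.
  have hmain : ∀ X Y, fderiv ℝ μ x X * inner ℝ (u x) (fderiv ℝ F x Y)
      + μ x * inner ℝ (fderiv ℝ u x X) (fderiv ℝ F x Y)
      = inner ℝ (fderiv ℝ u x X) (D x (fderiv ℝ F x Y))
        + inner ℝ (u x) (fderiv ℝ D x X (fderiv ℝ F x Y)) := by
    intro X Y
    have hTY : DifferentiableAt ℝ (fun y => fderiv ℝ F y Y) x :=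
      hT.clm_apply (differentiableAt_const Y)
    have e0 := congrArg (fun L => L X) (fderiv_eq_of_eqOn hV
      (f := fun y => μ y * inner ℝ (u y) (fderiv ℝ F y Y))
      (g := fun y => inner ℝ (u y) (D y (fderiv ℝ F y Y))) (fun y hy => by
        rw [← h.symm_D y hy, hDu y hy, real_inner_smul_left]) hx)
    rw [fderiv_fun_mul hμ (hu.inner ℝ hTY)] at e0
    simp only [add_apply, smul_apply, smul_eq_mul, fderiv_inner_apply ℝ hu hTY,
      fderiv_inner_apply ℝ hu (hDd.clm_apply hTY), fderiv_clm_apply_apply hDd hTY,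
      fderiv_clm_apply_const hT, inner_add_right] at e0
    rw [← h.symm_D x hx (u x), hDu x hx, real_inner_smul_left] at e0
    linear_combination e0
  have hcod : inner ℝ (u x) (fderiv ℝ D x X (fderiv ℝ F x Y))
      = inner ℝ (u x) (fderiv ℝ D x Y (fderiv ℝ F x X)) := by
    have := h.codazzi_D x hx X Y (tangentCoord F N x (u x))
    rwa [h.hyp.fderiv_tangentCoord_of_inner_eq_zero hx hNu, real_inner_comm,
      real_inner_comm (u x)] at this
  have m1 := hmain X Y
  have m2 := hmain Y X
  rw [hdD] at m1 m2
  have d1 := hdY X Y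
  have d2 := hdY Y X
  rw [hQd] at d1 d2
  linear_combination m1 - m2 + μ x * d1 - μ x * d2 + hcod

/-- The rescaled one-forms dual to the eigenvector fields have potentials. -/
theorem exists_potential (h : ShapePair F N D S V) (hD : ∀ x ∈ V, D x ≠ 0) (hconv : Convex ℝ V)
    {σ : ℝ} (hσ : σ ≠ 0) {κ ρ : Euc n → ℝ} {u u' : Euc n → Euc (n + 1)}
    (hκ : ContDiffOn ℝ ∞ κ V) (hρ : ContDiffOn ℝ ∞ ρ V) (hu : ContDiffOn ℝ ∞ u V)
    (hρ' : ∀ x ∈ V, ∀ X, fderiv ℝ ρ x X = ρ x * inner ℝ (nullityGrad F N D x) (fderiv ℝ F x X))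
    (hκρ : ∀ x ∈ V, κ x ^ 2 * ρ x = topEigenvalue D x)
    (hunit : ∀ y ∈ V, inner ℝ (u y) (u y) = 1)
    (hDu : ∀ y ∈ V, D y (u y) = (σ * topEigenvalue D y) • u y)
    (hDu' : ∀ y ∈ V, D y (u' y) = -(σ * topEigenvalue D y) • u' y)
    (hdec : ∀ y ∈ V, ∀ v, v = nullityProj N D y v + inner ℝ (N y) v • N y + inner ℝ (u y) v • u y
      + inner ℝ (u' y) v • u' y) :
    ∃ f : Euc n → ℝ, ContDiffOn ℝ ∞ f V ∧
      ∀ x ∈ V, ∀ X, fderiv ℝ f x X = κ x * inner ℝ (u x) (fderiv ℝ F x X) := by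
  have hV := h.hyp.isOpen
  have hTs := h.hyp.smooth.fderiv_infty hV
  set η : Euc n → Euc n →L[ℝ] ℝ := fun x => κ x • (innerSL ℝ (u x) ∘L fderiv ℝ F x) with hη
  have hηs : ContDiffOn ℝ ∞ η V :=
    hκ.smul (((innerSL ℝ).contDiff.comp_contDiffOn hu).clm_comp hTs)
  have hlam := h.contDiffOn_topEigenvalue hD
  obtain ⟨f, hf⟩ := hconv.exists_forall_hasFDerivAt_of_fderiv_symmetric hV
    (show DifferentiableOn ℝ η V from fun x hx =>
      (hηs.differentiableAt_of_isOpen hV hx).differentiableWithinAt) (by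
    intro x hx X Y
    have dκ := hκ.differentiableAt_of_isOpen hV hx
    have dρ := hρ.differentiableAt_of_isOpen hV hx
    have du := hu.differentiableAt_of_isOpen hV hx
    have dl := hlam.differentiableAt_of_isOpen hV hx
    have hT := h.hyp.differentiableAt_fderiv hx
    have dη := hηs.differentiableAt_of_isOpen hV hx
    have hl := h.topEigenvalue_pos hx (hD x hx)
    have hexp : ∀ X Y, fderiv ℝ η x X Y = κ x * (inner ℝ (u x) (fderiv ℝ (fderiv ℝ F) x X Y)
        + inner ℝ (fderiv ℝ u x X) (fderiv ℝ F x Y))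
        + fderiv ℝ κ x X * inner ℝ (u x) (fderiv ℝ F x Y) := by
      intro X Y
      have hTY : DifferentiableAt ℝ (fun y => fderiv ℝ F y Y) x :=
        hT.clm_apply (differentiableAt_const Y)
      rw [← fderiv_clm_apply_const dη]
      simp only [hη, smul_apply, ContinuousLinearMap.comp_apply, innerSL_apply_apply, smul_eq_mul]
      rw [fderiv_fun_mul dκ (du.inner ℝ hTY)]
      simp only [add_apply, smul_apply, smul_eq_mul, fderiv_inner_apply ℝ du hTY,
        fderiv_clm_apply_const hT]
      ring
    -- From κ²ρ = l and dρ = ρA the logarithmic derivative of κ is (dl/l - A)/2, exactly the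
    -- integrating factor required by `fderiv_eigenform`.
    have hdκ : ∀ X, 2 * (κ x * ρ x) * fderiv ℝ κ x X
        = fderiv ℝ (topEigenvalue D) x X
          - topEigenvalue D x * inner ℝ (nullityGrad F N D x) (fderiv ℝ F x X) := by
      intro X
      have e0 := congrArg (fun L => L X) (fderiv_eq_of_eqOn hV hκρ hx)
      rw [fderiv_fun_mul (dκ.fun_pow 2) dρ, fderiv_fun_pow 2 dκ] at e0
      simp only [add_apply, smul_apply, smul_eq_mul, hρ' x hx] at e0
      rw [← hκρ x hx, ← e0]
      push_cast
      ring
    have hμ : ∀ X, fderiv ℝ (fun y => σ * topEigenvalue D y) x X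
        = σ * fderiv ℝ (topEigenvalue D) x X := by
      intro X
      rw [fderiv_const_mul dl]
      rfl
    have key := h.fderiv_eigenform hD hx (μ := fun y => σ * topEigenvalue D y)
      (dl.const_mul σ) (mul_ne_zero hσ hl.ne') du hunit hDu (hDu' x hx) (hdec x hx) X Y
    rw [hμ, hμ] at key
    -- The sign σ cancels, so one factor κ serves both eigenvector fields.
    have key' : fderiv ℝ (topEigenvalue D) x X * inner ℝ (u x) (fderiv ℝ F x Y)
        - fderiv ℝ (topEigenvalue D) x Y * inner ℝ (u x) (fderiv ℝ F x X)
      + 2 * topEigenvalue D x * (inner ℝ (fderiv ℝ u x X) (fderiv ℝ F x Y)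
        - inner ℝ (fderiv ℝ u x Y) (fderiv ℝ F x X))
      = topEigenvalue D x * (inner ℝ (nullityGrad F N D x) (fderiv ℝ F x X)
          * inner ℝ (u x) (fderiv ℝ F x Y)
        - inner ℝ (nullityGrad F N D x) (fderiv ℝ F x Y) * inner ℝ (u x) (fderiv ℝ F x X)) := by
      refine mul_left_cancel₀ hσ ?_
      linear_combination key
    have hκ0 : 2 * (κ x * ρ x) ≠ 0 := by
      intro h0
      have : topEigenvalue D x = 0 := by
        rw [← hκρ x hx]
        linear_combination κ x / 2 * h0
      exact hl.ne' this
    refine mul_left_cancel₀ hκ0 ?_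
    rw [hexp, hexp, h.hyp.smooth.fderiv_fderiv_comm hV hx X Y]
    have h1 := hdκ X
    have h2 := hdκ Y
    have h3 := hκρ x hx
    rw [← h3] at key' h1 h2
    linear_combination key' + inner ℝ (u x) (fderiv ℝ F x Y) * h1
      - inner ℝ (u x) (fderiv ℝ F x X) * h2)
  refine ⟨f, (contDiffOn_infty_iff_fderiv_of_isOpen hV).2
    ⟨fun x hx => (hf x hx).differentiableAt.differentiableWithinAt,
      hηs.congr fun x hx => (hf x hx).fderiv⟩, fun x hx X => ?_⟩
  rw [(hf x hx).fderiv]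
  simp [hη]

end ShapePair

end Bonnet

end


/-! ### Coordinate changes and fundamental forms in coordinates -/

open scoped ContDiff Topology

noncomputable section

namespace Bonnet

theorem clm_ext_coordVec {n : ℕ} {G : Type*} [NormedAddCommGroup G] [NormedSpace ℝ G]
    {A B : Euc n →L[ℝ] G} (h : ∀ a, A (coordVec a) = B (coordVec a)) : A = B := by
  ext v
  have hv : v = ∑ a, v a • coordVec a := by
    have := (EuclideanSpace.basisFun (Fin n) ℝ).sum_repr v
    simpa [coordVec] using this.symm
  rw [hv, map_sum, map_sum]
  exact Finset.sum_congr rfl fun a _ => by rw [map_smul, map_smul, h]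

section Coord

variable {n : ℕ} {c : OpenPartialHomeomorph (Euc n) (Euc n)} {V : Set (Euc n)} {x₀ x y : Euc n}

theorem IsCoordAt.differentiableAt (h : IsCoordAt c V x₀) (hx : x ∈ c.source) :
    DifferentiableAt ℝ c x := h.smooth.differentiableAt_of_isOpen c.open_source hx

theorem IsCoordAt.differentiableAt_symm (h : IsCoordAt c V x₀) (hy : y ∈ c.target) :
    DifferentiableAt ℝ c.symm y := h.smooth_symm.differentiableAt_of_isOpen c.open_target hy

theorem IsCoordAt.fderiv_symm_fderiv (h : IsCoordAt c V x₀) (hx : x ∈ c.source) (w : Euc n) :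
    fderiv ℝ c.symm (c x) (fderiv ℝ c x w) = w := by
  have h1 := fderiv_comp x (h.differentiableAt_symm (c.map_source hx)) (h.differentiableAt hx)
  have h2 : fderiv ℝ (c.symm ∘ c) x = fderiv ℝ id x :=
    fderiv_eq_of_eqOn c.open_source (fun y hy => c.left_inv hy) hx
  rw [h2, fderiv_id] at h1
  exact (congrArg (fun L => L w) h1).symm

theorem IsCoordAt.fderiv_fderiv_symm (h : IsCoordAt c V x₀) (hy : y ∈ c.target) (w : Euc n) :
    fderiv ℝ c (c.symm y) (fderiv ℝ c.symm y w) = w := by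
  have h1 := fderiv_comp y (h.differentiableAt (c.map_target hy)) (h.differentiableAt_symm hy)
  have h2 : fderiv ℝ (c ∘ c.symm) y = fderiv ℝ id y :=
    fderiv_eq_of_eqOn c.open_target (fun y hy => c.right_inv hy) hy
  rw [h2, fderiv_id] at h1
  exact (congrArg (fun L => L w) h1).symm

theorem IsCoordAt.fderiv_comp_symm {F : Euc n → Euc (n + 1)} (h : IsCoordAt c V x₀)
    (hy : y ∈ c.target) (hF : DifferentiableAt ℝ F (c.symm y)) (w : Euc n) :
    fderiv ℝ (F ∘ c.symm) y w = fderiv ℝ F (c.symm y) (fderiv ℝ c.symm y w) := by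
  rw [fderiv_comp y hF (h.differentiableAt_symm hy)]
  rfl

theorem IsCoordAt.fderiv_comp_coord {F : Euc n → Euc (n + 1)} (h : IsCoordAt c V x₀)
    (hx : x ∈ c.source) (hF : DifferentiableAt ℝ F (c x)) (w : Euc n) :
    fderiv ℝ (F ∘ c) x w = fderiv ℝ F (c x) (fderiv ℝ c x w) := by
  rw [fderiv_comp x hF (h.differentiableAt hx)]
  rfl

/-- A hypersurface, expressed in the coordinates `c`. -/
theorem IsHypersurface.comp_symm {F N : Euc n → Euc (n + 1)} (hF : IsHypersurface F N V)
    (h : IsCoordAt c V x₀) : IsHypersurface (F ∘ c.symm) (N ∘ c.symm) c.target := by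
  have hm : Set.MapsTo c.symm c.target V := fun y hy => h.subset (c.map_target hy)
  refine ⟨c.open_target, hF.smooth.comp h.smooth_symm hm, fun y hy v w hvw => ?_,
    hF.smooth_normal.comp h.smooth_symm hm, fun y hy => hF.norm_normal _ (hm hy),
    fun y hy v => ?_⟩
  · rw [h.fderiv_comp_symm hy (hF.differentiableAt (hm hy)),
      h.fderiv_comp_symm hy (hF.differentiableAt (hm hy))] at hvw
    have := congrArg (fderiv ℝ c (c.symm y)) (hF.immersion _ (hm hy) hvw)
    rwa [h.fderiv_fderiv_symm hy, h.fderiv_fderiv_symm hy] at this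
  · rw [h.fderiv_comp_symm hy (hF.differentiableAt (hm hy))]
    exact hF.normal_orthogonal _ (hm hy) _

/-- A hypersurface given in coordinates, pulled back. -/
theorem IsHypersurface.comp_coord {F N : Euc n → Euc (n + 1)} (hF : IsHypersurface F N c.target)
    (h : IsCoordAt c V x₀) : IsHypersurface (F ∘ c) (N ∘ c) c.source := by
  have hm : Set.MapsTo c c.source c.target := fun y hy => c.map_source hy
  refine ⟨c.open_source, hF.smooth.comp h.smooth hm, fun y hy v w hvw => ?_,
    hF.smooth_normal.comp h.smooth hm, fun y hy => hF.norm_normal _ (hm hy),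
    fun y hy v => ?_⟩
  · rw [h.fderiv_comp_coord hy (hF.differentiableAt (hm hy)),
      h.fderiv_comp_coord hy (hF.differentiableAt (hm hy))] at hvw
    have := congrArg (fderiv ℝ c.symm (c y)) (hF.immersion _ (hm hy) hvw)
    rwa [h.fderiv_symm_fderiv hy, h.fderiv_symm_fderiv hy] at this
  · rw [h.fderiv_comp_coord hy (hF.differentiableAt (hm hy))]
    exact hF.normal_orthogonal _ (hm hy) _

/-- The new coordinate maps equal the old ones as functions, not merely on the smaller domain, so
fundamental forms are transported by rewriting. -/
theorem exists_restr_target {X Y : Type*} [TopologicalSpace X] [TopologicalSpace Y]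
    (c : OpenPartialHomeomorph X Y) {s : Set Y} (hs : IsOpen s) :
    ∃ c' : OpenPartialHomeomorph X Y, c'.target = c.target ∩ s ∧ c'.source = c.source ∩ c ⁻¹' s ∧
      (c' : X → Y) = c ∧ (c'.symm : Y → X) = c.symm :=
  ⟨(c.symm.restrOpen s hs).symm, rfl, rfl, rfl, rfl⟩

/-- Shrinking a coordinate system so that its image is a ball. -/
theorem IsCoordAt.exists_ball (h : IsCoordAt c V x₀) :
    ∃ c' : OpenPartialHomeomorph (Euc n) (Euc n), IsCoordAt c' V x₀ ∧
      (∃ r > 0, c'.target = Metric.ball (c x₀) r) ∧ c'.target ⊆ c.target ∧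
      (c' : Euc n → Euc n) = c ∧ (c'.symm : Euc n → Euc n) = c.symm := by
  obtain ⟨r, hr, hball⟩ := Metric.isOpen_iff.1 c.open_target _ (c.map_source h.mem)
  obtain ⟨c', ht, hsrc, hco, hsymm⟩ := exists_restr_target c (s := Metric.ball (c x₀) r)
    Metric.isOpen_ball
  refine ⟨c', ⟨?_, ?_, ?_, ?_⟩, ⟨r, hr, ?_⟩, ?_, hco, hsymm⟩
  · rw [hsrc]
    exact Set.mem_inter h.mem (Set.mem_preimage.2 (Metric.mem_ball_self hr))
  · rw [hsrc]
    exact Set.inter_subset_left.trans h.subset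
  · rw [hco, hsrc]
    exact h.smooth.mono Set.inter_subset_left
  · rw [hsymm, ht]
    exact h.smooth_symm.mono Set.inter_subset_left
  · rw [ht, Set.inter_eq_right]
    exact hball
  · rw [ht]
    exact Set.inter_subset_left

/-- The inverse function theorem, for a map whose derivative has a right inverse. -/
theorem exists_isCoordAt {G : Euc n → Euc n} (hV : IsOpen V) (hx₀ : x₀ ∈ V)
    (hG : ContDiffOn ℝ ∞ G V)
    (hdG : ∀ x ∈ V, ∀ a, ∃ w, fderiv ℝ G x w = coordVec a) :
    ∃ c : OpenPartialHomeomorph (Euc n) (Euc n), IsCoordAt c V x₀ ∧ (c : Euc n → Euc n) = G := by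
  -- Invertibility is needed at every point of V, not only at x₀, because the inverse must be smooth
  -- on its whole domain.
  have heq : ∀ x ∈ V, ∃ L : Euc n ≃L[ℝ] Euc n, HasFDerivAt G (L : Euc n →L[ℝ] Euc n) x := by
    intro x hx
    choose w hw using hdG x hx
    have hsurj : Function.Surjective (fderiv ℝ G x : Euc n →ₗ[ℝ] Euc n) := by
      intro v
      refine ⟨∑ a, v a • w a, ?_⟩
      rw [map_sum]
      simp only [map_smul, ContinuousLinearMap.coe_coe, hw]
      have := (EuclideanSpace.basisFun (Fin n) ℝ).sum_repr v
      simpa [coordVec] using this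
    have hinj := LinearMap.injective_iff_surjective.2 hsurj
    have hL : ((LinearEquiv.ofBijective _ ⟨hinj, hsurj⟩).toContinuousLinearEquiv
        : Euc n →L[ℝ] Euc n) = fderiv ℝ G x := by
      ext1 v
      rfl
    refine ⟨(LinearEquiv.ofBijective _ ⟨hinj, hsurj⟩).toContinuousLinearEquiv, ?_⟩
    rw [hL]
    exact (hG.differentiableAt_of_isOpen hV hx).hasFDerivAt
  obtain ⟨L, hL⟩ := heq x₀ hx₀
  have hat := hG.contDiffAt (hV.mem_nhds hx₀)
  set c₀ := hat.toOpenPartialHomeomorph G hL (by simp) with hc₀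
  have hc₀G : (c₀ : Euc n → Euc n) = G := hat.toOpenPartialHomeomorph_coe hL (by simp)
  set c := c₀.restrOpen V hV with hc
  have hcG : (c : Euc n → Euc n) = G := hc₀G
  have hsrc : c.source = c₀.source ∩ V := rfl
  refine ⟨c, ⟨⟨hat.mem_toOpenPartialHomeomorph_source hL (by simp), hx₀⟩, ?_, ?_, ?_⟩, hcG⟩
  · rw [hsrc]
    exact Set.inter_subset_right
  · rw [hcG, hsrc]
    exact hG.mono Set.inter_subset_right
  · intro y hy
    have hyV : c.symm y ∈ V := (c.map_target hy).2
    obtain ⟨L', hL'⟩ := heq _ hyV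
    refine (c.contDiffAt_symm hy (f₀' := L') ?_ ?_).contDiffWithinAt
    · rw [hcG]; exact hL'
    · rw [hcG]; exact hG.contDiffAt (hV.mem_nhds hyV)

end Coord

section Forms

variable {n : ℕ} {c : OpenPartialHomeomorph (Euc n) (Euc n)} {V : Set (Euc n)} {x₀ y : Euc n}
  {F N F' N' : Euc n → Euc (n + 1)}

theorem IsHypersurface.gIn_eq (hF : IsHypersurface F N V) (h : IsCoordAt c V x₀)
    (hy : y ∈ c.target) (A B : Fin n) :
    gIn F c y A B = inner ℝ (fderiv ℝ F (c.symm y) (fderiv ℝ c.symm y (coordVec A)))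
      (fderiv ℝ F (c.symm y) (fderiv ℝ c.symm y (coordVec B))) := by
  have hd := hF.differentiableAt (h.subset (c.map_target hy))
  rw [gIn, firstForm, Matrix.of_apply, h.fderiv_comp_symm hy hd, h.fderiv_comp_symm hy hd]

theorem IsometricPair.gIn_eq (hp : IsometricPair F N F' N' V) (h : IsCoordAt c V x₀)
    (hy : y ∈ c.target) (A B : Fin n) : gIn F' c y A B = gIn F c y A B := by
  rw [hp.left.gIn_eq h hy, hp.right.gIn_eq h hy, hp.inner_eq _ (h.subset (c.map_target hy))]

theorem IsometricPair.bIn_eq (hp : IsometricPair F N F' N' V) (h : IsCoordAt c V x₀)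
    (hy : y ∈ c.target) (A B : Fin n) :
    bIn F' N' c y A B = inner ℝ (relShape F N F' N' (c.symm y)
      (fderiv ℝ F (c.symm y) (fderiv ℝ c.symm y (coordVec A))))
      (fderiv ℝ F (c.symm y) (fderiv ℝ c.symm y (coordVec B))) := by
  have hx := h.subset (c.map_target hy)
  rw [hp.inner_relShape_fderiv hx, bIn, secondForm, Matrix.of_apply,
    (hp.right.comp_symm h).inner_fderiv_fderiv_normal hy,
    h.fderiv_comp_symm hy (hp.right.differentiableAt hx),
    h.fderiv_comp_symm hy (hp.right.differentiableAt_normal hx), real_inner_comm]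

end Forms

end Bonnet

end


/-! ### Construction of the common net -/

open scoped ContDiff Topology

noncomputable section

namespace Bonnet

theorem forall_fin_add_two {m : ℕ} {P : Fin (m + 2) → Prop} (h0 : P 0) (h1 : P 1)
    (hp : ∀ p : Fin m, P p.succ.succ) (A : Fin (m + 2)) : P A := by
  induction A using Fin.cases with
  | zero => exact h0
  | succ A =>
    induction A using Fin.cases with
    | zero => exact h1
    | succ p => exact hp p

theorem fderiv_apply_coord {E : Type*} [NormedAddCommGroup E] [NormedSpace ℝ E] {n : ℕ}
    {G : E → Euc n} {x : E} (hG : DifferentiableAt ℝ G x) (X : E) (A : Fin n) :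
    (fderiv ℝ G x X) A = fderiv ℝ (fun y => G y A) x X := by
  have := ((EuclideanSpace.proj A : Euc n →L[ℝ] ℝ).hasFDerivAt.comp x hG.hasFDerivAt).fderiv
  exact (congrArg (fun L => L X) this).symm

/-- Tangent vectors of a net: they are orthogonal, the first two have the same length and the others
are unit vectors in the kernels of `D` and `S`; the first two are asymptotic for `D` and conjugate
for `S`. -/
structure NetFrame {k m : ℕ} (D S : Euc k →L[ℝ] Euc k) (W : Fin (m + 2) → Euc k) (ρ : ℝ) :
    Prop where
  orthogonal : ∀ A B, A ≠ B → inner ℝ (W A) (W B) = 0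
  isothermal : inner ℝ (W 0) (W 0) = inner ℝ (W 1) (W 1)
  unit : ∀ p : Fin m, inner ℝ (W p.succ.succ) (W p.succ.succ) = 1
  D_null : ∀ p : Fin m, D (W p.succ.succ) = 0
  S_null : ∀ p : Fin m, S (W p.succ.succ) = 0
  D_fst : inner ℝ (D (W 0)) (W 0) = 0
  D_snd : inner ℝ (D (W 1)) (W 1) = 0
  D_mixed : inner ℝ (D (W 0)) (W 1) = 2 * ρ
  S_mixed : inner ℝ (S (W 0)) (W 1) = 0

/-- The vectors h₁ ± h₂ are isotropic for diag(l, -l), and conjugate for S because S has equal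
diagonal entries. The scale κ⁻¹ with κ²ρ = l makes the mixed entry of D equal to 2ρ. -/
theorem netFrame_of_eigen {k m : ℕ} {D S : Euc k →L[ℝ] Euc k} {h₁ h₂ : Euc k} {l κ ρ : ℝ}
    {ε : Fin m → Euc k} (hS : ∀ v w, inner ℝ (S v) w = inner ℝ v (S w))
    (h11 : inner ℝ h₁ h₁ = 1) (h22 : inner ℝ h₂ h₂ = 1) (h12 : inner ℝ h₁ h₂ = 0)
    (hε : ∀ p q, inner ℝ (ε p) (ε q) = if p = q then (1 : ℝ) else 0)
    (h1ε : ∀ p, inner ℝ h₁ (ε p) = 0) (h2ε : ∀ p, inner ℝ h₂ (ε p) = 0)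
    (hκ : 0 < κ) (hκρ : κ ^ 2 * ρ = l) (hD1 : D h₁ = l • h₁) (hD2 : D h₂ = -l • h₂)
    (hS12 : inner ℝ (S h₁) h₁ = inner ℝ (S h₂) h₂) (hDε : ∀ p, D (ε p) = 0)
    (hSε : ∀ p, S (ε p) = 0) :
    NetFrame D S (Fin.cons (κ⁻¹ • (h₁ + h₂)) (Fin.cons (κ⁻¹ • (h₁ - h₂)) ε) : Fin (m + 2) → Euc k)
      ρ := by
  set W : Fin (m + 2) → Euc k := Fin.cons (κ⁻¹ • (h₁ + h₂)) (Fin.cons (κ⁻¹ • (h₁ - h₂)) ε)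
  have W0 : W 0 = κ⁻¹ • (h₁ + h₂) := rfl
  have W1 : W 1 = κ⁻¹ • (h₁ - h₂) := rfl
  have Wp : ∀ p : Fin m, W p.succ.succ = ε p := fun p => rfl
  have h21 : inner ℝ h₂ h₁ = 0 := by rw [real_inner_comm, h12]
  have i01 : inner ℝ (W 0) (W 1) = 0 := by
    simp only [W0, W1, real_inner_smul_left, real_inner_smul_right, inner_add_left,
      inner_sub_right, h11, h22, h12, h21]
    ring
  have i0p : ∀ p : Fin m, inner ℝ (W 0) (W p.succ.succ) = 0 := fun p => by
    simp only [W0, Wp, real_inner_smul_left, inner_add_left, h1ε, h2ε]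
    ring
  have i1p : ∀ p : Fin m, inner ℝ (W 1) (W p.succ.succ) = 0 := fun p => by
    simp only [W1, Wp, real_inner_smul_left, inner_sub_left, h1ε, h2ε]
    ring
  refine ⟨forall_fin_add_two ?_ ?_ fun p => ?_, ?_, fun p => ?_, hDε, hSε, ?_, ?_, ?_, ?_⟩
  · exact forall_fin_add_two (fun h => absurd rfl h) (fun _ => i01) (fun p _ => i0p p)
  · exact forall_fin_add_two (fun _ => by rw [real_inner_comm, i01])
      (fun h => absurd rfl h) (fun p _ => i1p p)
  · refine forall_fin_add_two (fun _ => by rw [real_inner_comm, i0p])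
      (fun _ => by rw [real_inner_comm, i1p]) (fun q hpq => ?_)
    rw [Wp, Wp, hε, if_neg]
    rintro rfl
    exact hpq rfl
  · simp only [W0, W1, real_inner_smul_left, real_inner_smul_right, inner_add_left, inner_add_right,
      inner_sub_left, inner_sub_right, h11, h22, h12, h21]
    ring
  · rw [Wp, hε, if_pos rfl]
  · simp only [W0, map_smul, map_add, hD1, hD2, real_inner_smul_left, real_inner_smul_right,
      inner_add_left, inner_add_right, h11, h22, h12, h21]
    ring
  · simp only [W1, map_smul, map_sub, hD1, hD2, real_inner_smul_left, real_inner_smul_right,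
      inner_sub_left, inner_sub_right, h11, h22, h12, h21]
    ring
  · simp only [W0, W1, map_smul, map_add, hD1, hD2, real_inner_smul_left, real_inner_smul_right,
      inner_add_left, inner_sub_right, h11, h22, h12, h21, ← hκρ]
    field_simp
    ring
  · have hS21 : inner ℝ (S h₂) h₁ = inner ℝ (S h₁) h₂ := by rw [hS, real_inner_comm]
    simp only [W0, W1, map_smul, map_add, real_inner_smul_left, real_inner_smul_right,
      inner_add_left, inner_sub_right, hS12, hS21]
    ring

/-- The coordinates are (y₁ + y₂)/2, (y₁ - y₂)/2 and ξ_p, where dy_i = κ⟨h_i, dF⟩. On κ⁻¹(h₁ ± h₂)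
the pair dy₁, dy₂ takes the values 1, ±1, so these vectors and the frame of the kernel form the dual
basis. -/
theorem ShapePair.exists_netFrame {m : ℕ} {F N : Euc (m + 2) → Euc (m + 2 + 1)}
    {D S : Euc (m + 2) → Euc (m + 2 + 1) →L[ℝ] Euc (m + 2 + 1)} {V : Set (Euc (m + 2))}
    {x₀ : Euc (m + 2)} (h : ShapePair F N D S V) (hD : ∀ x ∈ V, D x ≠ 0) (hx₀ : x₀ ∈ V) :
    ∃ c : OpenPartialHomeomorph (Euc (m + 2)) (Euc (m + 2)), IsCoordAt c V x₀ ∧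
      (∃ r > 0, c.target = Metric.ball (c x₀) r) ∧
      ∃ ρ : Euc (m + 2) → ℝ, IsWeight ρ ∧ (∀ y ∈ c.target, 0 < ρ y) ∧
        ∀ y ∈ c.target, NetFrame (D (c.symm y)) (S (c.symm y))
          (fun A => fderiv ℝ F (c.symm y) (fderiv ℝ c.symm y (coordVec A))) (ρ y) := by
  obtain ⟨R₁, hR₁, hV₁, h₁, h₂, hE₁⟩ := h.exists_eigenFrame hD hx₀
  obtain ⟨R₂, hR₂, hV₂, ρ, ε, ξ, hP₂⟩ := (h.nullityField hD).exists_parallelFrame (m := m) hx₀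
    (by rw [h.opTrace_nullityProj hx₀ (hD x₀ hx₀)]; push_cast; ring)
  set B := Metric.ball x₀ (min R₁ R₂) with hB
  have hR : 0 < min R₁ R₂ := lt_min hR₁ hR₂
  have hx₀B : x₀ ∈ B := Metric.mem_ball_self hR
  have hBo : IsOpen B := Metric.isOpen_ball
  have hb₁ : B ⊆ Metric.ball x₀ R₁ := Metric.ball_subset_ball (min_le_left _ _)
  have hb₂ : B ⊆ Metric.ball x₀ R₂ := Metric.ball_subset_ball (min_le_right _ _)
  have hBV : B ⊆ V := hb₁.trans hV₁
  have hE := hE₁.mono hb₁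
  have hP := hP₂.mono hb₂
  replace h := h.mono hBo hBV
  replace hD : ∀ x ∈ B, D x ≠ 0 := fun x hx => hD x (hBV hx)
  have hlam := h.contDiffOn_topEigenvalue hD
  have hlpos : ∀ x ∈ B, 0 < topEigenvalue D x := fun x hx => h.topEigenvalue_pos hx (hD x hx)
  set κ : Euc (m + 2) → ℝ := fun x => √(topEigenvalue D x / ρ x) with hκ
  have hκpos : ∀ x ∈ B, 0 < κ x := fun x hx =>
    Real.sqrt_pos.2 (div_pos (hlpos x hx) (hP.pos x hx))
  have hκs : ContDiffOn ℝ ∞ κ B := (hlam.div hP.smooth_ρ fun x hx => (hP.pos x hx).ne').sqrt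
    fun x hx => (div_pos (hlpos x hx) (hP.pos x hx)).ne'
  have hκρ : ∀ x ∈ B, κ x ^ 2 * ρ x = topEigenvalue D x := by
    intro x hx
    rw [hκ, Real.sq_sqrt (div_pos (hlpos x hx) (hP.pos x hx)).le,
      div_mul_cancel₀ _ (hP.pos x hx).ne']
  obtain ⟨y₁, hy₁, hdy₁⟩ := h.exists_potential hD (convex_ball _ _) one_ne_zero hκs hP.smooth_ρ
    hE.smooth_fst hP.fderiv_ρ hκρ hE.unit_fst (u' := h₂)
    (fun x hx => by rw [one_mul, hE.D_fst x hx]) (fun x hx => by rw [one_mul, hE.D_snd x hx])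
    hE.decomp
  obtain ⟨y₂, hy₂, hdy₂⟩ := h.exists_potential hD (convex_ball _ _) (σ := -1) (by norm_num) hκs
    hP.smooth_ρ hE.smooth_snd hP.fderiv_ρ hκρ hE.unit_snd (u' := h₁)
    (fun x hx => by rw [neg_one_mul, hE.D_snd x hx])
    (fun x hx => by rw [neg_one_mul, neg_neg, hE.D_fst x hx])
    (fun x hx v => (hE.decomp x hx v).trans (add_right_comm _ _ _))
  have hQ : ∀ x ∈ B, ∀ p, nullityProj N D x (ε p x) = ε p x := hP.map_ε
  have hDε : ∀ x ∈ B, ∀ p, D x (ε p x) = 0 := fun x hx p => by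
    refine ext_inner_right ℝ fun w => ?_
    rw [h.symm_D x hx, ← hQ x hx, h.nullityProj_symm hx, h.nullityProj_D hx (hD x hx),
      inner_zero_right, inner_zero_left]
  have hSε : ∀ x ∈ B, ∀ p, S x (ε p x) = 0 := fun x hx p => by
    refine ext_inner_right ℝ fun w => ?_
    rw [h.symm_S x hx, ← hQ x hx, h.nullityProj_symm hx, h.nullityProj_S hx (hD x hx),
      inner_zero_right, inner_zero_left]
  have h1ε : ∀ x ∈ B, ∀ p, inner ℝ (h₁ x) (ε p x) = 0 := fun x hx p => by
    have := h.symm_D x hx (h₁ x) (ε p x)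
    rw [hDε x hx, inner_zero_right, hE.D_fst x hx, real_inner_smul_left] at this
    exact (mul_eq_zero.1 this).resolve_left (hlpos x hx).ne'
  have h2ε : ∀ x ∈ B, ∀ p, inner ℝ (h₂ x) (ε p x) = 0 := fun x hx p => by
    have := h.symm_D x hx (h₂ x) (ε p x)
    rw [hDε x hx, inner_zero_right, hE.D_snd x hx, real_inner_smul_left] at this
    exact (mul_eq_zero.1 this).resolve_left (neg_ne_zero.2 (hlpos x hx).ne')
  have hN1 : ∀ x ∈ B, inner ℝ (N x) (h₁ x) = 0 := fun x hx => by
    have := h.symm_D x hx (N x) (h₁ x)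
    rw [h.normal_D x hx, inner_zero_left, hE.D_fst x hx, real_inner_smul_right] at this
    exact (mul_eq_zero.1 this.symm).resolve_left (hlpos x hx).ne'
  have hN2 : ∀ x ∈ B, inner ℝ (N x) (h₂ x) = 0 := fun x hx => by
    have := h.symm_D x hx (N x) (h₂ x)
    rw [h.normal_D x hx, inner_zero_left, hE.D_snd x hx, real_inner_smul_right] at this
    exact (mul_eq_zero.1 this.symm).resolve_left (neg_ne_zero.2 (hlpos x hx).ne')
  have hNε : ∀ x ∈ B, ∀ p, inner ℝ (N x) (ε p x) = 0 := fun x hx p => by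
    rw [← hQ x hx, ← h.nullityProj_symm hx, h.nullityProj_normal hx, inner_zero_left]
  set W : Euc (m + 2) → Fin (m + 2) → Euc (m + 2 + 1) := fun x =>
    Fin.cons ((κ x)⁻¹ • (h₁ x + h₂ x)) (Fin.cons ((κ x)⁻¹ • (h₁ x - h₂ x)) fun p => ε p x) with hW
  have hnet : ∀ x ∈ B, NetFrame (D x) (S x) (W x) (ρ x) := fun x hx =>
    netFrame_of_eigen (h.symm_S x hx) (hE.unit_fst x hx) (hE.unit_snd x hx) (hE.orthogonal x hx)
      (hP.orthonormal x hx) (h1ε x hx) (h2ε x hx) (hκpos x hx) (hκρ x hx) (hE.D_fst x hx)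
      (hE.D_snd x hx) (hE.S_eq x hx) (hDε x hx) (hSε x hx)
  have hNW : ∀ x ∈ B, ∀ A, inner ℝ (N x) (W x A) = 0 := by
    intro x hx
    refine forall_fin_add_two ?_ ?_ fun p => hNε x hx p
    · change inner ℝ (N x) ((κ x)⁻¹ • (h₁ x + h₂ x)) = 0
      rw [real_inner_smul_right, inner_add_right, hN1 x hx, hN2 x hx, add_zero, mul_zero]
    · change inner ℝ (N x) ((κ x)⁻¹ • (h₁ x - h₂ x)) = 0
      rw [real_inner_smul_right, inner_sub_right, hN1 x hx, hN2 x hx, sub_zero, mul_zero]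
  set G : Euc (m + 2) → Euc (m + 2) := fun x => WithLp.toLp 2
    (Fin.cons ((y₁ x + y₂ x) / 2) (Fin.cons ((y₁ x - y₂ x) / 2) fun p => ξ p x)
      : Fin (m + 2) → ℝ) with hG
  have hGs : ContDiffOn ℝ ∞ G B := by
    rw [contDiffOn_euclidean]
    exact forall_fin_add_two ((hy₁.add hy₂).div_const 2) ((hy₁.sub hy₂).div_const 2)
      fun p => hP.smooth_ξ p
  have hdG : ∀ x ∈ B, ∀ A, fderiv ℝ G x (tangentCoord F N x (W x A)) = coordVec A := by
    intro x hx
    have dG := hGs.differentiableAt_of_isOpen hBo hx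
    have d1 := hy₁.differentiableAt_of_isOpen hBo hx
    have d2 := hy₂.differentiableAt_of_isOpen hBo hx
    have hκ0 := (hκpos x hx).ne'
    have hT : ∀ A, fderiv ℝ F x (tangentCoord F N x (W x A)) = W x A := fun A =>
      h.hyp.fderiv_tangentCoord_of_inner_eq_zero hx (hNW x hx A)
    have c0 : ∀ X, (fderiv ℝ G x X) 0 = (fderiv ℝ y₁ x X + fderiv ℝ y₂ x X) / 2 := fun X => by
      rw [fderiv_apply_coord dG]
      change fderiv ℝ (fun x => (y₁ x + y₂ x) / 2) x X = _
      simp only [div_eq_mul_inv]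
      rw [fderiv_mul_const (d1.fun_add d2), fderiv_fun_add d1 d2]
      simp only [smul_apply, add_apply, smul_eq_mul]
      ring
    have c1 : ∀ X, (fderiv ℝ G x X) 1 = (fderiv ℝ y₁ x X - fderiv ℝ y₂ x X) / 2 := fun X => by
      rw [fderiv_apply_coord dG]
      change fderiv ℝ (fun x => (y₁ x - y₂ x) / 2) x X = _
      simp only [div_eq_mul_inv]
      rw [fderiv_mul_const (d1.fun_sub d2), fderiv_fun_sub d1 d2]
      simp only [smul_apply, sub_apply, smul_eq_mul]
      ring
    have cp : ∀ X, ∀ p : Fin m, (fderiv ℝ G x X) p.succ.succ = fderiv ℝ (ξ p) x X := fun X p => by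
      rw [fderiv_apply_coord dG]
      rfl
    have h21 : inner ℝ (h₂ x) (h₁ x) = 0 := by rw [real_inner_comm, hE.orthogonal x hx]
    have hε1 : ∀ p, inner ℝ (ε p x) (h₁ x) = 0 := fun p => by rw [real_inner_comm, h1ε x hx]
    have hε2 : ∀ p, inner ℝ (ε p x) (h₂ x) = 0 := fun p => by rw [real_inner_comm, h2ε x hx]
    have e1 := fun A => hdy₁ x hx (tangentCoord F N x (W x A))
    have e2 := fun A => hdy₂ x hx (tangentCoord F N x (W x A))
    have e3 := fun p A => hP.fderiv_ξ p x hx (tangentCoord F N x (W x A))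
    simp only [hT] at e1 e2 e3
    refine forall_fin_add_two ?_ ?_ fun p => ?_
    · ext A
      have w0 : W x 0 = (κ x)⁻¹ • (h₁ x + h₂ x) := rfl
      revert A
      refine forall_fin_add_two ?_ ?_ (fun q => ?_)
      · rw [c0, e1, e2, w0]
        simp only [real_inner_smul_right, inner_add_right, hE.unit_fst x hx, hE.unit_snd x hx,
          hE.orthogonal x hx, h21, coordVec, PiLp.single_apply]
        field_simp
        norm_num
      · rw [c1, e1, e2, w0]
        simp only [real_inner_smul_right, inner_add_right, hE.unit_fst x hx, hE.unit_snd x hx,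
          hE.orthogonal x hx, h21, coordVec, PiLp.single_apply]
        simp
      · rw [cp, e3, w0]
        simp only [real_inner_smul_right, inner_add_right, hε1, hε2, coordVec, PiLp.single_apply]
        simp [Fin.ext_iff]
    · ext A
      have w1 : W x 1 = (κ x)⁻¹ • (h₁ x - h₂ x) := rfl
      revert A
      refine forall_fin_add_two ?_ ?_ (fun q => ?_)
      · rw [c0, e1, e2, w1]
        simp only [real_inner_smul_right, inner_sub_right, hE.unit_fst x hx, hE.unit_snd x hx,
          hE.orthogonal x hx, h21, coordVec, PiLp.single_apply]
        simp
      · rw [c1, e1, e2, w1]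
        simp only [real_inner_smul_right, inner_sub_right, hE.unit_fst x hx, hE.unit_snd x hx,
          hE.orthogonal x hx, h21, coordVec, PiLp.single_apply]
        field_simp
        norm_num
      · rw [cp, e3, w1]
        simp only [real_inner_smul_right, inner_sub_right, hε1, hε2, coordVec, PiLp.single_apply]
        simp [Fin.ext_iff]
    · ext A
      have wp : W x p.succ.succ = ε p x := rfl
      revert A
      refine forall_fin_add_two ?_ ?_ (fun q => ?_)
      · rw [c0, e1, e2, wp, h1ε x hx, h2ε x hx, coordVec, PiLp.single_apply]
        simp [Fin.ext_iff]
      · rw [c1, e1, e2, wp, h1ε x hx, h2ε x hx, coordVec, PiLp.single_apply]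
        simp [Fin.ext_iff]
      · rw [cp, e3, wp, hP.orthonormal x hx, coordVec, PiLp.single_apply]
        simp
  obtain ⟨c₀, hc₀, hc₀G⟩ := exists_isCoordAt hBo hx₀B hGs fun x hx A => ⟨_, hdG x hx A⟩
  obtain ⟨c, hc, ⟨r, hr, hr'⟩, -, hcc, -⟩ := hc₀.exists_ball
  have hcG : (c : Euc (m + 2) → Euc (m + 2)) = G := hcc.trans hc₀G
  have hframe : ∀ y ∈ c.target, ∀ A,
      fderiv ℝ F (c.symm y) (fderiv ℝ c.symm y (coordVec A)) = W (c.symm y) A := by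
    intro y hy A
    have hx := c.map_target hy
    have := hc.fderiv_symm_fderiv hx (tangentCoord F N (c.symm y) (W (c.symm y) A))
    rw [c.right_inv hy, hcG, hdG _ (hc.subset hx)] at this
    rw [this]
    exact h.hyp.fderiv_tangentCoord_of_inner_eq_zero (hc.subset hx) (hNW _ (hc.subset hx) A)
  -- Because the ξ_p are themselves coordinates, ρ becomes a linear form in the coordinates, or the
  -- constant 1.
  obtain ⟨ρ', hρ', hρ'ρ⟩ : ∃ ρ' : Euc (m + 2) → ℝ, IsWeight ρ' ∧ ∀ x ∈ B, ρ' (G x) = ρ x := by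
    rcases hP.weight with h1 | ⟨C, hC, h1⟩
    · exact ⟨fun _ => 1, Or.inr fun _ => rfl, fun x _ => (h1 x).symm⟩
    · exact ⟨fun y => ∑ p : Fin m, C p * y p.succ.succ, Or.inl ⟨C, hC, fun _ => rfl⟩,
        fun x hx => (h1 x hx).symm⟩
  have hρy : ∀ y ∈ c.target, ρ' y = ρ (c.symm y) := by
    intro y hy
    rw [← hρ'ρ _ (hc.subset (c.map_target hy)), ← hcG, c.right_inv hy]
  refine ⟨c, ⟨hc.mem, hc.subset.trans hBV, hc.smooth, hc.smooth_symm⟩, ⟨r, hr, by rw [hr', hcc]⟩,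
    ρ', hρ', fun y hy => ?_, fun y hy => ?_⟩
  · rw [hρy y hy]
    exact hP.pos _ (hc.subset (c.map_target hy))
  · rw [hρy y hy]
    simp only [hframe y hy]
    exact hnet _ (hc.subset (c.map_target hy))

/-- The common net of two isometric hypersurfaces with the same mean curvature and different shape
operators. -/
theorem IsometricPair.exists_net {m : ℕ} {F N F' N' : Euc (m + 2) → Euc (m + 2 + 1)}
    {V : Set (Euc (m + 2))} {x₀ : Euc (m + 2)} (hp : IsometricPair F N F' N' V)
    (hmean : ∀ x ∈ V, meanCurvature F' N' x = meanCurvature F N x)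
    (hH : ∀ x ∈ V, meanCurvature F N x ≠ 0)
    (hD : ∀ x ∈ V, relShape F N F N x - relShape F N F' N' x ≠ 0) (hx₀ : x₀ ∈ V) :
    ∃ c : OpenPartialHomeomorph (Euc (m + 2)) (Euc (m + 2)), IsCoordAt c V x₀ ∧
      (∃ r > 0, c.target = Metric.ball (c x₀) r) ∧
      ∃ ρ : Euc (m + 2) → ℝ, IsWeight ρ ∧ (∀ y ∈ c.target, 0 < ρ y) ∧
        IsNetWith F N c ρ 1 ∧ IsNetWith F' N' c ρ (-1) ∧
        ∀ y ∈ c.target, gIn F' c y 0 0 = gIn F c y 0 0 ∧ bIn F' N' c y 0 0 = bIn F N c y 0 0 ∧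
          bIn F' N' c y 1 1 = bIn F N c y 1 1 := by
  obtain ⟨c, hc, hball, ρ, hρ, hpos, hnet⟩ :=
    (hp.shapePair (by omega) hmean hH).exists_netFrame hD hx₀
  have h0 := hp.left.isometricPair_self
  have hg : ∀ y ∈ c.target, ∀ A B, gIn F' c y A B = gIn F c y A B := fun y hy => hp.gIn_eq hc hy
  have hsymm : ∀ y ∈ c.target, ∀ A B, bIn F N c y A B = bIn F N c y B A := by
    intro y hy A B
    rw [h0.bIn_eq hc hy, h0.bIn_eq hc hy, h0.inner_relShape_comm (hc.subset (c.map_target hy)),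
      real_inner_comm]
  have hsymm' : ∀ y ∈ c.target, ∀ A B, bIn F' N' c y A B = bIn F' N' c y B A := by
    intro y hy A B
    rw [hp.bIn_eq hc hy, hp.bIn_eq hc hy, hp.inner_relShape_comm (hc.subset (c.map_target hy)),
      real_inner_comm]
  have hsum : ∀ y ∈ c.target, ∀ A B, bIn F N c y A B + bIn F' N' c y A B
      = inner ℝ ((relShape F N F N (c.symm y) + relShape F N F' N' (c.symm y))
        (fderiv ℝ F (c.symm y) (fderiv ℝ c.symm y (coordVec A))))
        (fderiv ℝ F (c.symm y) (fderiv ℝ c.symm y (coordVec B))) := by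
    intro y hy A B
    rw [h0.bIn_eq hc hy, hp.bIn_eq hc hy, add_apply, inner_add_left]
  have hdiff : ∀ y ∈ c.target, ∀ A B, bIn F N c y A B - bIn F' N' c y A B
      = inner ℝ ((relShape F N F N (c.symm y) - relShape F N F' N' (c.symm y))
        (fderiv ℝ F (c.symm y) (fderiv ℝ c.symm y (coordVec A))))
        (fderiv ℝ F (c.symm y) (fderiv ℝ c.symm y (coordVec B))) := by
    intro y hy A B
    rw [h0.bIn_eq hc hy, hp.bIn_eq hc hy, sub_apply, inner_sub_left]
  have hnull : ∀ y ∈ c.target, ∀ A, ∀ q : Fin m, bIn F N c y A q.succ.succ = 0 ∧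
      bIn F' N' c y A q.succ.succ = 0 := by
    intro y hy A q
    have s := hsum y hy q.succ.succ A
    have d := hdiff y hy q.succ.succ A
    rw [(hnet y hy).S_null, inner_zero_left] at s
    rw [(hnet y hy).D_null, inner_zero_left] at d
    rw [hsymm y hy, hsymm' y hy]
    constructor <;> linarith
  -- The mixed entry of b + b' is 0 and that of b - b' is 2ρ; with the positive ρ chosen here, M
  -- gets ε = 1.
  have hmix : ∀ y ∈ c.target, bIn F N c y 0 1 = ρ y ∧ bIn F' N' c y 0 1 = -ρ y := by
    intro y hy
    have s := hsum y hy 0 1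
    have d := hdiff y hy 0 1
    rw [(hnet y hy).S_mixed] at s
    rw [(hnet y hy).D_mixed] at d
    constructor <;> linarith
  refine ⟨c, hc, hball, ρ, hρ, hpos, ⟨fun y hy A B hAB => ?_, fun y hy => ?_, fun y hy p => ?_,
    fun y hy A q => (hnull y hy A q).1, fun y hy => by rw [(hmix y hy).1, one_mul]⟩,
    ⟨fun y hy A B hAB => ?_, fun y hy => ?_, fun y hy p => ?_,
    fun y hy A q => (hnull y hy A q).2, fun y hy => by rw [(hmix y hy).2, neg_one_mul]⟩,
    fun y hy => ⟨hg y hy 0 0, ?_, ?_⟩⟩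
  · rw [hp.left.gIn_eq hc hy]
    exact (hnet y hy).orthogonal A B hAB
  · rw [hp.left.gIn_eq hc hy, hp.left.gIn_eq hc hy]
    exact (hnet y hy).isothermal
  · rw [hp.left.gIn_eq hc hy]
    exact (hnet y hy).unit p
  · rw [hg y hy, hp.left.gIn_eq hc hy]
    exact (hnet y hy).orthogonal A B hAB
  · rw [hg y hy, hg y hy, hp.left.gIn_eq hc hy, hp.left.gIn_eq hc hy]
    exact (hnet y hy).isothermal
  · rw [hg y hy, hp.left.gIn_eq hc hy]
    exact (hnet y hy).unit p
  · have d := hdiff y hy 0 0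
    rw [(hnet y hy).D_fst] at d
    linarith
  · have d := hdiff y hy 1 1
    rw [(hnet y hy).D_snd] at d
    linarith

end Bonnet

end


/-! ### Geometry of a hypersurface parametrized by a net -/

open scoped ContDiff Topology

noncomputable section

namespace Bonnet

/-- A hypersurface whose own parameters form a net with weight `ρ`. -/
structure NetForm {m : ℕ} (F N : Euc (m + 2) → Euc (m + 2 + 1)) (ρ : Euc (m + 2) → ℝ) (s : ℝ)
    (V : Set (Euc (m + 2))) : Prop where
  hyp : IsHypersurface F N V
  orthogonal : ∀ y ∈ V, ∀ A B, A ≠ B → firstForm F y A B = 0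
  isothermal : ∀ y ∈ V, firstForm F y 0 0 = firstForm F y 1 1
  unit : ∀ y ∈ V, ∀ p : Fin m, firstForm F y p.succ.succ p.succ.succ = 1
  null : ∀ y ∈ V, ∀ A, ∀ q : Fin m, secondForm F N y A q.succ.succ = 0
  mixed : ∀ y ∈ V, secondForm F N y 0 1 = s * ρ y

theorem IsNetWith.netForm {m : ℕ} {F N : Euc (m + 2) → Euc (m + 2 + 1)} {U : Set (Euc (m + 2))}
    {c : OpenPartialHomeomorph (Euc (m + 2)) (Euc (m + 2))} {x₀ : Euc (m + 2)}
    {ρ : Euc (m + 2) → ℝ} {s : ℝ} (h : IsNetWith F N c ρ s) (hF : IsHypersurface F N U)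
    (hc : IsCoordAt c U x₀) : NetForm (F ∘ c.symm) (N ∘ c.symm) ρ s c.target :=
  ⟨hF.comp_symm hc, h.orthogonal, h.g_isothermal, h.g_unit, h.b_null, h.b_mixed⟩

theorem IsWeight.contDiff {m : ℕ} {ρ : Euc (m + 2) → ℝ} (h : IsWeight ρ) : ContDiff ℝ ∞ ρ := by
  rcases h with ⟨C, -, h⟩ | h
  · rw [funext h]
    exact ContDiff.sum fun p _ => contDiff_const.mul
      (EuclideanSpace.proj (p.succ.succ : Fin (m + 2)) : Euc (m + 2) →L[ℝ] ℝ).contDiff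
  · rw [funext h]
    exact contDiff_const

/-- A weight with logarithmic derivatives in the last directions does not vanish. -/
theorem IsWeight.ne_zero {m : ℕ} {ρ : Euc (m + 2) → ℝ} (h : IsWeight ρ) {y : Euc (m + 2)}
    {w : Fin m → ℝ} (hw : ∀ p : Fin m, fderiv ℝ ρ y (coordVec p.succ.succ) = w p * ρ y) :
    ρ y ≠ 0 := by
  rcases h with ⟨C, hC, h⟩ | h
  · intro h0
    refine hC (funext fun p => ?_)
    have hd : HasFDerivAt ρ (∑ q : Fin m, C q •
        (EuclideanSpace.proj (q.succ.succ : Fin (m + 2)) : Euc (m + 2) →L[ℝ] ℝ)) y := by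
      rw [funext h]
      exact HasFDerivAt.fun_sum fun q _ =>
        (EuclideanSpace.proj (q.succ.succ : Fin (m + 2)) : Euc (m + 2) →L[ℝ] ℝ).hasFDerivAt.const_mul
          (C q)
    have := hw p
    rw [hd.fderiv, h0, mul_zero] at this
    simpa [coordVec, Pi.single_apply] using this
  · rw [h]
    exact one_ne_zero

namespace NetForm

variable {m : ℕ} {F N : Euc (m + 2) → Euc (m + 2 + 1)} {ρ : Euc (m + 2) → ℝ} {s : ℝ}
  {V : Set (Euc (m + 2))} {y : Euc (m + 2)}

/-- The conformal factor `g₁₁ = g₂₂`. -/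
theorem inner_self (h : NetForm F N ρ s V) (hy : y ∈ V) {i : Fin (m + 2)} (hi : i = 0 ∨ i = 1) :
    inner ℝ (fderiv ℝ F y (coordVec i)) (fderiv ℝ F y (coordVec i)) = firstForm F y 0 0 := by
  rcases hi with rfl | rfl
  · rfl
  · rw [h.isothermal y hy]
    rfl

theorem firstForm_pos (h : NetForm F N ρ s V) (hy : y ∈ V) : 0 < firstForm F y 0 0 := by
  have h0 : fderiv ℝ F y (coordVec 0) ≠ 0 := by
    rw [← map_zero (fderiv ℝ F y), (h.hyp.immersion y hy).ne_iff]
    simp [coordVec]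
  exact real_inner_self_pos.2 h0

theorem secondForm_eq (h : NetForm F N ρ s V) (hy : y ∈ V) (A B : Fin (m + 2)) :
    secondForm F N y A B
      = -inner ℝ (fderiv ℝ F y (coordVec B)) (fderiv ℝ N y (coordVec A)) := by
  rw [secondForm, Matrix.of_apply, h.hyp.inner_fderiv_fderiv_normal hy]

theorem secondForm_comm (h : NetForm F N ρ s V) (hy : y ∈ V) (A B : Fin (m + 2)) :
    secondForm F N y A B = secondForm F N y B A := by
  rw [secondForm, Matrix.of_apply, Matrix.of_apply,
    h.hyp.smooth.fderiv_fderiv_comm h.hyp.isOpen hy]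

theorem _root_.Bonnet.IsHypersurface.eq_of_inner_coordVec {n : ℕ} {F N : Euc n → Euc (n + 1)}
    {V : Set (Euc n)} {y : Euc n} (hF : IsHypersurface F N V) (hy : y ∈ V) {v w : Euc (n + 1)}
    (hT : ∀ A, inner ℝ v (fderiv ℝ F y (coordVec A)) = inner ℝ w (fderiv ℝ F y (coordVec A)))
    (hN : inner ℝ v (N y) = inner ℝ w (N y)) : v = w := by
  refine hF.eq_of_inner_eq hy (fun X => ?_) hN
  have : innerSL ℝ v ∘L fderiv ℝ F y = innerSL ℝ w ∘L fderiv ℝ F y := clm_ext_coordVec hT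
  exact congrArg (fun L => L X) this

theorem fderiv_normal_null (h : NetForm F N ρ s V) (hy : y ∈ V) (p : Fin m) :
    fderiv ℝ N y (coordVec p.succ.succ) = 0 := by
  refine h.hyp.eq_of_inner_coordVec hy (fun A => ?_) ?_
  · have := h.null y hy A p
    rw [h.secondForm_comm hy, h.secondForm_eq hy, neg_eq_zero] at this
    rw [real_inner_comm, this, inner_zero_left]
  · rw [h.hyp.inner_fderiv_normal hy, inner_zero_left]

theorem fderiv_firstForm (h : NetForm F N ρ s V) (hy : y ∈ V) (X : Euc (m + 2))
    (A B : Fin (m + 2)) :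
    fderiv ℝ (fun z => firstForm F z A B) y X
      = inner ℝ (fderiv ℝ (fderiv ℝ F) y X (coordVec A)) (fderiv ℝ F y (coordVec B))
        + inner ℝ (fderiv ℝ (fderiv ℝ F) y X (coordVec B)) (fderiv ℝ F y (coordVec A)) := by
  have hT := h.hyp.differentiableAt_fderiv hy
  change fderiv ℝ (fun z => inner ℝ (fderiv ℝ F z (coordVec A)) (fderiv ℝ F z (coordVec B))) y X = _
  rw [fderiv_inner_apply ℝ (hT.clm_apply (differentiableAt_const _))
    (hT.clm_apply (differentiableAt_const _)), fderiv_clm_apply_const hT,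
    fderiv_clm_apply_const hT, add_comm,
    real_inner_comm (fderiv ℝ (fderiv ℝ F) y X (coordVec B))]

/-- Symmetric in A and B because derivatives commute, antisymmetric in B and C because orthogonality
is preserved: such an expression is zero. -/
theorem inner_fderiv_fderiv_of_ne (h : NetForm F N ρ s V) (hy : y ∈ V) {A B C : Fin (m + 2)}
    (hAB : A ≠ B) (hBC : B ≠ C) (hAC : A ≠ C) :
    inner ℝ (fderiv ℝ (fderiv ℝ F) y (coordVec A) (coordVec B)) (fderiv ℝ F y (coordVec C))
      = 0 := by
  have hz : ∀ A B C : Fin (m + 2), B ≠ C →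
      inner ℝ (fderiv ℝ (fderiv ℝ F) y (coordVec A) (coordVec B)) (fderiv ℝ F y (coordVec C))
      + inner ℝ (fderiv ℝ (fderiv ℝ F) y (coordVec A) (coordVec C)) (fderiv ℝ F y (coordVec B))
      = 0 := by
    intro A B C hBC
    rw [← h.fderiv_firstForm hy,
      fderiv_eq_of_eqOn h.hyp.isOpen (fun z hz => h.orthogonal z hz B C hBC) hy]
    simp
  have hcomm := fun A B => h.hyp.smooth.fderiv_fderiv_comm h.hyp.isOpen hy (coordVec A) (coordVec B)
  have h1 := hz A B C hBC
  have h2 := hz B A C hAC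
  have h3 := hz C A B hAB
  rw [hcomm B A] at h2
  rw [hcomm C A, hcomm C B] at h3
  linarith

/-- The derivative of the first two tangent vectors in the last directions. -/
theorem fderiv_fderiv_null (h : NetForm F N ρ s V) (hy : y ∈ V) {i : Fin (m + 2)}
    (hi : i = 0 ∨ i = 1) (p : Fin m) :
    fderiv ℝ (fderiv ℝ F) y (coordVec p.succ.succ) (coordVec i)
      = (fderiv ℝ (fun z => firstForm F z 0 0) y (coordVec p.succ.succ) / (2 * firstForm F y 0 0))
        • fderiv ℝ F y (coordVec i) := by
  have hpi : p.succ.succ ≠ i := by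
    rcases hi with rfl | rfl
    · exact Fin.succ_ne_zero _
    · exact fun h => Fin.succ_ne_zero p (Fin.succ_injective _ h)
  have hE := (h.firstForm_pos hy).ne'
  have hcomm := fun A B => h.hyp.smooth.fderiv_fderiv_comm h.hyp.isOpen hy (coordVec A) (coordVec B)
  refine h.hyp.eq_of_inner_coordVec hy (fun B => ?_) ?_
  · rw [real_inner_smul_left]
    by_cases hBi : B = i
    · subst hBi
      have h1 := h.fderiv_firstForm hy (coordVec p.succ.succ) B B
      have h2 : fderiv ℝ (fun z => firstForm F z B B) y = fderiv ℝ (fun z => firstForm F z 0 0) y :=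
        fderiv_eq_of_eqOn h.hyp.isOpen (fun z hz => h.inner_self hz hi) hy
      rw [h2] at h1
      rw [h.inner_self hy hi, h1]
      field_simp
      ring
    · have h0 : inner ℝ (fderiv ℝ F y (coordVec i)) (fderiv ℝ F y (coordVec B)) = 0 :=
        h.orthogonal y hy i B (Ne.symm hBi)
      rw [h0, mul_zero]
      by_cases hBp : B = p.succ.succ
      · subst hBp
        have h1 := h.fderiv_firstForm hy (coordVec i) p.succ.succ p.succ.succ
        rw [fderiv_eq_of_eqOn h.hyp.isOpen (fun z hz => h.unit z hz p) hy] at h1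
        rw [hcomm]
        simp only [fderiv_fun_const, Pi.zero_apply, zero_apply] at h1
        linarith
      · exact h.inner_fderiv_fderiv_of_ne hy hpi (Ne.symm hBi) (Ne.symm hBp)
  · rw [real_inner_smul_left, h.hyp.normal_orthogonal y hy, mul_zero]
    have := h.null y hy i p
    rw [h.secondForm_comm hy] at this
    exact this

/-- In the null directions N is constant, and the first two coordinate vectors keep their directions
and scale like √g₁₁, so these entries of b scale in the same way. -/
theorem fderiv_secondForm_null (h : NetForm F N ρ s V) (hy : y ∈ V) {i j : Fin (m + 2)}
    (hj : j = 0 ∨ j = 1) (p : Fin m) :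
    fderiv ℝ (fun z => secondForm F N z i j) y (coordVec p.succ.succ)
      = fderiv ℝ (fun z => firstForm F z 0 0) y (coordVec p.succ.succ) / (2 * firstForm F y 0 0)
        * secondForm F N y i j := by
  have hV := h.hyp.isOpen
  have hT := h.hyp.differentiableAt_fderiv hy
  have hN := h.hyp.differentiableAt_fderiv_normal hy
  have h1 : fderiv ℝ (fun z => secondForm F N z i j) y
      = fderiv ℝ (fun z => -inner ℝ (fderiv ℝ F z (coordVec j)) (fderiv ℝ N z (coordVec i))) y :=
    fderiv_eq_of_eqOn hV (fun z hz => h.secondForm_eq hz i j) hy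
  have h2 : fderiv ℝ (fderiv ℝ N) y (coordVec p.succ.succ) (coordVec i) = 0 := by
    rw [h.hyp.smooth_normal.fderiv_fderiv_comm hV hy, ← fderiv_clm_apply_const hN,
      fderiv_eq_of_eqOn hV (fun z hz => h.fderiv_normal_null hz p) hy]
    simp
  rw [h1, fderiv_fun_neg, neg_apply, fderiv_inner_apply ℝ (hT.clm_apply (differentiableAt_const _))
    (hN.clm_apply (differentiableAt_const _)), fderiv_clm_apply_const hT,
    fderiv_clm_apply_const hN, h2, h.fderiv_fderiv_null hy hj, inner_zero_right, zero_add,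
    real_inner_smul_left, h.secondForm_eq hy]
  ring

/-- Applied to b₁₂ = sρ, the scaling law says that ρ also scales like √g₁₁ in the null directions.
-/
theorem fderiv_weight (h : NetForm F N ρ s V) (hy : y ∈ V) (hs : s ≠ 0) (hρ : IsWeight ρ)
    (p : Fin m) : fderiv ℝ ρ y (coordVec p.succ.succ)
      = fderiv ℝ (fun z => firstForm F z 0 0) y (coordVec p.succ.succ) / (2 * firstForm F y 0 0)
        * ρ y := by
  have h1 := h.fderiv_secondForm_null hy (i := 0) (Or.inr rfl) p
  have h2 : fderiv ℝ (fun z => secondForm F N z 0 1) y = fderiv ℝ (fun z => s * ρ z) y :=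
    fderiv_eq_of_eqOn h.hyp.isOpen (fun z hz => h.mixed z hz) hy
  rw [h2, h.mixed y hy, fderiv_const_mul (hρ.contDiff.contDiffAt.differentiableAt (by simp))] at h1
  refine mul_left_cancel₀ hs ?_
  rw [smul_apply, smul_eq_mul] at h1
  linear_combination h1

/-- An A-net does not ask for ρ ≠ 0. It follows from the scaling law: at a zero of a linear weight
all partial derivatives C^p would vanish. -/
theorem weight_ne_zero (h : NetForm F N ρ s V) (hy : y ∈ V) (hs : s ≠ 0) (hρ : IsWeight ρ) :
    ρ y ≠ 0 := hρ.ne_zero fun p => h.fderiv_weight hy hs hρ p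

theorem contDiffOn_firstForm (h : NetForm F N ρ s V) (A B : Fin (m + 2)) :
    ContDiffOn ℝ ∞ (fun z => firstForm F z A B) V := by
  have hT := h.hyp.smooth.fderiv_infty h.hyp.isOpen
  exact (hT.clm_apply contDiffOn_const).inner ℝ (hT.clm_apply contDiffOn_const)

theorem contDiffOn_secondForm (h : NetForm F N ρ s V) (A B : Fin (m + 2)) :
    ContDiffOn ℝ ∞ (fun z => secondForm F N z A B) V := by
  have hT := (h.hyp.smooth.fderiv_infty h.hyp.isOpen).fderiv_infty h.hyp.isOpen
  exact ((hT.clm_apply contDiffOn_const).clm_apply contDiffOn_const).inner ℝ h.hyp.smooth_normal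

end NetForm

end Bonnet

end


/-! ### Canonical shape of the fundamental forms -/

open scoped ContDiff Topology

noncomputable section

namespace Bonnet

/-- The point with first two coordinates `a` and the other coordinates those of `y₀`. -/
def slicePoint {m : ℕ} (y₀ : Euc (m + 2)) (a : ℝ × ℝ) : Euc (m + 2) :=
  WithLp.toLp 2 (Fin.cons a.1 (Fin.cons a.2 fun p : Fin m => y₀ p.succ.succ) : Fin (m + 2) → ℝ)

theorem contDiff_slicePoint {m : ℕ} (y₀ : Euc (m + 2)) : ContDiff ℝ ∞ (slicePoint y₀) := by
  rw [contDiff_euclidean]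
  exact forall_fin_add_two contDiff_fst contDiff_snd fun p => contDiff_const

theorem slicePoint_mem_ball {m : ℕ} {y₀ y : Euc (m + 2)} {r : ℝ} (hy : y ∈ Metric.ball y₀ r) :
    slicePoint y₀ (y 0, y 1) ∈ Metric.ball y₀ r := by
  rw [Metric.mem_ball, EuclideanSpace.dist_eq] at *
  refine lt_of_le_of_lt (Real.sqrt_le_sqrt (Finset.sum_le_sum fun A hA => ?_)) hy
  clear hA
  revert A
  refine forall_fin_add_two le_rfl le_rfl fun p => ?_
  have : slicePoint y₀ (y 0, y 1) p.succ.succ = y₀ p.succ.succ := rfl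
  rw [this, dist_self, zero_pow two_ne_zero]
  positivity

/-- A function on a ball whose derivatives in the last directions vanish depends on the first two
coordinates only. -/
theorem apply_slicePoint {m : ℕ} {y₀ y : Euc (m + 2)} {r : ℝ} {f : Euc (m + 2) → ℝ}
    (hf : ∀ z ∈ Metric.ball y₀ r, DifferentiableAt ℝ f z)
    (h0 : ∀ z ∈ Metric.ball y₀ r, ∀ p : Fin m, fderiv ℝ f z (coordVec p.succ.succ) = 0)
    (hy : y ∈ Metric.ball y₀ r) : f (slicePoint y₀ (y 0, y 1)) = f y := by
  set v := slicePoint y₀ (y 0, y 1) - y with hv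
  have hmem : ∀ t ∈ Set.Icc (0 : ℝ) 1, y + t • v ∈ Metric.ball y₀ r := fun t ht =>
    (convex_ball y₀ r).add_smul_sub_mem hy (slicePoint_mem_ball hy) ht
  have hdv : ∀ z ∈ Metric.ball y₀ r, fderiv ℝ f z v = 0 := by
    intro z hz
    have hsum : v = ∑ A, v A • coordVec A := by
      have := (EuclideanSpace.basisFun (Fin (m + 2)) ℝ).sum_repr v
      simpa [coordVec] using this.symm
    rw [hsum, map_sum]
    refine Finset.sum_eq_zero fun A hA => ?_
    rw [map_smul]
    clear hA
    revert A
    refine forall_fin_add_two ?_ ?_ fun p => ?_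
    · have : v 0 = 0 := by rw [hv, PiLp.sub_apply]; exact sub_self _
      rw [this, zero_smul]
    · have : v 1 = 0 := by rw [hv, PiLp.sub_apply]; exact sub_self _
      rw [this, zero_smul]
    · rw [h0 z hz, smul_zero]
  have hd : ∀ t ∈ Set.Icc (0 : ℝ) 1, HasDerivAt (fun t : ℝ => f (y + t • v)) 0 t := by
    intro t ht
    have h1 : HasDerivAt (fun t : ℝ => y + t • v) v t := by
      simpa using ((hasDerivAt_id t).smul_const v).const_add y
    have := (hf _ (hmem t ht)).hasFDerivAt.comp_hasDerivAt t h1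
    rwa [hdv _ (hmem t ht)] at this
  have := constant_of_has_deriv_right_zero
    (fun t ht => (hd t ht).continuousAt.continuousWithinAt)
    (fun t ht => (hd t (Set.Ico_subset_Icc_self ht)).hasDerivWithinAt) 1 (by simp)
  simpa [hv] using this

theorem fderiv_div_eq_zero {E : Type*} [NormedAddCommGroup E] [NormedSpace ℝ E] {f g : E → ℝ}
    {x X : E} (hf : DifferentiableAt ℝ f x) (hg : DifferentiableAt ℝ g x) (h0 : g x ≠ 0) {w : ℝ}
    (hf' : fderiv ℝ f x X = w * f x) (hg' : fderiv ℝ g x X = w * g x) :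
    fderiv ℝ (fun y => f y / g y) x X = 0 := by
  have h1 : fderiv ℝ (fun y => f y / g y * g y) x = fderiv ℝ f x := by
    refine Filter.EventuallyEq.fderiv_eq ?_
    filter_upwards [hg.continuousAt.eventually_ne h0] with y hy
    rw [div_mul_cancel₀ _ hy]
  have h2 := congrArg (fun L => L X) h1
  have hd : DifferentiableAt ℝ (fun y => f y / g y) x := by
    simpa only [div_eq_mul_inv] using hf.fun_mul (hg.fun_inv h0)
  rw [fderiv_fun_mul hd hg] at h2
  simp only [add_apply, smul_apply, smul_eq_mul, hf', hg'] at h2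
  have h3 : f x / g x * (w * g x) = w * f x := by field_simp
  rw [h3] at h2
  have h4 : g x * fderiv ℝ (fun y => f y / g y) x X = 0 := by linarith
  exact (mul_eq_zero.1 h4).resolve_left h0

/-- In a net the fundamental forms have the canonical shape. -/
theorem NetForm.exists_forms {m : ℕ} {F N : Euc (m + 2) → Euc (m + 2 + 1)}
    {ρ : Euc (m + 2) → ℝ} {y₀ : Euc (m + 2)} {r : ℝ} (h : NetForm F N ρ 1 (Metric.ball y₀ r))
    (hρ : IsWeight ρ) (hpos : ∀ y ∈ Metric.ball y₀ r, 0 < ρ y) :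
    ∃ H J θ : ℝ × ℝ → ℝ, IsBonnetData (Metric.ball y₀ r) ρ H J θ 1 ∧
      ∀ y ∈ Metric.ball y₀ r,
        firstForm F y 0 0 = ρ y ^ 2 / (|J (y 0, y 1)| * Real.sin (θ (y 0, y 1))) ∧
        secondForm F N y 0 0 = ρ y * (H (y 0, y 1) + J (y 0, y 1) * Real.cos (θ (y 0, y 1))) /
          (|J (y 0, y 1)| * Real.sin (θ (y 0, y 1))) ∧
        secondForm F N y 1 1 = ρ y * (H (y 0, y 1) - J (y 0, y 1) * Real.cos (θ (y 0, y 1))) /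
          (|J (y 0, y 1)| * Real.sin (θ (y 0, y 1))) := by
  set Ω := Metric.ball y₀ r with hΩ
  have hΩo : IsOpen Ω := Metric.isOpen_ball
  have hρs : ContDiffOn ℝ ∞ ρ Ω := hρ.contDiff.contDiffOn
  have hρ0 : ∀ y ∈ Ω, ρ y ≠ 0 := fun y hy => (hpos y hy).ne'
  have hdiff : ∀ {f : Euc (m + 2) → ℝ}, ContDiffOn ℝ ∞ f Ω → ∀ y ∈ Ω, DifferentiableAt ℝ f y :=
    fun hf y hy => hf.differentiableAt_of_isOpen hΩo hy
  set u : Euc (m + 2) → ℝ := fun y => secondForm F N y 0 0 / ρ y with hu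
  set v : Euc (m + 2) → ℝ := fun y => secondForm F N y 1 1 / ρ y with hv
  set w : Euc (m + 2) → ℝ := fun y => firstForm F y 0 0 / (ρ y * ρ y) with hw
  have hus : ContDiffOn ℝ ∞ u Ω := (h.contDiffOn_secondForm 0 0).div hρs hρ0
  have hvs : ContDiffOn ℝ ∞ v Ω := (h.contDiffOn_secondForm 1 1).div hρs hρ0
  have hws : ContDiffOn ℝ ∞ w Ω := (h.contDiffOn_firstForm 0 0).div (hρs.mul hρs)
    fun y hy => mul_ne_zero (hρ0 y hy) (hρ0 y hy)
  have hwpos : ∀ y ∈ Ω, 0 < w y := fun y hy =>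
    div_pos (h.firstForm_pos hy) (mul_pos (hpos y hy) (hpos y hy))
  -- Numerator and denominator have equal logarithmic derivatives in the null directions, so the
  -- quotients are functions of the first two coordinates, evaluated on the slice through the
  -- centre.
  have hu0 : ∀ y ∈ Ω, u (slicePoint y₀ (y 0, y 1)) = u y := fun y hy =>
    apply_slicePoint (hdiff hus) (fun z hz p => fderiv_div_eq_zero
      (hdiff (h.contDiffOn_secondForm 0 0) z hz) (hdiff hρs z hz) (hρ0 z hz)
      (h.fderiv_secondForm_null hz (Or.inl rfl) p) (h.fderiv_weight hz one_ne_zero hρ p)) hy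
  have hv0 : ∀ y ∈ Ω, v (slicePoint y₀ (y 0, y 1)) = v y := fun y hy =>
    apply_slicePoint (hdiff hvs) (fun z hz p => fderiv_div_eq_zero
      (hdiff (h.contDiffOn_secondForm 1 1) z hz) (hdiff hρs z hz) (hρ0 z hz)
      (h.fderiv_secondForm_null hz (Or.inr rfl) p) (h.fderiv_weight hz one_ne_zero hρ p)) hy
  have hw0 : ∀ y ∈ Ω, w (slicePoint y₀ (y 0, y 1)) = w y := fun y hy =>
    apply_slicePoint (hdiff hws) (fun z hz p => by
      refine fderiv_div_eq_zero (hdiff (h.contDiffOn_firstForm 0 0) z hz)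
        ((hdiff hρs z hz).fun_mul (hdiff hρs z hz)) (mul_ne_zero (hρ0 z hz) (hρ0 z hz))
        (w := fderiv ℝ (fun z => firstForm F z 0 0) z (coordVec p.succ.succ) / firstForm F z 0 0)
        ?_ ?_
      · have := (h.firstForm_pos hz).ne'
        field_simp
      · have := (h.firstForm_pos hz).ne'
        rw [fderiv_fun_mul (hdiff hρs z hz) (hdiff hρs z hz)]
        simp only [add_apply, smul_apply, smul_eq_mul, h.fderiv_weight hz one_ne_zero hρ p]
        field_simp
        ring) hy
  -- The angle solves cot θ = (b₁₁ - b₂₂)/(2ρ), and the arctangent places it in (0, π). Then J is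
  -- forced by g₁₁ = ρ²/(J sin θ) and H by b₁₁ + b₂₂; J is positive, in accordance with ε = 1.
  set θ : ℝ × ℝ → ℝ := fun a => Real.pi / 2
    - Real.arctan ((u (slicePoint y₀ a) - v (slicePoint y₀ a)) / 2) with hθ
  set J : ℝ × ℝ → ℝ := fun a => 1 / (w (slicePoint y₀ a) * Real.sin (θ a)) with hJ
  set H : ℝ × ℝ → ℝ := fun a => (u (slicePoint y₀ a) + v (slicePoint y₀ a))
    / (2 * w (slicePoint y₀ a)) with hH
  have hcomp : ∀ {f : Euc (m + 2) → ℝ}, ContDiffOn ℝ ∞ f Ω → ∀ y ∈ Ω,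
      ContDiffAt ℝ ∞ (fun a => f (slicePoint y₀ a)) (y 0, y 1) := fun hf y hy =>
    ContDiffAt.comp (y 0, y 1) (hf.contDiffAt (hΩo.mem_nhds (slicePoint_mem_ball hy)))
      (contDiff_slicePoint y₀).contDiffAt
  have hangle : ∀ a, θ a ∈ Set.Ioo 0 Real.pi := fun a => by
    have h1 := Real.neg_pi_div_two_lt_arctan ((u (slicePoint y₀ a) - v (slicePoint y₀ a)) / 2)
    have h2 := Real.arctan_lt_pi_div_two ((u (slicePoint y₀ a) - v (slicePoint y₀ a)) / 2)
    constructor <;> simp only [hθ] <;> linarith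
  have hsin : ∀ a, 0 < Real.sin (θ a) := fun a =>
    Real.sin_pos_of_pos_of_lt_pi (hangle a).1 (hangle a).2
  have hcos : ∀ a, Real.cos (θ a)
      = (u (slicePoint y₀ a) - v (slicePoint y₀ a)) / 2 * Real.sin (θ a) := fun a => by
    simp only [hθ]
    rw [Real.cos_pi_div_two_sub, Real.sin_pi_div_two_sub]
    have := Real.tan_mul_cos
      (Real.cos_arctan_pos ((u (slicePoint y₀ a) - v (slicePoint y₀ a)) / 2)).ne'
    rw [Real.tan_arctan] at this
    exact this.symm
  have hθs : ∀ y ∈ Ω, ContDiffAt ℝ ∞ θ (y 0, y 1) := fun y hy =>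
    contDiffAt_const.sub (((hcomp hus y hy).sub (hcomp hvs y hy)).div_const 2).arctan
  have hJpos : ∀ y ∈ Ω, 0 < J (y 0, y 1) := fun y hy =>
    one_div_pos.2 (mul_pos (hwpos _ (slicePoint_mem_ball hy)) (hsin _))
  refine ⟨H, J, θ, ⟨hρ, Or.inl rfl, fun y hy => by simpa using hJpos y hy, fun y _ => hangle _,
    fun y hy => ?_, fun y hy => ?_, hθs⟩, fun y hy => ?_⟩
  · exact ((hcomp hus y hy).add (hcomp hvs y hy)).div (contDiffAt_const.mul (hcomp hws y hy))
      (mul_pos two_pos (hwpos _ (slicePoint_mem_ball hy))).ne'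
  · exact contDiffAt_const.div ((hcomp hws y hy).mul (hθs y hy).sin)
      (mul_pos (hwpos _ (slicePoint_mem_ball hy)) (hsin _)).ne'
  · have hden : |J (y 0, y 1)| * Real.sin (θ (y 0, y 1)) = ρ y ^ 2 / firstForm F y 0 0 := by
      have hs := (hsin (y 0, y 1)).ne'
      have hρy := hρ0 y hy
      have hE := (h.firstForm_pos hy).ne'
      rw [abs_of_pos (hJpos y hy)]
      simp only [hJ]
      rw [hw0 y hy]
      simp only [hw]
      field_simp
    have hJc : J (y 0, y 1) * Real.cos (θ (y 0, y 1)) = (u y - v y) / (2 * w y) := by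
      have hs := (hsin (y 0, y 1)).ne'
      have hwy := (hwpos y hy).ne'
      rw [hcos]
      simp only [hJ]
      rw [hw0 y hy, hu0 y hy, hv0 y hy]
      field_simp
    have hHy : H (y 0, y 1) = (u y + v y) / (2 * w y) := by
      simp only [hH]
      rw [hw0 y hy, hu0 y hy, hv0 y hy]
    rw [hden, hJc, hHy]
    simp only [hu, hv, hw]
    have hρy := hρ0 y hy
    have hE := (h.firstForm_pos hy).ne'
    refine ⟨by field_simp, ?_, ?_⟩ <;> field_simp <;> ring

theorem IsNetWith.hasBonnetForms {m : ℕ} {F N : Euc (m + 2) → Euc (m + 2 + 1)}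
    {c : OpenPartialHomeomorph (Euc (m + 2)) (Euc (m + 2))} {ρ : Euc (m + 2) → ℝ}
    {s : ℝ} {H J θ : ℝ × ℝ → ℝ} (h : IsNetWith F N c ρ s)
    (hf : ∀ y ∈ c.target,
      gIn F c y 0 0 = ρ y ^ 2 / (|J (y 0, y 1)| * Real.sin (θ (y 0, y 1))) ∧
      bIn F N c y 0 0 = ρ y * (H (y 0, y 1) + J (y 0, y 1) * Real.cos (θ (y 0, y 1))) /
        (|J (y 0, y 1)| * Real.sin (θ (y 0, y 1))) ∧
      bIn F N c y 1 1 = ρ y * (H (y 0, y 1) - J (y 0, y 1) * Real.cos (θ (y 0, y 1))) /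
        (|J (y 0, y 1)| * Real.sin (θ (y 0, y 1)))) : HasBonnetForms F N c ρ H J θ s :=
  ⟨h, fun y hy => (hf y hy).1, fun y hy => (hf y hy).2.1, fun y hy => (hf y hy).2.2⟩

/-- Local form of a pair of isometric hypersurfaces with the same mean curvature and different shape
operators. -/
theorem IsometricPair.exists_bonnetForms {m : ℕ} {F N F' N' : Euc (m + 2) → Euc (m + 2 + 1)}
    {V : Set (Euc (m + 2))} {x₀ : Euc (m + 2)} (hp : IsometricPair F N F' N' V)
    (hmean : ∀ x ∈ V, meanCurvature F' N' x = meanCurvature F N x)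
    (hH : ∀ x ∈ V, meanCurvature F N x ≠ 0)
    (hD : ∀ x ∈ V, relShape F N F N x - relShape F N F' N' x ≠ 0) (hx₀ : x₀ ∈ V) :
    ∃ c : OpenPartialHomeomorph (Euc (m + 2)) (Euc (m + 2)), IsCoordAt c V x₀ ∧
      ∃ (ρ : Euc (m + 2) → ℝ) (H J θ : ℝ × ℝ → ℝ) (ε : ℝ), IsBonnetData c.target ρ H J θ ε ∧
        HasBonnetForms F N c ρ H J θ ε ∧ HasBonnetForms F' N' c ρ H J θ (-ε) := by
  obtain ⟨c, hc, ⟨r, -, hr⟩, ρ, hρ, hpos, hn, hn', heq⟩ := hp.exists_net hmean hH hD hx₀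
  have hnf := hn.netForm hp.left hc
  rw [hr] at hnf hpos
  obtain ⟨H, J, θ, hdata, hforms⟩ := hnf.exists_forms hρ hpos
  rw [← hr] at hdata hforms
  refine ⟨c, hc, ρ, H, J, θ, 1, hdata, hn.hasBonnetForms hforms, hn'.hasBonnetForms ?_⟩
  intro y hy
  obtain ⟨e1, e2, e3⟩ := heq y hy
  rw [e1, e2, e3]
  exact hforms y hy

end Bonnet

end


/-! ### A local Frobenius theorem for dR = R Ω -/

open scoped ContDiff Topology

noncomputable section

namespace Bonnet

section Frobenius

variable {E A : Type*} [NormedAddCommGroup E] [NormedSpace ℝ E] [NormedRing A] [NormedAlgebra ℝ A]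

/-- The linear equation `Y' = Y a`, `Y 0 = 1` on `[0, 1]`, with small coefficient. -/
theorem exists_linear_ode [CompleteSpace A] {a : ℝ → A} (ha : ContinuousOn a (Set.Icc 0 1))
    (hb : ∀ t ∈ Set.Icc (0 : ℝ) 1, ‖a t‖ ≤ 1 / 2) :
    ∃ Y : ℝ → A, Y 0 = 1 ∧
      ∀ t ∈ Set.Icc (0 : ℝ) 1, HasDerivWithinAt Y (Y t * a t) (Set.Icc 0 1) t := by
  -- On the ball of radius ‖1‖ about 1 the field has norm at most 2‖1‖ · 1/2 = ‖1‖, so the solution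
  -- stays in the ball for unit time. This is the role of the bound 1/2.
  have hp : IsPicardLindelof (fun t Y => Y * a t) (⟨0, by simp⟩ : Set.Icc (0 : ℝ) 1) (1 : A)
      ‖(1 : A)‖₊ 0 ‖(1 : A)‖₊ 1 := by
    refine ⟨fun t ht => LipschitzOnWith.of_dist_le_mul fun y _ z _ => ?_, fun y _ =>
      continuousOn_const.mul ha, fun t ht y hy => ?_, ?_⟩
    · rw [dist_eq_norm, dist_eq_norm, ← sub_mul]
      refine (norm_mul_le _ _).trans ?_
      have := hb t ht
      have h0 := norm_nonneg (y - z)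
      push_cast
      nlinarith
    · have h1 : ‖y‖ ≤ 2 * ‖(1 : A)‖ := by
        have h2 := norm_add_le (y - 1) 1
        rw [sub_add_cancel] at h2
        rw [mem_closedBall_iff_norm, coe_nnnorm] at hy
        linarith
      refine (norm_mul_le _ _).trans ?_
      have := hb t ht
      rw [coe_nnnorm]
      calc ‖y‖ * ‖a t‖ ≤ (2 * ‖(1 : A)‖) * (1 / 2) := by gcongr
        _ = ‖(1 : A)‖ := by ring
    · simp
  exact hp.exists_eq_forall_mem_Icc_hasDerivWithinAt₀

/-- Provides a bound that is uniform over all rays; the Grönwall constant 1 is generous but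
sufficient. -/
theorem norm_le_of_linear_ode {Y a : ℝ → A} (h0 : Y 0 = 1)
    (hY : ∀ t ∈ Set.Icc (0 : ℝ) 1, HasDerivWithinAt Y (Y t * a t) (Set.Icc 0 1) t)
    (hb : ∀ t ∈ Set.Icc (0 : ℝ) 1, ‖a t‖ ≤ 1 / 2) {t : ℝ} (ht : t ∈ Set.Icc (0 : ℝ) 1) :
    ‖Y t‖ ≤ ‖(1 : A)‖ * Real.exp 1 := by
  have := norm_le_gronwallBound_of_norm_deriv_right_le (f := Y) (δ := ‖(1 : A)‖) (K := 1) (ε := 0)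
    (fun s hs => (hY s hs).continuousWithinAt)
    (fun s hs => (hY s (Set.Ico_subset_Icc_self hs)).mono_of_mem_nhdsWithin
      (Icc_mem_nhdsGE_of_mem hs)) (by rw [h0]) (fun s hs => by
      refine (norm_mul_le _ _).trans ?_
      have h1 := hb s (Set.Ico_subset_Icc_self hs)
      have h2 := norm_nonneg (Y s)
      nlinarith) t ht
  rw [gronwallBound_ε0, sub_zero, one_mul] at this
  refine this.trans ?_
  have := ht.2
  gcongr

/-- Comparison of the solutions of the linear equation along two rays. -/
theorem norm_ray_sub_le {Ω : E → E →L[ℝ] A} {x₀ v h : E} {Y Y' : ℝ → A} {M M₁ M₂ K : ℝ}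
    (hM : 0 ≤ M) (hM₁ : 0 ≤ M₁) (hM₂ : 0 ≤ M₂) (hK : 0 ≤ K)
    (hdiff : ∀ t ∈ Set.Icc (0 : ℝ) 1, DifferentiableAt ℝ Ω (x₀ + t • v))
    (hflat : ∀ t ∈ Set.Icc (0 : ℝ) 1,
      fderiv ℝ Ω (x₀ + t • v) v h + Ω (x₀ + t • v) v * Ω (x₀ + t • v) h
        = fderiv ℝ Ω (x₀ + t • v) h v + Ω (x₀ + t • v) h * Ω (x₀ + t • v) v)
    (h0 : Y 0 = 1) (h0' : Y' 0 = 1)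
    (hY : ∀ t ∈ Set.Icc (0 : ℝ) 1, HasDerivWithinAt Y (Y t * Ω (x₀ + t • v) v) (Set.Icc 0 1) t)
    (hY' : ∀ t ∈ Set.Icc (0 : ℝ) 1,
      HasDerivWithinAt Y' (Y' t * Ω (x₀ + t • (v + h)) (v + h)) (Set.Icc 0 1) t)
    (hYK : ∀ t ∈ Set.Icc (0 : ℝ) 1, ‖Y t‖ ≤ K)
    (hsmall : ‖v + h‖ ≤ 1)
    (hb : ∀ t ∈ Set.Icc (0 : ℝ) 1, ‖Ω (x₀ + t • v)‖ ≤ M)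
    (hb' : ∀ t ∈ Set.Icc (0 : ℝ) 1, ‖Ω (x₀ + t • (v + h)) (v + h)‖ ≤ 1)
    (hb₁ : ∀ t ∈ Set.Icc (0 : ℝ) 1, ‖fderiv ℝ Ω (x₀ + t • v)‖ ≤ M₁)
    (hlip : ∀ t ∈ Set.Icc (0 : ℝ) 1, ‖Ω (x₀ + t • (v + h)) - Ω (x₀ + t • v)‖ ≤ M₁ * ‖h‖)
    (htaylor : ∀ t ∈ Set.Icc (0 : ℝ) 1, ‖Ω (x₀ + t • (v + h)) - Ω (x₀ + t • v)
      - fderiv ℝ Ω (x₀ + t • v) (t • h)‖ ≤ M₂ * ‖h‖ ^ 2) :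
    ‖Y' 1 - Y 1 - Y 1 * Ω (x₀ + v) h‖
      ≤ K * (M₂ + M₁ + M * (M₁ + M)) * (Real.exp 1 - 1) * ‖h‖ ^ 2 := by
  -- If dR = RΩ holds, the solutions on the rays v and v + h differ at time t by Y Ω(th) to first
  -- order; δ is the error of that prediction and starts at zero.
  set δ : ℝ → A := fun t => Y' t - Y t - Y t * (t • Ω (x₀ + t • v) h) with hδ
  set δ' : ℝ → A := fun t => Y' t * Ω (x₀ + t • (v + h)) (v + h) - Y t * Ω (x₀ + t • v) v
    - (Y t * Ω (x₀ + t • v) v * (t • Ω (x₀ + t • v) h)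
      + Y t * (Ω (x₀ + t • v) h + t • fderiv ℝ Ω (x₀ + t • v) v h)) with hδ'
  have hder : ∀ t ∈ Set.Icc (0 : ℝ) 1, HasDerivWithinAt δ (δ' t) (Set.Icc 0 1) t := by
    intro t ht
    have h1 : HasDerivAt (fun t : ℝ => x₀ + t • v) v t := by
      simpa using ((hasDerivAt_id t).smul_const v).const_add x₀
    have h2 : HasDerivAt (fun t : ℝ => Ω (x₀ + t • v) h) (fderiv ℝ Ω (x₀ + t • v) v h) t := by
      have h3 := (hdiff t ht).hasFDerivAt.comp_hasDerivAt t h1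
      have h4 := ((ContinuousLinearMap.apply ℝ A h).hasFDerivAt).comp_hasDerivAt t h3
      exact h4
    have h5 : HasDerivAt (fun t : ℝ => t • Ω (x₀ + t • v) h)
        (Ω (x₀ + t • v) h + t • fderiv ℝ Ω (x₀ + t • v) v h) t := by
      have := (hasDerivAt_id t).fun_smul h2
      simpa [add_comm] using this
    exact ((hY' t ht).sub (hY t ht)).sub ((hY t ht).mul h5.hasDerivWithinAt)
  have hbound : ∀ t ∈ Set.Icc (0 : ℝ) 1,
      ‖δ' t‖ ≤ 1 * ‖δ t‖ + K * (M₂ + M₁ + M * (M₁ + M)) * ‖h‖ ^ 2 := by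
    intro t ht
    set p := x₀ + t • v with hp
    set q := x₀ + t • (v + h) with hq
    set d := fderiv ℝ Ω p with hd
    -- Flatness exchanges v and h in dΩ. Apart from the term linear in δ, everything that remains is
    -- quadratic in h.
    have hcomb : δ' t = δ t * Ω q (v + h)
        + Y t * ((Ω q - Ω p - d (t • h)) (v + h) + t • d h h)
        + t • (Y t * Ω p h * ((Ω q - Ω p) (v + h) + Ω p h)) := by
      have hfl := congrArg (fun z => t • (Y t * z)) (hflat t ht)
      simp only [hδ, hδ', ← hp, ← hq, ← hd] at hfl ⊢
      simp only [map_add, map_smul, sub_apply, smul_apply, sub_mul, mul_sub, mul_add,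
        smul_mul_assoc, mul_smul_comm, smul_add, smul_sub, ← mul_assoc] at hfl ⊢
      rw [← sub_eq_zero] at hfl ⊢
      rw [← neg_eq_zero, ← hfl]
      abel
    have e1 : ‖δ t * Ω q (v + h)‖ ≤ 1 * ‖δ t‖ := by
      refine (norm_mul_le _ _).trans ?_
      rw [mul_comm]
      exact mul_le_mul_of_nonneg_right (hb' t ht) (norm_nonneg _)
    have ht1 : ‖t‖ ≤ 1 := by
      rw [Real.norm_eq_abs, abs_of_nonneg ht.1]
      exact ht.2
    have e2 : ‖Y t * ((Ω q - Ω p - d (t • h)) (v + h) + t • d h h)‖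
        ≤ K * (M₂ * ‖h‖ ^ 2 + M₁ * ‖h‖ ^ 2) := by
      refine (norm_mul_le _ _).trans (mul_le_mul (hYK t ht) ?_ (norm_nonneg _) hK)
      refine (norm_add_le _ _).trans (add_le_add ?_ ?_)
      · refine (ContinuousLinearMap.le_opNorm _ _).trans ?_
        calc _ ≤ (M₂ * ‖h‖ ^ 2) * 1 := by
              gcongr
              exact htaylor t ht
          _ = _ := mul_one _
      · rw [norm_smul]
        calc ‖t‖ * ‖d h h‖ ≤ 1 * (M₁ * ‖h‖ * ‖h‖) := by
              gcongr
              refine (ContinuousLinearMap.le_opNorm₂ _ _ _).trans ?_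
              gcongr
              exact hb₁ t ht
          _ = _ := by ring
    have e3 : ‖t • (Y t * Ω p h * ((Ω q - Ω p) (v + h) + Ω p h))‖
        ≤ K * (M * ‖h‖) * (M₁ * ‖h‖ + M * ‖h‖) := by
      have hΩh : ‖Ω p h‖ ≤ M * ‖h‖ := (ContinuousLinearMap.le_opNorm _ _).trans (by
        gcongr
        exact hb t ht)
      rw [norm_smul]
      calc _ ≤ 1 * (K * (M * ‖h‖) * (M₁ * ‖h‖ + M * ‖h‖)) := by
            gcongr
            refine (norm_mul_le _ _).trans (mul_le_mul ?_ ?_ (norm_nonneg _) (by positivity))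
            · exact (norm_mul_le _ _).trans (mul_le_mul (hYK t ht) hΩh (norm_nonneg _) hK)
            · refine (norm_add_le _ _).trans (add_le_add ?_ hΩh)
              refine (ContinuousLinearMap.le_opNorm _ _).trans ?_
              calc _ ≤ (M₁ * ‖h‖) * 1 := by
                    gcongr
                    exact hlip t ht
                _ = _ := mul_one _
        _ = _ := one_mul _
    rw [hcomb]
    refine (norm_add₃_le).trans ((add_le_add (add_le_add e1 e2) e3).trans (le_of_eq ?_))
    ring
  have := norm_le_gronwallBound_of_norm_deriv_right_le (f := δ) (δ := 0) (K := 1)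
    (ε := K * (M₂ + M₁ + M * (M₁ + M)) * ‖h‖ ^ 2)
    (fun s hs => (hder s hs).continuousWithinAt)
    (fun s hs => (hder s (Set.Ico_subset_Icc_self hs)).mono_of_mem_nhdsWithin
      (Icc_mem_nhdsGE_of_mem hs)) (by simp [hδ, h0, h0'])
    (fun s hs => hbound s (Set.Ico_subset_Icc_self hs)) 1 (by simp)
  rw [gronwallBound_of_K_ne_0 one_ne_zero] at this
  simp only [hδ, one_smul, zero_mul, zero_add, div_one, sub_zero, mul_one] at this
  refine this.trans (le_of_eq ?_)
  ring

/-- Bootstrapping the regularity of a solution of `dR = R Ω`. -/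
theorem contDiffOn_of_hasFDerivAt_mul {Ω : E → E →L[ℝ] A} {V : Set E} (hV : IsOpen V)
    (hΩ : ContDiffOn ℝ ∞ Ω V) {R : E → A}
    (hR : ∀ x ∈ V, HasFDerivAt R (ContinuousLinearMap.mul ℝ A (R x) ∘L Ω x) x) :
    ContDiffOn ℝ ∞ R V := by
  rw [contDiffOn_infty]
  intro n
  induction n with
  | zero =>
    exact contDiffOn_zero.2 fun x hx => (hR x hx).continuousAt.continuousWithinAt
  | succ n ih =>
    push_cast
    rw [contDiffOn_succ_iff_fderiv_of_isOpen hV]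
    refine ⟨fun x hx => (hR x hx).differentiableAt.differentiableWithinAt, by simp, ?_⟩
    have h1 : ContDiffOn ℝ n (fun x => ContinuousLinearMap.mul ℝ A (R x) ∘L Ω x) V :=
      ((ContinuousLinearMap.mul ℝ A).contDiff.comp_contDiffOn ih).clm_comp
        (hΩ.of_le (by exact_mod_cast le_top))
    exact h1.congr fun x hx => (hR x hx).fderiv

/-- The local Frobenius theorem for the equation `dR = R Ω` with a flat connection form `Ω`. -/
theorem exists_fderiv_eq_mul [CompleteSpace A] {Ω : E → E →L[ℝ] A} {V : Set E} (hV : IsOpen V)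
    (hΩ : ContDiffOn ℝ ∞ Ω V) {x₀ : E} (hx₀ : x₀ ∈ V)
    (hflat : ∀ x ∈ V, ∀ X Y,
      fderiv ℝ Ω x X Y + Ω x X * Ω x Y = fderiv ℝ Ω x Y X + Ω x Y * Ω x X) :
    ∃ r > 0, Metric.ball x₀ r ⊆ V ∧ ∃ R : E → A, ContDiffOn ℝ ∞ R (Metric.ball x₀ r) ∧
      R x₀ = 1 ∧ ∀ x ∈ Metric.ball x₀ r, ∀ X, fderiv ℝ R x X = R x * Ω x X := by
  set M := ‖Ω x₀‖ + 1 with hM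
  set M₁ := ‖fderiv ℝ Ω x₀‖ + 1 with hM₁
  have hM0 : 0 < M := by positivity
  have hM₁0 : 0 < M₁ := by positivity
  have hΩ₁ := hΩ.fderiv_infty hV
  have hnb := hV.mem_nhds hx₀
  obtain ⟨M₂, u, hu, hlip₂⟩ := ((hΩ₁.contDiffAt hnb).of_le
    (by exact_mod_cast le_top : (1 : WithTop ℕ∞) ≤ ∞)).exists_lipschitzOnWith
  have hev : ∀ᶠ x in 𝓝 x₀, x ∈ V ∧ ‖Ω x‖ < M ∧ ‖fderiv ℝ Ω x‖ < M₁ ∧ x ∈ u := by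
    refine Filter.Eventually.and hnb (Filter.Eventually.and ?_ (Filter.Eventually.and ?_ ?_))
    · exact (hΩ.continuousOn.continuousAt hnb).norm.eventually_lt_const (lt_add_one _)
    · exact (hΩ₁.continuousOn.continuousAt hnb).norm.eventually_lt_const (lt_add_one _)
    · exact hu
  obtain ⟨r₀, hr₀, hball⟩ := Metric.eventually_nhds_iff_ball.1 hev
  -- The bound 1/(2M) makes the coefficient on each ray at most 1/2, as `exists_linear_ode`
  -- requires; the bound 1 serves the estimates with ‖v + h‖ ≤ 1.
  set r := min r₀ (min 1 (1 / (2 * M))) with hr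
  have hrpos : 0 < r := by positivity
  have hr1 : r ≤ 1 := (min_le_right _ _).trans (min_le_left _ _)
  have hrM : M * r ≤ 1 / 2 := by
    have : r ≤ 1 / (2 * M) := (min_le_right _ _).trans (min_le_right _ _)
    calc M * r ≤ M * (1 / (2 * M)) := by gcongr
      _ = 1 / 2 := by field_simp
  have hsub : Metric.ball x₀ r ⊆ Metric.ball x₀ r₀ := Metric.ball_subset_ball (min_le_left _ _)
  have hBV : ∀ x ∈ Metric.ball x₀ r, x ∈ V := fun x hx => (hball x (hsub hx)).1
  have hray : ∀ v : E, ‖v‖ < r → ∀ t ∈ Set.Icc (0 : ℝ) 1, x₀ + t • v ∈ Metric.ball x₀ r := by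
    intro v hv t ht
    rw [mem_ball_iff_norm, add_sub_cancel_left, norm_smul, Real.norm_eq_abs, abs_of_nonneg ht.1]
    calc t * ‖v‖ ≤ 1 * ‖v‖ := by
          gcongr
          exact ht.2
      _ < r := by rwa [one_mul]
  have hcoef : ∀ v : E, ‖v‖ < r → ∀ t ∈ Set.Icc (0 : ℝ) 1, ‖Ω (x₀ + t • v) v‖ ≤ 1 / 2 := by
    intro v hv t ht
    refine (ContinuousLinearMap.le_opNorm _ _).trans (le_trans ?_ hrM)
    have := (hball _ (hsub (hray v hv t ht))).2.1
    gcongr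
  have hcont : ∀ v : E, ‖v‖ < r → ContinuousOn (fun t : ℝ => Ω (x₀ + t • v) v) (Set.Icc 0 1) := by
    intro v hv
    have h1 : ContinuousOn (fun t : ℝ => Ω (x₀ + t • v)) (Set.Icc 0 1) :=
      hΩ.continuousOn.comp (by fun_prop) fun t ht => hBV _ (hray v hv t ht)
    exact h1.clm_apply continuousOn_const
  have hex : ∀ v : E, ∃ Y : ℝ → A, ‖v‖ < r → Y 0 = 1 ∧ ∀ t ∈ Set.Icc (0 : ℝ) 1,
      HasDerivWithinAt Y (Y t * Ω (x₀ + t • v) v) (Set.Icc 0 1) t := by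
    intro v
    by_cases hv : ‖v‖ < r
    · obtain ⟨Y, hY⟩ := exists_linear_ode (hcont v hv) (hcoef v hv)
      exact ⟨Y, fun _ => hY⟩
    · exact ⟨0, fun h => absurd h hv⟩
  choose Y hY using hex
  -- R is the parallel transport along the segment from x₀ to x, read at time one; flatness makes it
  -- a solution in every direction.
  set R : E → A := fun x => Y (x - x₀) 1 with hR
  set K := ‖(1 : A)‖ * Real.exp 1 with hK
  have hK0 : 0 ≤ K := by positivity
  have hder : ∀ x ∈ Metric.ball x₀ r,
      HasFDerivAt R (ContinuousLinearMap.mul ℝ A (R x) ∘L Ω x) x := by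
    intro x hx
    rw [hasFDerivAt_iff_isLittleO_nhds_zero]
    refine Asymptotics.IsBigO.trans_isLittleO (g := fun h : E => ‖h‖ ^ 2) ?_
      (Asymptotics.isLittleO_norm_pow_id one_lt_two)
    refine Asymptotics.IsBigO.of_bound (K * (M₂ + M₁ + M * (M₁ + M)) * (Real.exp 1 - 1)) ?_
    have hnear : ∀ᶠ h in 𝓝 (0 : E), x + h ∈ Metric.ball x₀ r := by
      have : Filter.Tendsto (fun h : E => x + h) (𝓝 0) (𝓝 x) := by
        have : ContinuousAt (fun h : E => x + h) 0 := by fun_prop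
        simpa [ContinuousAt] using this
      exact this (Metric.isOpen_ball.mem_nhds hx)
    filter_upwards [hnear] with h hh
    set v := x - x₀ with hv
    have hvr : ‖v‖ < r := by rwa [mem_ball_iff_norm] at hx
    have hvh : x + h - x₀ = v + h := by rw [hv]; abel
    have hvhr : ‖v + h‖ < r := by rwa [mem_ball_iff_norm, hvh] at hh
    have hconv := convex_ball x₀ r
    have hpq : ∀ t : ℝ, x₀ + t • (v + h) - (x₀ + t • v) = t • h := fun t => by
      rw [smul_add]; abel
    have hth : ∀ t ∈ Set.Icc (0 : ℝ) 1, ‖t • h‖ ≤ ‖h‖ := fun t ht => by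
      rw [norm_smul, Real.norm_eq_abs, abs_of_nonneg ht.1]
      exact mul_le_of_le_one_left (norm_nonneg _) ht.2
    have hmain := norm_ray_sub_le (Ω := Ω) (x₀ := x₀) (v := v) (h := h) hM0.le hM₁0.le M₂.coe_nonneg hK0
      (fun t ht => hΩ.differentiableAt_of_isOpen hV (hBV _ (hray v hvr t ht)))
      (fun t ht => hflat _ (hBV _ (hray v hvr t ht)) v h)
      (hY v hvr).1 (hY (v + h) hvhr).1 (hY v hvr).2 (hY (v + h) hvhr).2
      (fun t ht => norm_le_of_linear_ode (hY v hvr).1 (hY v hvr).2 (hcoef v hvr) ht)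
      (hvhr.le.trans hr1)
      (fun t ht => (hball _ (hsub (hray v hvr t ht))).2.1.le)
      (fun t ht => (hcoef (v + h) hvhr t ht).trans (by norm_num))
      (fun t ht => (hball _ (hsub (hray v hvr t ht))).2.2.1.le)
      (fun t ht => by
        have := hconv.norm_image_sub_le_of_norm_fderiv_le
          (fun z hz => hΩ.differentiableAt_of_isOpen hV (hBV z hz))
          (fun z hz => (hball z (hsub hz)).2.2.1.le) (hray v hvr t ht) (hray (v + h) hvhr t ht)
        rw [hpq] at this
        refine this.trans ?_
        gcongr
        exact hth t ht)
      -- Second-order Taylor estimate: dΩ is Lipschitz with constant M₂, and the mean value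
      -- inequality is applied inside the ball about p of radius ‖t • h‖.
      (fun t ht => by
        set p := x₀ + t • v with hp
        set q := x₀ + t • (v + h) with hq
        have hpb : p ∈ Metric.ball x₀ r := hray v hvr t ht
        have hs : Convex ℝ (Metric.ball x₀ r ∩ Metric.closedBall p ‖t • h‖) :=
          hconv.inter (convex_closedBall _ _)
        have := hs.norm_image_sub_le_of_norm_fderiv_le' (φ := fderiv ℝ Ω p) (C := M₂ * ‖t • h‖)
          (fun z hz => hΩ.differentiableAt_of_isOpen hV (hBV z hz.1))
          (fun z hz => by
            have := hlip₂.dist_le_mul z (hball z (hsub hz.1)).2.2.2 p (hball p (hsub hpb)).2.2.2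
            rw [← dist_eq_norm]
            refine this.trans ?_
            gcongr
            exact hz.2)
          ⟨hpb, Metric.mem_closedBall_self (norm_nonneg _)⟩
          ⟨hray (v + h) hvhr t ht, by rw [mem_closedBall_iff_norm, hpq]⟩
        rw [hpq] at this
        refine this.trans ?_
        calc M₂ * ‖t • h‖ * ‖t • h‖ ≤ M₂ * ‖h‖ * ‖h‖ := by
              gcongr <;> exact hth t ht
          _ = M₂ * ‖h‖ ^ 2 := by ring)
    have hxv : x₀ + v = x := by rw [hv]; abel
    rw [hxv] at hmain
    simp only [hR, hvh, ContinuousLinearMap.comp_apply, ContinuousLinearMap.mul_apply', ← hv]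
    rw [Real.norm_of_nonneg (by positivity)]
    exact hmain
  have hsol := contDiffOn_of_hasFDerivAt_mul Metric.isOpen_ball (hΩ.mono hBV) hder
  refine ⟨r, hrpos, hBV, R, hsol, ?_, fun x hx X => ?_⟩
  · have h0 : ‖(0 : E)‖ < r := by rwa [norm_zero]
    have := constant_of_has_deriv_right_zero
      (fun t ht => ((hY 0 h0).2 t ht).continuousWithinAt)
      (fun t ht => by
        have := ((hY 0 h0).2 t (Set.Ico_subset_Icc_self ht)).mono_of_mem_nhdsWithin
          (Icc_mem_nhdsGE_of_mem ht)
        simpa using this) 1 (by simp)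
    rw [hR]
    simp only [sub_self]
    rw [this, (hY 0 h0).1]
  · rw [(hder x hx).fderiv]
    rfl

end Frobenius

end Bonnet

end


/-! ### Deformations of a hypersurface from solutions of Gauss and Codazzi -/

open scoped ContDiff Topology

noncomputable section

namespace Bonnet

section Wedge

variable {E G : Type*} [NormedAddCommGroup E] [InnerProductSpace ℝ E] [NormedAddCommGroup G]
  [NormedSpace ℝ G]

/-- The skew-symmetric operator `v ↦ ⟨b, v⟩ a - ⟨a, v⟩ b`. -/
def wedge (a b : E) : E →L[ℝ] E := (innerSL ℝ b).smulRight a - (innerSL ℝ a).smulRight b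

theorem wedge_apply (a b v : E) : wedge a b v = (inner ℝ b v : ℝ) • a - (inner ℝ a v : ℝ) • b := rfl

theorem inner_wedge (a b v w : E) : inner ℝ (wedge a b v) w = -inner ℝ v (wedge a b w) := by
  simp only [wedge_apply, inner_sub_left, inner_sub_right, real_inner_smul_left,
    real_inner_smul_right, real_inner_comm v]
  ring

/-- The form `X ↦ z X ∧ b`. -/
def wedgeForm (z : G →L[ℝ] E) (b : E) : G →L[ℝ] E →L[ℝ] E :=
  ContinuousLinearMap.smulRightL ℝ E E (innerSL ℝ b) ∘L z
    - (ContinuousLinearMap.smulRightL ℝ E E).flip b ∘L (innerSL ℝ : E →L[ℝ] E →L[ℝ] ℝ) ∘L z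

theorem wedgeForm_apply (z : G →L[ℝ] E) (b : E) (X : G) : wedgeForm z b X = wedge (z X) b := rfl

theorem _root_.ContDiffOn.wedgeForm {z : G → G →L[ℝ] E} {N : G → E} {V : Set G}
    (hz : ContDiffOn ℝ ∞ z V) (hN : ContDiffOn ℝ ∞ N V) :
    ContDiffOn ℝ ∞ (fun x => wedgeForm (z x) (N x)) V := by
  have h1 : ContDiffOn ℝ ∞
      (fun x => ContinuousLinearMap.smulRightL ℝ E E (innerSL ℝ (N x))) V :=
    contDiffOn_const.clm_apply ((innerSL ℝ : E →L[ℝ] E →L[ℝ] ℝ).contDiff.comp_contDiffOn hN)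
  have h2 : ContDiffOn ℝ ∞ (fun x => (ContinuousLinearMap.smulRightL ℝ E E).flip (N x)) V :=
    contDiffOn_const.clm_apply hN
  exact (h1.clm_comp hz).sub (h2.clm_comp (contDiffOn_const.clm_comp hz))

theorem fderiv_wedge_apply {a b : G → E} {x : G} (ha : DifferentiableAt ℝ a x)
    (hb : DifferentiableAt ℝ b x) (X : G) :
    fderiv ℝ (fun y => wedge (a y) (b y)) x X
      = wedge (fderiv ℝ a x X) (b x) + wedge (a x) (fderiv ℝ b x X) := by
  have h1 : ∀ {a b : G → E}, DifferentiableAt ℝ a x → DifferentiableAt ℝ b x →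
      HasFDerivAt (fun y => (innerSL ℝ (b y)).smulRight (a y))
        ((ContinuousLinearMap.smulRightL ℝ E E (innerSL ℝ (b x))) ∘L fderiv ℝ a x
          + (ContinuousLinearMap.smulRightL ℝ E E).flip (a x) ∘L
            (innerSL ℝ : E →L[ℝ] E →L[ℝ] ℝ) ∘L fderiv ℝ b x) x := by
    intro a b ha hb
    exact (ContinuousLinearMap.smulRightL ℝ E E).hasFDerivAt_of_bilinear
      ((innerSL ℝ : E →L[ℝ] E →L[ℝ] ℝ).hasFDerivAt.comp x hb.hasFDerivAt) ha.hasFDerivAt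
  have h2 : HasFDerivAt (fun y => wedge (a y) (b y)) _ x := (h1 ha hb).sub (h1 hb ha)
  rw [h2.fderiv]
  ext1 v
  change (inner ℝ (b x) v : ℝ) • fderiv ℝ a x X + (inner ℝ (fderiv ℝ b x X) v : ℝ) • a x
    - ((inner ℝ (a x) v : ℝ) • fderiv ℝ b x X + (inner ℝ (fderiv ℝ a x X) v : ℝ) • b x) = _
  rw [add_apply, wedge_apply, wedge_apply]
  module

/-- Skew-symmetric connections preserve the inner product. -/
theorem inner_apply_of_fderiv_eq_mul {n k : ℕ} {B : Set (Euc n)} (hB : IsOpen B)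
    (hconn : IsPreconnected B)
    {R : Euc n → Euc k →L[ℝ] Euc k} {Ω : Euc n → Euc n →L[ℝ] Euc k →L[ℝ] Euc k}
    (hR : ContDiffOn ℝ ∞ R B) {x₀ : Euc n} (hx₀ : x₀ ∈ B) (h1 : R x₀ = 1)
    (hdR : ∀ x ∈ B, ∀ X, fderiv ℝ R x X = R x * Ω x X)
    (hΩ : ∀ x ∈ B, ∀ X v w, inner ℝ (Ω x X v) w = -inner ℝ v (Ω x X w))
    {x : Euc n} (hx : x ∈ B) (v w : Euc k) : inner ℝ (R x v) (R x w) = inner ℝ v w := by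
  let e := EuclideanSpace.basisFun (Fin k) ℝ
  -- Expansion in a basis allows R Rᵀ to be differentiated without differentiating the adjoint.
  have hsum : ∀ (L M : Euc k →L[ℝ] Euc k) (u w : Euc k),
      ∑ a, inner ℝ u (L (e a)) * inner ℝ w (M (e a))
        = inner ℝ (L.adjoint u) (M.adjoint w) := by
    intro L M u w
    rw [← e.sum_inner_mul_inner]
    refine Finset.sum_congr rfl fun a _ => ?_
    rw [L.adjoint_inner_left, M.adjoint_inner_right, real_inner_comm w]
  -- For dR = RΩ with skew Ω it is R Rᵀ whose derivative R(Ω + Ωᵀ)Rᵀ vanishes. The identity for RᵀR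
  -- then follows since one-sided inverses are two-sided in finite dimension.
  have hconst : ∀ u w : Euc k, inner ℝ ((R x).adjoint u) ((R x).adjoint w) = inner ℝ u w := by
    intro u w
    have hd : ∀ y ∈ B, HasFDerivAt (fun y => ∑ a, inner ℝ u (R y (e a)) * inner ℝ w (R y (e a)))
        (0 : Euc n →L[ℝ] ℝ) y := by
      intro y hy
      have dR := hR.differentiableAt_of_isOpen hB hy
      have dRe := fun a => dR.clm_apply (differentiableAt_const (e a))
      have du := fun (u : Euc k) a => (differentiableAt_const u).inner ℝ (dRe a)
      have hdiff : DifferentiableAt ℝ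
          (fun y => ∑ a, inner ℝ u (R y (e a)) * inner ℝ w (R y (e a))) y :=
        DifferentiableAt.fun_sum fun a _ => (du u a).fun_mul (du w a)
      convert hdiff.hasFDerivAt using 1
      ext1 X
      have hinner : ∀ (u : Euc k) a, fderiv ℝ (fun y => inner ℝ u (R y (e a))) y X
          = inner ℝ u ((R y * Ω y X) (e a)) := by
        intro u a
        rw [fderiv_inner_apply ℝ (differentiableAt_const u) (dRe a), fderiv_clm_apply_const dR,
          hdR y hy]
        simp
      rw [fderiv_fun_sum fun a _ => (du u a).fun_mul (du w a)]
      simp only [sum_apply, fderiv_fun_mul (du u _) (du w _), add_apply, smul_apply, hinner,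
        smul_eq_mul, zero_apply]
      rw [Finset.sum_add_distrib, hsum]
      simp only [mul_comm (inner ℝ w (R y _))]
      rw [hsum]
      have hadj : ∀ u, (R y * Ω y X).adjoint u = -Ω y X ((R y).adjoint u) := by
        intro u
        refine ext_inner_right ℝ fun v => ?_
        rw [ContinuousLinearMap.adjoint_inner_left, inner_neg_left, hΩ y hy, neg_neg,
          ContinuousLinearMap.adjoint_inner_left]
        rfl
      rw [hadj, hadj, inner_neg_left, inner_neg_right, hΩ y hy]
      ring
    have := hB.is_const_of_fderiv_eq_zero hconn
      (fun y hy => (hd y hy).differentiableAt.differentiableWithinAt)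
      (fun y hy => (hd y hy).fderiv) hx hx₀
    rw [hsum, hsum, h1] at this
    rw [this]
    simp only [← hsum, one_apply_eq_self]
    rw [← e.sum_inner_mul_inner u w]
    simp only [real_inner_comm w]
  have h2 : R x * (R x).adjoint = 1 := by
    ext1 w
    refine ext_inner_left ℝ fun u => ?_
    rw [mul_apply_eq_comp, ← ContinuousLinearMap.adjoint_inner_left, hconst]
    rfl
  have h3 : (R x).adjoint * R x = 1 := by
    have : (R x).toLinearMap * ((R x).adjoint).toLinearMap = 1 := by
      ext1 v; exact congrArg (fun L => L v) h2
    rw [mul_eq_one_comm] at this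
    ext1 v
    exact congrArg (fun L => L v) this
  rw [← ContinuousLinearMap.adjoint_inner_left]
  exact congrArg (fun L => inner ℝ (L v) w) h3

end Wedge

section Deformation

variable {n : ℕ} {F N : Euc n → Euc (n + 1)} {V : Set (Euc n)}
  {z : Euc n → Euc n →L[ℝ] Euc (n + 1)}

theorem IsHypersurface.contDiffOn_wedgeForm (hF : IsHypersurface F N V)
    (hz : ContDiffOn ℝ ∞ z V) : ContDiffOn ℝ ∞ (fun x => wedgeForm (z x) (N x)) V :=
  hz.wedgeForm hF.smooth_normal

theorem IsHypersurface.fderiv_wedgeForm (hF : IsHypersurface F N V)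
    (hz : ContDiffOn ℝ ∞ z V) {x : Euc n} (hx : x ∈ V) (X Y : Euc n) :
    fderiv ℝ (fun x => wedgeForm (z x) (N x)) x X Y
      = wedge (fderiv ℝ z x X Y) (N x) + wedge (z x Y) (fderiv ℝ N x X) := by
  have dz := hz.differentiableAt_of_isOpen hF.isOpen hx
  rw [← fderiv_clm_apply_const ((hF.contDiffOn_wedgeForm hz).differentiableAt_of_isOpen
    hF.isOpen hx)]
  simp only [wedgeForm_apply]
  rw [fderiv_wedge_apply (dz.clm_apply (differentiableAt_const Y)) (hF.differentiableAt_normal hx),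
    fderiv_clm_apply_const dz]

/-- The equations of Gauss and Codazzi make the connection flat. -/
theorem IsHypersurface.wedgeForm_flat (hF : IsHypersurface F N V)
    (hz : ContDiffOn ℝ ∞ z V) {x : Euc n} (hx : x ∈ V)
    (hzN : ∀ X, inner ℝ (z x X) (N x) = 0)
    (hcodazzi : ∀ X Y Z, inner ℝ (fderiv ℝ z x X Y) (fderiv ℝ F x Z)
      = inner ℝ (fderiv ℝ z x Y X) (fderiv ℝ F x Z))
    (hgauss : ∀ X Y, wedge (z x Y) (fderiv ℝ N x X)
      = wedge (z x X) (fderiv ℝ N x Y) + wedge (z x X) (z x Y)) (X Y : Euc n) :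
    fderiv ℝ (fun x => wedgeForm (z x) (N x)) x X Y + wedgeForm (z x) (N x) X * wedgeForm (z x) (N x) Y
      = fderiv ℝ (fun x => wedgeForm (z x) (N x)) x Y X + wedgeForm (z x) (N x) Y * wedgeForm (z x) (N x) X := by
  have hNN := hF.inner_normal_self hx
  have hNz : ∀ X, inner ℝ (N x) (z x X) = 0 := fun X => by rw [real_inner_comm, hzN]
  have hNT : ∀ X, inner ℝ (N x) (fderiv ℝ F x X) = 0 := fun X => by
    rw [real_inner_comm, hF.normal_orthogonal x hx]
  -- By Codazzi the antisymmetric part of dz is a multiple of N, and the wedge product with N kills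
  -- it.
  have hc : wedge (fderiv ℝ z x X Y) (N x) = wedge (fderiv ℝ z x Y X) (N x) := by
    set a := fderiv ℝ z x X Y - fderiv ℝ z x Y X with ha
    have h1 : a = (inner ℝ a (N x) : ℝ) • N x := by
      refine hF.eq_of_inner_eq hx (fun Z => ?_) ?_
      · rw [real_inner_smul_left, hNT, ha, inner_sub_left, hcodazzi X Y Z, sub_self, mul_zero]
      · rw [real_inner_smul_left, hNN, mul_one]
    have h2 : fderiv ℝ z x X Y = fderiv ℝ z x Y X + (inner ℝ a (N x) : ℝ) • N x := by
      rw [← h1, ha]; abel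
    ext1 v
    rw [h2, wedge_apply, wedge_apply, inner_add_left, real_inner_smul_left]
    module
  have hprod : ∀ X Y v, (wedgeForm (z x) (N x) X * wedgeForm (z x) (N x) Y) v
      = -(inner ℝ (z x Y) v : ℝ) • z x X
        - ((inner ℝ (N x) v : ℝ) * inner ℝ (z x X) (z x Y)) • N x := by
    intro X Y v
    simp only [mul_apply_eq_comp, wedgeForm_apply, wedge_apply, inner_sub_right,
      real_inner_smul_right, hNz, hNN, hzN]
    module
  rw [hF.fderiv_wedgeForm hz hx, hF.fderiv_wedgeForm hz hx, hc, hgauss X Y]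
  ext1 v
  simp only [add_apply, hprod, real_inner_comm (z x X) (z x Y)]
  rw [wedge_apply (z x X) (z x Y)]
  module

/-- The existence part of the fundamental theorem of hypersurfaces, in the form of a deformation:
a tangential perturbation `z` of the differential of the normal that is compatible with the
equations of Gauss and Codazzi comes from an isometric hypersurface. -/
theorem IsHypersurface.exists_deformation (hF : IsHypersurface F N V) (hz : ContDiffOn ℝ ∞ z V)
    (hzN : ∀ x ∈ V, ∀ X, inner ℝ (z x X) (N x) = 0)
    (hsymm : ∀ x ∈ V, ∀ X Y, inner ℝ (z x X) (fderiv ℝ F x Y) = inner ℝ (z x Y) (fderiv ℝ F x X))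
    (hcodazzi : ∀ x ∈ V, ∀ X Y Z, inner ℝ (fderiv ℝ z x X Y) (fderiv ℝ F x Z)
      = inner ℝ (fderiv ℝ z x Y X) (fderiv ℝ F x Z))
    (hgauss : ∀ x ∈ V, ∀ X Y, wedge (z x Y) (fderiv ℝ N x X)
      = wedge (z x X) (fderiv ℝ N x Y) + wedge (z x X) (z x Y))
    {x₀ : Euc n} (hx₀ : x₀ ∈ V) :
    ∃ r > 0, Metric.ball x₀ r ⊆ V ∧ ∃ (F' N' : Euc n → Euc (n + 1))
      (R : Euc n → Euc (n + 1) →L[ℝ] Euc (n + 1)),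
      IsometricPair F N F' N' (Metric.ball x₀ r) ∧
      (∀ x ∈ Metric.ball x₀ r, ∀ v w, inner ℝ (R x v) (R x w) = inner ℝ v w) ∧
      (∀ x ∈ Metric.ball x₀ r, ∀ X, fderiv ℝ F' x X = R x (fderiv ℝ F x X)) ∧
      ∀ x ∈ Metric.ball x₀ r, ∀ X, fderiv ℝ N' x X = R x (fderiv ℝ N x X + z x X) := by
  have hV := hF.isOpen
  have hNT : ∀ x ∈ V, ∀ X, inner ℝ (N x) (fderiv ℝ F x X) = 0 := fun x hx X => by
    rw [real_inner_comm, hF.normal_orthogonal x hx]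
  -- The form Ω X = z X ∧ N sends N to z X, so d(RN) = R(dN + z), and sends dF Y to a multiple of N,
  -- so the new immersion keeps the Christoffel symbols.
  obtain ⟨r, hr, hball, R, hRs, hR1, hdR⟩ := exists_fderiv_eq_mul hV
    (hF.contDiffOn_wedgeForm hz) hx₀ fun x hx => hF.wedgeForm_flat hz hx (hzN x hx)
      (hcodazzi x hx) (hgauss x hx)
  set B := Metric.ball x₀ r with hBdef
  have hB : IsOpen B := Metric.isOpen_ball
  have hconv : Convex ℝ B := convex_ball _ _
  have hx₀B : x₀ ∈ B := Metric.mem_ball_self hr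
  have hRR : ∀ x ∈ B, ∀ v w, inner ℝ (R x v) (R x w) = inner ℝ v w := fun x hx v w =>
    inner_apply_of_fderiv_eq_mul hB hconv.isPreconnected hRs hx₀B hR1 hdR
      (fun y _ X v w => inner_wedge _ _ v w) hx v w
  have hTs := (hF.smooth.mono hball).fderiv_infty hB
  have hηs : ContDiffOn ℝ ∞ (fun x => R x ∘L fderiv ℝ F x) B := hRs.clm_comp hTs
  -- The form R dF is closed because its derivative contains z only through ⟨z X, dF Y⟩, which is
  -- symmetric; on a ball it is therefore a differential.
  obtain ⟨F', hF'⟩ := hconv.exists_forall_hasFDerivAt_of_fderiv_symmetric hB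
    (show DifferentiableOn ℝ (fun x => R x ∘L fderiv ℝ F x) B from fun x hx =>
      (hηs.differentiableAt_of_isOpen hB hx).differentiableWithinAt) (by
    intro x hx X Y
    have dη := hηs.differentiableAt_of_isOpen hB hx
    have dR := hRs.differentiableAt_of_isOpen hB hx
    have dT := hF.differentiableAt_fderiv (hball hx)
    have hexp : ∀ X Y, fderiv ℝ (fun x => R x ∘L fderiv ℝ F x) x X Y
        = R x (fderiv ℝ (fderiv ℝ F) x X Y - (inner ℝ (z x X) (fderiv ℝ F x Y) : ℝ) • N x) := by
      intro X Y
      rw [← fderiv_clm_apply_const dη]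
      simp only [ContinuousLinearMap.comp_apply]
      rw [fderiv_clm_apply_apply dR (dT.clm_apply (differentiableAt_const Y)),
        fderiv_clm_apply_const dT, hdR x hx, mul_apply_eq_comp, ← map_add, wedgeForm_apply,
        wedge_apply, hNT x (hball hx), zero_smul, zero_sub, neg_add_eq_sub]
    rw [hexp, hexp, hF.smooth.fderiv_fderiv_comm hV (hball hx) X Y, hsymm x (hball hx) X Y])
  have hdF' : ∀ x ∈ B, ∀ X, fderiv ℝ F' x X = R x (fderiv ℝ F x X) := fun x hx X => by
    rw [(hF' x hx).fderiv]; rfl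
  have hF's : ContDiffOn ℝ ∞ F' B := (contDiffOn_infty_iff_fderiv_of_isOpen hB).2
    ⟨fun x hx => (hF' x hx).differentiableAt.differentiableWithinAt,
      hηs.congr fun x hx => (hF' x hx).fderiv⟩
  have hinj : ∀ x ∈ B, Function.Injective (R x) := fun x hx => by
    rw [injective_iff_map_eq_zero]
    intro v hv
    have := hRR x hx v v
    rwa [hv, inner_zero_left, eq_comm, inner_self_eq_zero] at this
  refine ⟨r, hr, hball, F', fun x => R x (N x), R, ⟨hF.mono hB hball, ⟨hB, hF's, ?_, ?_, ?_, ?_⟩, ?_⟩,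
    hRR, hdF', ?_⟩
  · intro x hx X Y hXY
    rw [hdF' x hx, hdF' x hx] at hXY
    exact hF.immersion x (hball hx) (hinj x hx hXY)
  · exact hRs.clm_apply (hF.smooth_normal.mono hball)
  · intro x hx
    have := hRR x hx (N x) (N x)
    rw [hF.inner_normal_self (hball hx), real_inner_self_eq_norm_sq] at this
    exact (pow_eq_one_iff_of_nonneg (norm_nonneg _) two_ne_zero).1 this
  · intro x hx v
    rw [hdF' x hx, hRR x hx, hF.normal_orthogonal x (hball hx)]
  · intro x hx X Y
    rw [hdF' x hx, hdF' x hx, hRR x hx]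
  · intro x hx X
    rw [fderiv_clm_apply_apply (hRs.differentiableAt_of_isOpen hB hx)
      (hF.differentiableAt_normal (hball hx)), hdR x hx, mul_apply_eq_comp, wedgeForm_apply,
      wedge_apply, hF.inner_normal_self (hball hx), hzN x (hball hx), one_smul, zero_smul, sub_zero, map_add]
    exact add_comm _ _

end Deformation

end Bonnet

end


/-! ### The shift that reverses b₁₂ satisfies Gauss and Codazzi -/

open scoped ContDiff Topology

noncomputable section

namespace Bonnet

theorem linearMap_symm_of_coordVec {n : ℕ} {G : Type*} [AddCommGroup G] [Module ℝ G]
    (f : Euc n →ₗ[ℝ] Euc n →ₗ[ℝ] G)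
    (h : ∀ A B, f (coordVec A) (coordVec B) = f (coordVec B) (coordVec A)) (X Y : Euc n) :
    f X Y = f Y X := by
  have : f = f.flip := by
    refine LinearMap.ext_basis (stdBasis n) (stdBasis n) fun A B => ?_
    simpa [coordVec] using h A B
  exact LinearMap.congr_fun₂ this X Y

/-- A symmetric relation between the indices of a net. -/
theorem forall_fin_add_two_of_symm {m : ℕ} {P : Fin (m + 2) → Fin (m + 2) → Prop}
    (hsymm : ∀ A B, P A B → P B A) (hrefl : ∀ A, P A A) (h01 : P 0 1)
    (hp : ∀ A, ∀ p : Fin m, P A p.succ.succ) (A B : Fin (m + 2)) : P A B := by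
  revert B
  refine forall_fin_add_two (P := fun A => ∀ B, P A B) ?_ ?_ (fun p B => hsymm _ _ (hp B p)) A
  · exact forall_fin_add_two (hrefl 0) h01 (hp 0)
  · exact forall_fin_add_two (hsymm _ _ h01) (hrefl 1) (hp 1)

theorem IsWeight.fderiv_eq_zero {m : ℕ} {ρ : Euc (m + 2) → ℝ} (h : IsWeight ρ) (y : Euc (m + 2))
    {i : Fin (m + 2)} (hi : i = 0 ∨ i = 1) : fderiv ℝ ρ y (coordVec i) = 0 := by
  rcases h with ⟨C, -, h⟩ | h
  · have hd : HasFDerivAt ρ (∑ q : Fin m, C q •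
        (EuclideanSpace.proj (q.succ.succ : Fin (m + 2)) : Euc (m + 2) →L[ℝ] ℝ)) y := by
      rw [funext h]
      exact HasFDerivAt.fun_sum fun q _ =>
        (EuclideanSpace.proj (q.succ.succ : Fin (m + 2)) : Euc (m + 2) →L[ℝ] ℝ).hasFDerivAt.const_mul
          (C q)
    have hne : ∀ q : Fin m, q.succ.succ ≠ i := by
      intro q
      rcases hi with rfl | rfl
      · exact Fin.succ_ne_zero _
      · exact fun h => Fin.succ_ne_zero q (Fin.succ_injective _ h)
    rw [hd.fderiv]
    simp [coordVec, hne]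
  · rw [funext h]
    simp

/-- The infinitesimal rotation of the normal that changes the sign of `b₁₂` in a net. -/
def netShift {m : ℕ} (F : Euc (m + 2) → Euc (m + 2 + 1)) (ρ : Euc (m + 2) → ℝ) (s : ℝ)
    (y : Euc (m + 2)) : Euc (m + 2) →L[ℝ] Euc (m + 2 + 1) :=
  (2 * s * ρ y / firstForm F y 0 0) •
    ((EuclideanSpace.proj 0 : Euc (m + 2) →L[ℝ] ℝ).smulRight (fderiv ℝ F y (coordVec 1))
      + (EuclideanSpace.proj 1 : Euc (m + 2) →L[ℝ] ℝ).smulRight (fderiv ℝ F y (coordVec 0)))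

section NetShift

variable {m : ℕ} {F : Euc (m + 2) → Euc (m + 2 + 1)} {ρ : Euc (m + 2) → ℝ} {s : ℝ}
  {y : Euc (m + 2)}

theorem netShift_zero : netShift F ρ s y (coordVec 0)
    = (2 * s * ρ y / firstForm F y 0 0) • fderiv ℝ F y (coordVec 1) := by
  simp [netShift, coordVec]

theorem netShift_one : netShift F ρ s y (coordVec 1)
    = (2 * s * ρ y / firstForm F y 0 0) • fderiv ℝ F y (coordVec 0) := by
  simp [netShift, coordVec]

theorem netShift_succ_succ (p : Fin m) : netShift F ρ s y (coordVec p.succ.succ) = 0 := by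
  have h1 : (1 : Fin (m + 2)) ≠ p.succ.succ :=
    fun h => Fin.succ_ne_zero p (Fin.succ_injective _ h.symm)
  have h0 : (0 : Fin (m + 2)) ≠ p.succ.succ := (Fin.succ_ne_zero _).symm
  simp [netShift, coordVec, h0, h1]

end NetShift

namespace NetForm

variable {m : ℕ} {F N : Euc (m + 2) → Euc (m + 2 + 1)} {ρ : Euc (m + 2) → ℝ} {s : ℝ}
  {V : Set (Euc (m + 2))} {y : Euc (m + 2)}

theorem inner_of_ne (h : NetForm F N ρ s V) (hy : y ∈ V) {A B : Fin (m + 2)} (hAB : A ≠ B) :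
    inner ℝ (fderiv ℝ F y (coordVec A)) (fderiv ℝ F y (coordVec B)) = 0 :=
  h.orthogonal y hy A B hAB

theorem fderiv_firstForm_self (h : NetForm F N ρ s V) (hy : y ∈ V) {i : Fin (m + 2)}
    (hi : i = 0 ∨ i = 1) (X : Euc (m + 2)) :
    inner ℝ (fderiv ℝ (fderiv ℝ F) y X (coordVec i)) (fderiv ℝ F y (coordVec i))
      = fderiv ℝ (fun z => firstForm F z 0 0) y X / 2 := by
  have h1 := h.fderiv_firstForm hy X i i
  have h2 : fderiv ℝ (fun z => firstForm F z i i) y = fderiv ℝ (fun z => firstForm F z 0 0) y :=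
    fderiv_eq_of_eqOn h.hyp.isOpen (fun z hz => h.inner_self hz hi) hy
  rw [h2] at h1
  linarith

theorem inner_fderiv_fderiv_self (h : NetForm F N ρ s V) (hy : y ∈ V) {i C : Fin (m + 2)}
    (hi : i = 0 ∨ i = 1) (hC : C ≠ i) :
    inner ℝ (fderiv ℝ (fderiv ℝ F) y (coordVec i) (coordVec i)) (fderiv ℝ F y (coordVec C))
      = -(fderiv ℝ (fun z => firstForm F z 0 0) y (coordVec C) / 2) := by
  have h1 := h.fderiv_firstForm hy (coordVec i) i C
  rw [fderiv_eq_of_eqOn h.hyp.isOpen (fun z hz => h.orthogonal z hz i C hC.symm) hy] at h1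
  simp only [fderiv_fun_const, Pi.zero_apply, zero_apply] at h1
  rw [← h.fderiv_firstForm_self hy hi, h.hyp.smooth.fderiv_fderiv_comm h.hyp.isOpen hy (coordVec C)]
  linarith

theorem contDiffOn_netShift (h : NetForm F N ρ s V) (hρ : IsWeight ρ) :
    ContDiffOn ℝ ∞ (netShift F ρ s) V := by
  have hT := h.hyp.smooth.fderiv_infty h.hyp.isOpen
  have h1 : ContDiffOn ℝ ∞ (fun y => 2 * s * ρ y / firstForm F y 0 0) V :=
    (contDiffOn_const.mul hρ.contDiff.contDiffOn).div (h.contDiffOn_firstForm 0 0)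
      fun y hy => (h.firstForm_pos hy).ne'
  exact h1.smul ((contDiffOn_const.smulRight (hT.clm_apply contDiffOn_const)).add
    (contDiffOn_const.smulRight (hT.clm_apply contDiffOn_const)))

theorem inner_netShift_normal (h : NetForm F N ρ s V) (hy : y ∈ V) (X : Euc (m + 2)) :
    inner ℝ (netShift F ρ s y X) (N y) = 0 := by
  simp [netShift, real_inner_smul_left, inner_add_left, h.hyp.normal_orthogonal y hy]

theorem inner_netShift_comm (h : NetForm F N ρ s V) (hy : y ∈ V) (X Y : Euc (m + 2)) :
    inner ℝ (netShift F ρ s y X) (fderiv ℝ F y Y) = inner ℝ (netShift F ρ s y Y) (fderiv ℝ F y X) := by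
  refine linearMap_symm_of_coordVec ((innerₗ (Euc (m + 2 + 1))).compl₁₂
    (netShift F ρ s y).toLinearMap (fderiv ℝ F y).toLinearMap) (fun A B => ?_) X Y
  simp only [LinearMap.compl₁₂_apply, ContinuousLinearMap.coe_coe, innerₗ_apply_apply]
  refine forall_fin_add_two_of_symm (P := fun A B =>
    inner ℝ (netShift F ρ s y (coordVec A)) (fderiv ℝ F y (coordVec B))
      = inner ℝ (netShift F ρ s y (coordVec B)) (fderiv ℝ F y (coordVec A)))
    (fun _ _ h => h.symm) (fun _ => rfl) ?_ (fun A p => ?_) A B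
  · rw [netShift_zero, netShift_one, real_inner_smul_left, real_inner_smul_left,
      h.inner_self hy (Or.inl rfl), h.inner_self hy (Or.inr rfl)]
  · rw [netShift_succ_succ, inner_zero_left]
    refine forall_fin_add_two (P := fun A => inner ℝ (netShift F ρ s y (coordVec A))
      (fderiv ℝ F y (coordVec p.succ.succ)) = 0) ?_ ?_ (fun q => ?_) A
    · rw [netShift_zero, real_inner_smul_left, h.inner_of_ne hy, mul_zero]
      exact fun h => Fin.succ_ne_zero p (Fin.succ_injective _ h.symm)
    · rw [netShift_one, real_inner_smul_left, h.inner_of_ne hy, mul_zero]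
      exact (Fin.succ_ne_zero _).symm
    · rw [netShift_succ_succ, inner_zero_left]

/-- The Codazzi equation for the shift. -/
theorem inner_fderiv_netShift_comm (h : NetForm F N ρ s V) (hs : s ≠ 0) (hρ : IsWeight ρ)
    (hy : y ∈ V) (X Y Z : Euc (m + 2)) :
    inner ℝ (fderiv ℝ (netShift F ρ s) y X Y) (fderiv ℝ F y Z)
      = inner ℝ (fderiv ℝ (netShift F ρ s) y Y X) (fderiv ℝ F y Z) := by
  have hV := h.hyp.isOpen
  have dz := (h.contDiffOn_netShift hρ).differentiableAt_of_isOpen hV hy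
  have dT := h.hyp.differentiableAt_fderiv hy
  have dE := (h.contDiffOn_firstForm 0 0).differentiableAt_of_isOpen hV hy
  have dρ : DifferentiableAt ℝ ρ y := hρ.contDiff.contDiffAt.differentiableAt (by simp)
  have hE := (h.firstForm_pos hy).ne'
  set σ : Euc (m + 2) → ℝ := fun y => 2 * s * ρ y / firstForm F y 0 0 with hσ
  have hσs : ContDiffOn ℝ ∞ σ V := (contDiffOn_const.mul hρ.contDiff.contDiffOn).div
    (h.contDiffOn_firstForm 0 0) fun y hy => (h.firstForm_pos hy).ne'
  have dσ : DifferentiableAt ℝ σ y := hσs.differentiableAt_of_isOpen hV hy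
  set E' := fderiv ℝ (fun z => firstForm F z 0 0) y with hE'
  have hσ' : ∀ X, fderiv ℝ σ y X * firstForm F y 0 0 + σ y * E' X = 2 * s * fderiv ℝ ρ y X := by
    intro X
    have h1 : fderiv ℝ (fun z => σ z * firstForm F z 0 0) y = fderiv ℝ (fun z => 2 * s * ρ z) y :=
      fderiv_eq_of_eqOn hV (fun z hz => div_mul_cancel₀ _ (h.firstForm_pos hz).ne') hy
    rw [fderiv_fun_mul dσ dE, fderiv_const_mul dρ] at h1
    have h2 := congrArg (fun L => L X) h1
    simp only [add_apply, smul_apply, smul_eq_mul] at h2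
    linear_combination h2
  have hd : ∀ (A B : Fin (m + 2)) (X : Euc (m + 2)),
      (∀ z, netShift F ρ s z (coordVec A) = σ z • fderiv ℝ F z (coordVec B)) →
      fderiv ℝ (netShift F ρ s) y X (coordVec A) = fderiv ℝ σ y X • fderiv ℝ F y (coordVec B)
        + σ y • fderiv ℝ (fderiv ℝ F) y X (coordVec B) := by
    intro A B X hAB
    rw [← fderiv_clm_apply_const dz, funext hAB,
      fderiv_fun_smul dσ (dT.clm_apply (differentiableAt_const _))]
    simp only [add_apply, smul_apply, ContinuousLinearMap.smulRight_apply,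
      fderiv_clm_apply_const dT]
    exact add_comm _ _
  have hd0 := fun X => hd 0 1 X fun z => netShift_zero
  have hd1 := fun X => hd 1 0 X fun z => netShift_one
  have hdp : ∀ (p : Fin m) X, fderiv ℝ (netShift F ρ s) y X (coordVec p.succ.succ) = 0 := by
    intro p X
    rw [← fderiv_clm_apply_const dz, funext fun z => netShift_succ_succ (F := F) (ρ := ρ) (s := s) p]
    simp
  -- In the null directions σ = 2sρ/g₁₁ scales like the inverse of √g₁₁ and the coordinate vector
  -- like √g₁₁, so the product σ ∂_iF is constant.
  have hvec : ∀ (p : Fin m) {i : Fin (m + 2)} (_ : i = 0 ∨ i = 1),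
      fderiv ℝ σ y (coordVec p.succ.succ) • fderiv ℝ F y (coordVec i)
        + σ y • fderiv ℝ (fderiv ℝ F) y (coordVec p.succ.succ) (coordVec i) = 0 := by
    intro p i hi
    rw [h.fderiv_fderiv_null hy hi, smul_smul, ← add_smul]
    have h1 := hσ' (coordVec p.succ.succ)
    rw [h.fderiv_weight hy hs hρ] at h1
    have h2 : 2 * s * ρ y = σ y * firstForm F y 0 0 := (div_mul_cancel₀ _ hE).symm
    have h3 : fderiv ℝ σ y (coordVec p.succ.succ)
        + σ y * (E' (coordVec p.succ.succ) / (2 * firstForm F y 0 0)) = 0 := by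
      refine mul_right_cancel₀ hE ?_
      rw [zero_mul]
      calc _ = fderiv ℝ σ y (coordVec p.succ.succ) * firstForm F y 0 0
            + σ y * E' (coordVec p.succ.succ) - E' (coordVec p.succ.succ) / (2 * firstForm F y 0 0)
              * (σ y * firstForm F y 0 0) := by field_simp; ring
        _ = 0 := by rw [h1, ← h2]; ring
    rw [h3, zero_smul]
  refine linearMap_symm_of_coordVec (LinearMap.mk₂ ℝ (fun X Y =>
    (inner ℝ (fderiv ℝ (netShift F ρ s) y X Y) (fderiv ℝ F y Z) : ℝ))
    (fun _ _ _ => by rw [map_add, add_apply, inner_add_left])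
    (fun _ _ _ => by rw [map_smul, smul_apply, real_inner_smul_left, smul_eq_mul])
    (fun _ _ _ => by rw [map_add, inner_add_left])
    (fun _ _ _ => by rw [map_smul, real_inner_smul_left, smul_eq_mul])) (fun A B => ?_) X Y
  simp only [LinearMap.mk₂_apply]
  refine forall_fin_add_two_of_symm (P := fun A B =>
    inner ℝ (fderiv ℝ (netShift F ρ s) y (coordVec A) (coordVec B)) (fderiv ℝ F y Z)
      = inner ℝ (fderiv ℝ (netShift F ρ s) y (coordVec B) (coordVec A)) (fderiv ℝ F y Z))
    (fun _ _ h => h.symm) (fun _ => rfl) ?_ (fun A p => ?_) A B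
  -- For the pair (0, 1) the identity reduces, in isothermal parameters, to the constancy of σ g₁₁ =
  -- 2sρ along the first two coordinates.
  · set v := fderiv ℝ (netShift F ρ s) y (coordVec 0) (coordVec 1) with hv
    set w := fderiv ℝ (netShift F ρ s) y (coordVec 1) (coordVec 0) with hw
    have hz : innerSL ℝ v ∘L fderiv ℝ F y = innerSL ℝ w ∘L fderiv ℝ F y := by
      refine clm_ext_coordVec (forall_fin_add_two ?_ ?_ fun p => ?_) <;>
        simp only [ContinuousLinearMap.comp_apply, innerSL_apply_apply, hv, hw, hd0, hd1,
          inner_add_left, real_inner_smul_left]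
      · rw [h.inner_self hy (Or.inl rfl), h.fderiv_firstForm_self hy (Or.inl rfl),
          h.inner_fderiv_fderiv_self hy (Or.inr rfl) zero_ne_one, h.inner_of_ne hy one_ne_zero]
        have := hσ' (coordVec 0)
        rw [hρ.fderiv_eq_zero y (Or.inl rfl)] at this
        linear_combination this
      · rw [h.inner_self hy (Or.inr rfl), h.fderiv_firstForm_self hy (Or.inr rfl),
          h.inner_fderiv_fderiv_self hy (Or.inl rfl) one_ne_zero, h.inner_of_ne hy zero_ne_one]
        have := hσ' (coordVec 1)
        rw [hρ.fderiv_eq_zero y (Or.inr rfl)] at this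
        linear_combination -this
      · have h0 : p.succ.succ ≠ (0 : Fin (m + 2)) := Fin.succ_ne_zero _
        have h1 : p.succ.succ ≠ (1 : Fin (m + 2)) :=
          fun h => Fin.succ_ne_zero p (Fin.succ_injective _ h)
        rw [h.inner_of_ne hy h0.symm, h.inner_of_ne hy h1.symm,
          h.inner_fderiv_fderiv_self hy (Or.inl rfl) h0,
          h.inner_fderiv_fderiv_self hy (Or.inr rfl) h1]
        ring
    exact congrArg (fun L => L Z) hz
  · rw [hdp, inner_zero_left]
    refine forall_fin_add_two (P := fun A => 0 = inner ℝ (fderiv ℝ (netShift F ρ s) y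
      (coordVec p.succ.succ) (coordVec A)) (fderiv ℝ F y Z)) ?_ ?_ (fun q => ?_) A
    · rw [hd0, hvec p (Or.inr rfl), inner_zero_left]
    · rw [hd1, hvec p (Or.inl rfl), inner_zero_left]
    · rw [hdp, inner_zero_left]

/-- Adding half the shift gives the mean of the old and the new differential of the normal. There
b₁₂ cancels, so the coordinate directions are principal. -/
theorem fderiv_normal_add_netShift (h : NetForm F N ρ s V) (hy : y ∈ V) {i j : Fin (m + 2)}
    (hij : i = 0 ∧ j = 1 ∨ i = 1 ∧ j = 0) :
    fderiv ℝ N y (coordVec i) + (1 / 2 : ℝ) • netShift F ρ s y (coordVec i)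
      = -(secondForm F N y i i / firstForm F y 0 0) • fderiv ℝ F y (coordVec i) := by
  have hE := (h.firstForm_pos hy).ne'
  have hi : i = 0 ∨ i = 1 := by tauto
  have hj : j = 0 ∨ j = 1 := by tauto
  have hne : j ≠ i := by rcases hij with ⟨rfl, rfl⟩ | ⟨rfl, rfl⟩ <;> simp
  have hz : netShift F ρ s y (coordVec i)
      = (2 * s * ρ y / firstForm F y 0 0) • fderiv ℝ F y (coordVec j) := by
    rcases hij with ⟨rfl, rfl⟩ | ⟨rfl, rfl⟩
    exacts [netShift_zero, netShift_one]
  have hb : secondForm F N y i j = s * ρ y := by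
    rcases hij with ⟨rfl, rfl⟩ | ⟨rfl, rfl⟩
    · exact h.mixed y hy
    · rw [h.secondForm_comm hy, h.mixed y hy]
  have hN : ∀ A, inner ℝ (fderiv ℝ N y (coordVec i)) (fderiv ℝ F y (coordVec A))
      = -secondForm F N y i A := fun A => by
    rw [h.secondForm_eq hy, neg_neg, real_inner_comm]
  rw [hz]
  refine h.hyp.eq_of_inner_coordVec hy (fun A => ?_) ?_
  · simp only [inner_add_left, real_inner_smul_left, hN]
    by_cases hAi : A = i
    · subst hAi
      rw [h.inner_self hy hi, h.inner_of_ne hy hne]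
      field_simp
      ring
    by_cases hAj : A = j
    · subst hAj
      rw [h.inner_self hy hj, h.inner_of_ne hy hne.symm, hb]
      field_simp
      ring
    · obtain ⟨p, rfl⟩ : ∃ p : Fin m, A = p.succ.succ := by
        refine forall_fin_add_two (P := fun A => A ≠ i → A ≠ j → ∃ p : Fin m, A = p.succ.succ)
          ?_ ?_ (fun p _ _ => ⟨p, rfl⟩) A hAi hAj
        · intro h1 h2; exfalso; tauto
        · intro h1 h2; exfalso; tauto
      rw [h.null y hy, h.inner_of_ne hy (Ne.symm hAi), h.inner_of_ne hy (Ne.symm hAj)]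
      ring
  · simp [inner_add_left, real_inner_smul_left, h.hyp.inner_fderiv_normal hy,
      h.hyp.normal_orthogonal y hy]

/-- The Gauss equation for the shift. -/
theorem wedge_netShift (h : NetForm F N ρ s V) (hy : y ∈ V) (X Y : Euc (m + 2)) :
    wedge (netShift F ρ s y Y) (fderiv ℝ N y X)
      = wedge (netShift F ρ s y X) (fderiv ℝ N y Y)
        + wedge (netShift F ρ s y X) (netShift F ρ s y Y) := by
  set z := netShift F ρ s y with hz
  -- Splitting the quadratic term evenly between both sides makes the Gauss equation a symmetry
  -- statement. On the pair (0, 1) both sides are wedge products of parallel vectors and vanish.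
  have key : ∀ X Y, wedge (z Y) (fderiv ℝ N y X + (1 / 2 : ℝ) • z X)
      = wedge (z X) (fderiv ℝ N y Y + (1 / 2 : ℝ) • z Y) := by
    intro X Y
    ext1 v
    refine linearMap_symm_of_coordVec (LinearMap.mk₂ ℝ (fun X Y =>
      wedge (z Y) (fderiv ℝ N y X + (1 / 2 : ℝ) • z X) v) ?_ ?_ ?_ ?_) (fun A B => ?_) X Y
    · intro X X' Y
      simp only [wedge_apply, map_add, inner_add_left, real_inner_smul_left]
      module
    · intro c X Y
      simp only [wedge_apply, map_smul, inner_add_left, real_inner_smul_left]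
      module
    · intro X Y Y'
      simp only [wedge_apply, map_add, inner_add_left, real_inner_smul_left]
      module
    · intro c X Y
      simp only [wedge_apply, map_smul, inner_add_left, real_inner_smul_left]
      module
    simp only [LinearMap.mk₂_apply]
    refine forall_fin_add_two_of_symm (P := fun A B =>
      wedge (z (coordVec B)) (fderiv ℝ N y (coordVec A) + (1 / 2 : ℝ) • z (coordVec A)) v
      = wedge (z (coordVec A)) (fderiv ℝ N y (coordVec B) + (1 / 2 : ℝ) • z (coordVec B)) v)
      (fun _ _ h => h.symm) (fun _ => rfl) ?_ (fun A p => ?_) A B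
    · rw [hz, h.fderiv_normal_add_netShift hy (Or.inl ⟨rfl, rfl⟩),
        h.fderiv_normal_add_netShift hy (Or.inr ⟨rfl, rfl⟩), netShift_zero, netShift_one]
      simp only [wedge_apply, real_inner_smul_left]
      module
    · rw [hz, netShift_succ_succ, h.fderiv_normal_null hy]
      simp [wedge_apply]
  have h1 := key X Y
  ext1 v
  have h2 := congrArg (fun L => L v) h1
  simp only [wedge_apply, inner_add_left, real_inner_smul_left, add_apply] at h2 ⊢
  rw [← sub_eq_zero] at h2 ⊢
  rw [← h2]
  module

end NetForm

end Bonnet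

end


/-! ### Existence of a Bonnet associate from an A-net -/

open scoped ContDiff Topology

noncomputable section

namespace Bonnet

section Invariance

variable {n : ℕ} {F N F' N' : Euc n → Euc (n + 1)} {V W : Set (Euc n)} {x : Euc n}

theorem IsHypersurface.meanCurvature_eq_trace (hF : IsHypersurface F N V) (hx : x ∈ V)
    {A : Euc n →L[ℝ] Euc n} (hA : ∀ X, fderiv ℝ F x (A X) = -fderiv ℝ N x X) :
    meanCurvature F N x = opTrace n A / n := by
  rw [meanCurvature, hF.shapeMatrix_eq_toMatrix hx hA, ← LinearMap.trace_eq_matrix_trace ℝ,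
    opTrace_apply]

/-- The mean curvature does not depend on the parametrization. -/
theorem IsHypersurface.meanCurvature_comp {φ : Euc n → Euc n} (hF : IsHypersurface F N V)
    (hG : IsHypersurface (F ∘ φ) (N ∘ φ) W) (hx : x ∈ W) (hφx : φ x ∈ V)
    (hφ : DifferentiableAt ℝ φ x) {ψ : Euc n →L[ℝ] Euc n} (hψ : ∀ w, fderiv ℝ φ x (ψ w) = w) :
    meanCurvature (F ∘ φ) (N ∘ φ) x = meanCurvature F N (φ x) := by
  set A := -(tangentCoord F N (φ x) ∘L fderiv ℝ N (φ x)) with hA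
  have hAF := hF.fderiv_neg_tangentCoord hφx
  have hAG : ∀ X, fderiv ℝ (F ∘ φ) x ((ψ ∘L A ∘L fderiv ℝ φ x) X) = -fderiv ℝ (N ∘ φ) x X := by
    intro X
    rw [fderiv_comp x (hF.differentiableAt hφx) hφ, fderiv_comp x (hF.differentiableAt_normal hφx) hφ]
    simp only [ContinuousLinearMap.comp_apply]
    rw [hψ, hAF]
  rw [hG.meanCurvature_eq_trace hx hAG, hF.meanCurvature_eq_trace hφx hAF, ← hA, opTrace_apply,
    opTrace_apply]
  have h1 : (ψ ∘L A ∘L fderiv ℝ φ x).toLinearMap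
      = ψ.toLinearMap ∘ₗ (A.toLinearMap ∘ₗ (fderiv ℝ φ x).toLinearMap) := rfl
  have h2 : (A.toLinearMap ∘ₗ (fderiv ℝ φ x).toLinearMap) ∘ₗ ψ.toLinearMap = A.toLinearMap := by
    ext1 w
    simp [hψ]
  rw [h1, LinearMap.trace_comp_comm', h2]

/-- A rigid motion changes the second fundamental form at most by a sign. -/
theorem IsHypersurface.exists_secondForm_eq (hF : IsHypersurface F N V)
    (hF' : IsHypersurface F' N' V) {Φ : Euc (n + 1) ≃ᵃⁱ[ℝ] Euc (n + 1)}
    (hΦ : ∀ x ∈ V, F' x = Φ (F x)) (hx : x ∈ V) :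
    ∃ τ : ℝ, secondForm F' N' x = τ • secondForm F N x := by
  set L : Euc (n + 1) →L[ℝ] Euc (n + 1) :=
    Φ.linearIsometryEquiv.toContinuousLinearEquiv.toContinuousLinearMap with hL
  have hLL : ∀ v w, inner ℝ (L v) (L w) = inner ℝ v w := fun v w =>
    Φ.linearIsometryEquiv.inner_map_map v w
  have hΦL : ∀ v, Φ v = L v + Φ 0 := fun v => by
    have := Φ.map_vadd 0 v
    rw [vadd_eq_add, vadd_eq_add, add_zero] at this
    exact this
  have hd : ∀ y ∈ V, fderiv ℝ F' y = L ∘L fderiv ℝ F y := fun y hy => by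
    rw [fderiv_eq_of_eqOn hF.isOpen (fun z hz => (hΦ z hz).trans (hΦL (F z))) hy, fderiv_add_const]
    exact (L.hasFDerivAt.comp y (hF.differentiableAt hy).hasFDerivAt).fderiv
  have hdd : ∀ X Y, fderiv ℝ (fderiv ℝ F') x X Y = L (fderiv ℝ (fderiv ℝ F) x X Y) := by
    intro X Y
    have dT := hF.differentiableAt_fderiv hx
    rw [← fderiv_clm_apply_const (hF'.differentiableAt_fderiv hx), ← fderiv_clm_apply_const dT,
      fderiv_eq_of_eqOn hF.isOpen (fun z hz => congrArg (fun L => L Y) (hd z hz)) hx]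
    exact congrArg (fun L => L X) (L.hasFDerivAt.comp x
      (dT.clm_apply (differentiableAt_const Y)).hasFDerivAt).fderiv
  set t : ℝ := inner ℝ (L (N x)) (N' x) with ht
  have hLN : L (N x) = t • N' x := by
    refine hF'.eq_of_inner_eq hx (fun X => ?_) ?_
    · rw [hd x hx, ContinuousLinearMap.comp_apply, hLL, real_inner_comm,
        hF.normal_orthogonal x hx, real_inner_smul_left, real_inner_comm,
        ← ContinuousLinearMap.comp_apply, ← hd x hx, hF'.normal_orthogonal x hx, mul_zero]
    · rw [real_inner_smul_left, hF'.inner_normal_self hx, mul_one]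
  have htt : t * t = 1 := by
    have h1 := hLL (N x) (N x)
    rw [hF.inner_normal_self hx, hLN, real_inner_smul_left, real_inner_smul_right,
      hF'.inner_normal_self hx] at h1
    linarith
  have hN' : N' x = t • L (N x) := by rw [hLN, smul_smul, htt, one_smul]
  refine ⟨t, ?_⟩
  ext A B
  rw [secondForm, Matrix.of_apply, hdd, hN', real_inner_smul_right, hLL]
  rfl

end Invariance

section Associate

variable {m : ℕ} {F N : Euc (m + 2) → Euc (m + 2 + 1)} {ρ : Euc (m + 2) → ℝ} {s : ℝ}
  {V : Set (Euc (m + 2))} {y₀ : Euc (m + 2)}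

/-- A hypersurface parametrized by a net has an isometric deformation that preserves the mean
curvature and changes the sign of `b₁₂`. -/
theorem NetForm.exists_isometricPair (h : NetForm F N ρ s V) (hs : s ≠ 0) (hρ : IsWeight ρ)
    (hy₀ : y₀ ∈ V) : ∃ r > 0, Metric.ball y₀ r ⊆ V ∧ ∃ F' N' : Euc (m + 2) → Euc (m + 2 + 1),
      IsometricPair F N F' N' (Metric.ball y₀ r) ∧
      (∀ y ∈ Metric.ball y₀ r, meanCurvature F' N' y = meanCurvature F N y) ∧
      ∀ y ∈ Metric.ball y₀ r, secondForm F' N' y 0 1 = -(s * ρ y) := by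
  obtain ⟨r, hr, hball, F', N', R, hp, hRR, hdF, hdN⟩ := h.hyp.exists_deformation
    (h.contDiffOn_netShift hρ) (fun y hy => h.inner_netShift_normal hy)
    (fun y hy => h.inner_netShift_comm hy) (fun y hy => h.inner_fderiv_netShift_comm hs hρ hy)
    (fun y hy => h.wedge_netShift hy) hy₀
  refine ⟨r, hr, hball, F', N', hp, fun y hy => ?_, fun y hy => ?_⟩
  · have hyV := hball hy
    set A := -(tangentCoord F N y ∘L fderiv ℝ N y) with hA
    have hAF := h.hyp.fderiv_neg_tangentCoord hyV
    set K := tangentCoord F N y ∘L netShift F ρ s y with hK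
    have hAF' : ∀ X, fderiv ℝ F' y ((A - K) X) = -fderiv ℝ N' y X := by
      intro X
      rw [hdF y hy, hdN y hy, sub_apply, map_sub, hAF, hK, ContinuousLinearMap.comp_apply,
        h.hyp.fderiv_tangentCoord_of_inner_eq_zero hyV
          (by rw [real_inner_comm, h.inner_netShift_normal hyV]), ← neg_add', map_neg]
    -- The shift exchanges the first two coordinate directions up to scale and kills the others, so
    -- its diagonal is zero and the mean curvature does not change.
    have hK0 : opTrace (m + 2) K = 0 := by
      rw [opTrace_eq_sum K (EuclideanSpace.basisFun (Fin (m + 2)) ℝ)]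
      refine Finset.sum_eq_zero fun i _ => ?_
      rw [EuclideanSpace.basisFun_apply]
      change inner ℝ (coordVec i) (K (coordVec i)) = 0
      refine forall_fin_add_two (P := fun i => inner ℝ (coordVec i) (K (coordVec i)) = 0)
        ?_ ?_ (fun p => ?_) i
      · rw [hK, ContinuousLinearMap.comp_apply, netShift_zero, map_smul,
          h.hyp.tangentCoord_fderiv hyV]
        rw [real_inner_smul_right]
        simp [coordVec, EuclideanSpace.inner_single_left]
      · rw [hK, ContinuousLinearMap.comp_apply, netShift_one, map_smul,
          h.hyp.tangentCoord_fderiv hyV]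
        rw [real_inner_smul_right]
        simp [coordVec, EuclideanSpace.inner_single_left]
      · rw [hK, ContinuousLinearMap.comp_apply, netShift_succ_succ, map_zero, inner_zero_right]
    rw [hp.right.meanCurvature_eq_trace hy hAF', h.hyp.meanCurvature_eq_trace hyV hAF, map_sub, hK0,
      sub_zero]
  · have hyV := hball hy
    have hE := (h.firstForm_pos hyV).ne'
    rw [secondForm, Matrix.of_apply, hp.right.inner_fderiv_fderiv_normal hy, hdF y hy, hdN y hy,
      hRR y hy, inner_add_right, netShift_zero, real_inner_smul_right,
      h.inner_self hyV (Or.inr rfl), neg_add, ← h.secondForm_eq hyV, h.mixed y hyV]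
    field_simp
    ring

variable {U : Set (Euc (m + 2))} {c : OpenPartialHomeomorph (Euc (m + 2)) (Euc (m + 2))}
  {x₀ : Euc (m + 2)}

theorem IsHypersurface.meanCurvature_comp_symm (hF : IsHypersurface F N U) (hc : IsCoordAt c U x₀)
    {y : Euc (m + 2)} (hy : y ∈ c.target) :
    meanCurvature (F ∘ c.symm) (N ∘ c.symm) y = meanCurvature F N (c.symm y) := by
  refine hF.meanCurvature_comp (hF.comp_symm hc) hy (hc.subset (c.map_target hy))
    (hc.differentiableAt_symm hy) (ψ := fderiv ℝ c (c.symm y)) fun w => ?_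
  have := hc.fderiv_symm_fderiv (c.map_target hy) w
  rwa [c.right_inv hy] at this

/-- A hypersurface with an A-net has a Bonnet associate. -/
theorem IsNetWith.isBonnetAt (h : IsNetWith F N c ρ s) (hs : s ≠ 0) (hρ : IsWeight ρ)
    (hF : IsHypersurface F N U) (hc : IsCoordAt c U x₀)
    (hH : ∀ x ∈ U, meanCurvature F N x ≠ 0) : IsBonnetAt F N U x₀ := by
  have hnet := h.netForm hF hc
  obtain ⟨r, hr, hball, F', N', hp, hmean, hb⟩ :=
    hnet.exists_isometricPair hs hρ (c.map_source hc.mem)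
  obtain ⟨c', ht, hsrc, hco, hsymm⟩ := exists_restr_target c (s := Metric.ball (c x₀) r)
    Metric.isOpen_ball
  have ht' : c'.target = Metric.ball (c x₀) r := by rw [ht, Set.inter_eq_right.2 hball]
  have hsub : c'.source ⊆ c.source := by rw [hsrc]; exact Set.inter_subset_left
  have hmem : x₀ ∈ c'.source := by
    rw [hsrc]
    exact Set.mem_inter hc.mem (Set.mem_preimage.2 (Metric.mem_ball_self hr))
  have hc' : IsCoordAt c' U x₀ := by
    refine ⟨hmem, hsub.trans hc.subset, ?_, ?_⟩
    · rw [hco]; exact hc.smooth.mono hsub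
    · rw [hsymm, ht']; exact hc.smooth_symm.mono hball
  rw [← hsymm] at hp hmean
  rw [← ht'] at hp hmean hb
  have hx₀t : c' x₀ ∈ c'.target := c'.map_source hmem
  have hG := hp.right.comp_coord hc'
  refine ⟨c'.source, c'.open_source, ?_, hmem, hc'.subset, F' ∘ c', N' ∘ c', hG, ?_, ?_, ?_⟩
  -- The domain of the associate is the image of a ball under the inverse coordinates, hence
  -- connected.
  · rw [← c'.symm_image_target_eq_source, ht']
    refine ((convex_ball _ _).isConnected ⟨_, Metric.mem_ball_self hr⟩).image _ ?_
    rw [← ht']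
    exact c'.continuousOn_symm
  · intro x hx
    have hxt := c'.map_source hx
    ext A B
    simp only [firstForm, Matrix.of_apply]
    rw [hc'.fderiv_comp_coord hx (hp.right.differentiableAt hxt),
      hc'.fderiv_comp_coord hx (hp.right.differentiableAt hxt), hp.inner_eq _ hxt]
    have hFx := hF.differentiableAt (hc'.subset (c'.map_target hxt))
    rw [hc'.fderiv_comp_symm hxt hFx, hc'.fderiv_comp_symm hxt hFx, hc'.fderiv_symm_fderiv hx,
      hc'.fderiv_symm_fderiv hx, c'.left_inv hx]
  · intro x hx
    have hxt := c'.map_source hx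
    rw [hp.right.meanCurvature_comp hG hx hxt (hc'.differentiableAt hx)
      (ψ := fderiv ℝ c'.symm (c' x)), hmean _ hxt, hF.meanCurvature_comp_symm hc' hxt,
      c'.left_inv hx]
    intro w
    have := hc'.fderiv_fderiv_symm hxt w
    rwa [c'.left_inv hx] at this
  -- A motion would give b' = τb. Comparing the nonzero mean curvatures yields τ = 1, which
  -- contradicts the reversed sign of b₁₂ = sρ ≠ 0.
  · rintro ⟨Φ, hΦ⟩
    have hΦ' : ∀ y ∈ c'.target, F' y = Φ ((F ∘ c'.symm) y) := fun y hy => by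
      have := hΦ _ (c'.map_target hy)
      rwa [Function.comp_apply, c'.right_inv hy] at this
    obtain ⟨τ, hτ⟩ := hp.left.exists_secondForm_eq hp.right hΦ' hx₀t
    have hg : firstForm F' (c' x₀) = firstForm (F ∘ c'.symm) (c' x₀) := by
      ext A B
      exact hp.inner_eq _ hx₀t _ _
    have hm := hmean _ hx₀t
    have hH' : meanCurvature (F ∘ c'.symm) (N ∘ c'.symm) (c' x₀) ≠ 0 := by
      rw [hF.meanCurvature_comp_symm hc' hx₀t]
      exact hH _ (hc'.subset (c'.map_target hx₀t))
    have hτm : meanCurvature F' N' (c' x₀)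
        = τ * meanCurvature (F ∘ c'.symm) (N ∘ c'.symm) (c' x₀) := by
      rw [meanCurvature, meanCurvature, shapeMatrix, shapeMatrix, hτ, hg, Matrix.mul_smul,
        Matrix.trace_smul, smul_eq_mul, mul_div_assoc]
    have hτ1 : τ = 1 := by
      rw [hm] at hτm
      exact mul_right_cancel₀ hH' (by rw [one_mul, ← hτm])
    rw [hτ1, one_smul] at hτ
    have hb₀ := hb _ hx₀t
    rw [hτ, hsymm, hco, hnet.mixed _ (c.map_source hc.mem)] at hb₀
    have := mul_ne_zero hs (hnet.weight_ne_zero (c.map_source hc.mem) hs hρ)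
    exact this (by linarith)

end Associate

end Bonnet

end


/-! ### Conclusion -/

theorem Bonnet.IsBonnetAssociate.exists_hasBonnetForms {m : ℕ} {U V : Set (Bonnet.Euc (m + 2))}
    {F N F' N' : Bonnet.Euc (m + 2) → Bonnet.Euc (m + 2 + 1)}
    (h : Bonnet.IsBonnetAssociate F N F' N' V) (hF : Bonnet.IsHypersurface F N U)
    (hH : ∀ x ∈ U, Bonnet.meanCurvature F N x ≠ 0)
    (hU : ∀ x ∈ U, ¬ Bonnet.IsUmbilical F N x) (hVo : IsOpen V) (hVc : IsConnected V)
    (hVU : V ⊆ U) {x₀ : Bonnet.Euc (m + 2)} (hx₀ : x₀ ∈ V) :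
    ∃ c : OpenPartialHomeomorph (Bonnet.Euc (m + 2)) (Bonnet.Euc (m + 2)),
      Bonnet.IsCoordAt c V x₀ ∧
      ∃ (ρ : Bonnet.Euc (m + 2) → ℝ) (H J θ : ℝ × ℝ → ℝ) (ε : ℝ),
        Bonnet.IsBonnetData c.target ρ H J θ ε ∧
        Bonnet.HasBonnetForms F N c ρ H J θ ε ∧
        Bonnet.HasBonnetForms F' N' c ρ H J θ (-ε) := by
  have hp : Bonnet.IsometricPair F N F' N' V := ⟨hF.mono hVo hVU, h.hypersurface,
    fun x hx => Bonnet.inner_fderiv_eq_of_firstForm_eq (h.isometric x hx)⟩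
  have hH' := fun x hx => hH x (hVU hx)
  have hs := hp.shapePair (Nat.succ_ne_zero _) h.same_mean hH'
  rcases hs.D_eq_zero_or_ne_zero (fun x hx => hU x (hVU hx)) hVc with hD | hD
  -- If D vanishes identically, the shape operators coincide and the correspondence is induced by a
  -- motion, contrary to nontriviality.
  · refine absurd (hp.exists_affineIsometryEquiv hVc fun x hx => ?_) h.nontrivial
    exact (sub_eq_zero.1 (hD x hx)).symm
  · exact hp.exists_bonnetForms h.same_mean hH' hD hx₀

theorem theorem1 (m : ℕ) (U : Set (Bonnet.Euc (m + 2)))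
    (F N : Bonnet.Euc (m + 2) → Bonnet.Euc (m + 2 + 1))
    (hF : Bonnet.IsHypersurface F N U)
    (hH : ∀ x ∈ U, Bonnet.meanCurvature F N x ≠ 0)
    (hU : ∀ x ∈ U, ¬ Bonnet.IsUmbilical F N x) :
    (∀ x₀ ∈ U, Bonnet.IsBonnetAt F N U x₀ ↔ Bonnet.HasANetAt F N U x₀) ∧
    (∀ V : Set (Bonnet.Euc (m + 2)), IsOpen V → IsConnected V → V ⊆ U →
      ∀ F' N' : Bonnet.Euc (m + 2) → Bonnet.Euc (m + 2 + 1),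
        Bonnet.IsBonnetAssociate F N F' N' V →
        ∀ x₀ ∈ V, ∃ c : OpenPartialHomeomorph (Bonnet.Euc (m + 2)) (Bonnet.Euc (m + 2)),
          Bonnet.IsCoordAt c V x₀ ∧
          ∃ (ρ : Bonnet.Euc (m + 2) → ℝ) (H J θ : ℝ × ℝ → ℝ) (ε : ℝ),
            Bonnet.IsBonnetData c.target ρ H J θ ε ∧
            Bonnet.HasBonnetForms F N c ρ H J θ ε ∧
            Bonnet.HasBonnetForms F' N' c ρ H J θ (-ε)) := by
  refine ⟨fun x₀ _ => ⟨?_, ?_⟩, fun V hVo hVc hVU F' N' h x₀ hx₀ =>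
    h.exists_hasBonnetForms hF hH hU hVo hVc hVU hx₀⟩
  · rintro ⟨V, hVo, hVc, hx₀, hVU, F', N', h⟩
    obtain ⟨c, hc, ρ, H, J, θ, ε, hdata, hforms, -⟩ :=
      h.exists_hasBonnetForms hF hH hU hVo hVc hVU hx₀
    exact ⟨c, ⟨hc.mem, hc.subset.trans hVU, hc.smooth, hc.smooth_symm⟩, ρ, ε, hdata.weight,
      hdata.sign, hforms.net⟩
  · rintro ⟨c, hc, ρ, ε, hρ, hε, hnet⟩
    refine hnet.isBonnetAt ?_ hρ hF hc hH
    rcases hε with rfl | rfl <;> norm_num
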